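/- **A network of six small resolutions.** Let $B=\operatorname{Spec}A$ be an affine scheme over $\mathbb C$, and let $w_0,\beta_0,\beta_2,\beta_3,\beta_4,\beta_5\in A$. They define the $SU(5)$ Weierstrass model $Y^2+\beta_5XY+\beta_3w_0^2Y=X^3+\beta_4w_0X^2+\beta_2w_0^3X+\beta_0w_0^5$. Consider the patch of its twofold blow-up with ambient space $M=\{xw=w_0\}\subset B\times\mathbb A^3_{x,y,w}$ and blow-down $(X,Y,w_0)=(x^2w,\,x^2wy,\,xw)$. Put $s=y+\beta_5+w\beta_3$ and $t=x+\beta_4+w\beta_2+w^2\beta_0$. In this patch the fibration is $\mathscr E=\{ys=xwt\}\subset M\to B$. Let $L_x=\{y=s=w=t=0\}$, $L_w=\{y=s=x=t=0\}$, $L_t=\{y=s=x=w=0\}$ be the three lines, $L$ their union, and $p=\{x=w=t=y=s=0\}$ their common locus. For each of the six permutations $(u_1,u_2,u_3)$ of $(x,w,t)$ let $\mathscr E_{u_1u_2}\subset M\times\mathbb P^1\times\mathbb P^1$ be the closed subscheme $$u_1\alpha_--\sigma_-y=0,\qquad u_2\alpha_+-\sigma_+s=0,\qquad \alpha_-\alpha_+-\sigma_-\sigma_+u_3=0,$$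 where $[\alpha_-:\sigma_-]$ and $[\alpha_+:\sigma_+]$ are the homogeneous coordinates of the two factors. Then: 1. The projection to $M$ factors through a proper morphism $\pi:\mathscr E_{u_1u_2}\to\mathscr E$, which is an isomorphism over $\mathscr E\setminus L$. 2. For every point $q\in L\setminus p$ the scheme-theoretic fibre $\pi^{-1}(q)$ is isomorphic to $\mathbb P^1_{\kappa(q)}$. For every $q\in p$ the fibre is reduced and is the union of two closed subschemes isomorphic to $\mathbb P^1_{\kappa(q)}$ whose scheme-theoretic intersection is one reduced $\kappa(q)$-rational point. 3. The preimage in $\mathscr E_{u_1u_2}$ of the divisor $w_0=0$ of the base is the locus $wx=0$. 4. $\mathscr E\to B$ is flat, and if $w_0,\beta_0,\beta_2,\beta_3,\beta_4,\beta_5$ have no common zero on $B$, then $\mathscr E_{u_1u_2}\to B$ is flat. 5. Let $U\subset M$ be any open subset on which $x,w,t,y,s$ are part of a local coordinate system, that is, on which $(x,w,t,y,s):U\to\mathbb A^5_{\mathbb C}$ is smooth. Then over $U$: the singular locus of $\mathscr E$ is $L$ (an open $V\subset\mathscr E\cap U$ is smooth over $\mathbb C$ if and only if $V\cap L=\emptyset$);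 $\mathscr E_{u_1u_2}$ is smooth over $\mathbb C$; and $\pi$ is small, that is, every point of $L$ has codimension at least $3$ in $\mathscr E$, and every point of the exceptional locus $\pi^{-1}(L)$ has codimension at least $2$ in $\mathscr E_{u_1u_2}$. If moreover $U$ meets $p$, then the six schemes $\mathscr E_{u_1u_2}$ are pairwise non-isomorphic over $M$. -/

import Mathlib

open CategoryTheory CategoryTheory.Limits AlgebraicGeometry

namespace SU5

noncomputable section

/-! ### The projective line and the product of two projective lines over a base scheme -/

/-- The grading by degree of `ℤ[X₀, X₁]`; `X₀ = α` and `X₁ = σ` are the homogeneous coordinates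
`[α : σ]` of the projective line. -/
abbrev grading := MvPolynomial.homogeneousSubmodule (Fin 2) ℤ

instance : GradedRing grading := MvPolynomial.gradedAlgebra

/-- The projective line over `ℤ`. -/
def P1Z : Scheme.{0} := Proj grading

/-- The projective line over a scheme `S`. -/
def P1 (S : Scheme.{0}) : Scheme.{0} := pullback (terminal.from S) (terminal.from P1Z)

/-- The structure morphism of the projective line over `S`. -/
def P1.toBase (S : Scheme.{0}) : P1 S ⟶ S := pullback.fst _ _

/-- The surface `𝔽₀ = ℙ¹ × ℙ¹` over `S`. -/
def F0 (S : Scheme.{0}) : Scheme.{0} := pullback (P1.toBase S) (P1.toBase S)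

/-- The structure morphism of `ℙ¹ × ℙ¹` over `S`. -/
def F0.toBase (S : Scheme.{0}) : F0 S ⟶ S := pullback.fst _ _ ≫ P1.toBase S

/-- The homogeneous coordinates of a point in the `i`-th standard chart of `ℙ¹`: the `i`-th
coordinate is `1`, the other one is `a`. -/
def affineCoords {R : Type} [CommRing R] (i : Fin 2) (a : R) : Fin 2 → R :=
  fun k => if k = i then 1 else a

/-- The evaluation at a point of the `i`-th chart, on degree zero fractions with denominator a
power of `X i`. -/
def evalAway {R : Type} [CommRing R] (i : Fin 2) (a : R) :
    HomogeneousLocalization.Away grading (MvPolynomial.X i) →+* R :=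
  (IsLocalization.Away.lift (S := Localization.Away (MvPolynomial.X i : MvPolynomial (Fin 2) ℤ))
    (MvPolynomial.X i) (g := MvPolynomial.eval₂Hom (Int.castRingHom R) (affineCoords i a))
    (by simp [affineCoords])).comp
    (algebraMap (HomogeneousLocalization.Away grading (MvPolynomial.X i))
      (Localization.Away (MvPolynomial.X i : MvPolynomial (Fin 2) ℤ)))

/-- The `R`-valued point of `ℙ¹` with homogeneous coordinates `affineCoords i a`, that is
`[1 : a]` for `i = 0` and `[a : 1]` for `i = 1`. -/
def affinePoint {R : Type} [CommRing R] (i : Fin 2) (a : R) :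
    Spec (CommRingCat.of R) ⟶ P1Z :=
  Spec.map (CommRingCat.ofHom (evalAway i a)) ≫
    Proj.awayι grading (MvPolynomial.X i) (MvPolynomial.isHomogeneous_X ℤ i) Nat.one_pos

/-! ### The zero scheme of the three bihomogeneous equations -/

section Equations

variable {C : Type} [CommRing C]

/-- The morphism `Spec C[a, b] ⟶ Spec C` of the affine plane over `C`. -/
def planeToBase (C : Type) [CommRing C] :
    Spec (CommRingCat.of (MvPolynomial (Fin 2) C)) ⟶ Spec (CommRingCat.of C) :=
  Spec.map (CommRingCat.ofHom MvPolynomial.C)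

/-- The standard chart `(i, j)` of `ℙ¹ × ℙ¹` over `C`: the affine plane with coordinates
`a = X 0` on the first factor and `b = X 1` on the second one. -/
def chart (C : Type) [CommRing C] (i j : Fin 2) :
    Spec (CommRingCat.of (MvPolynomial (Fin 2) C)) ⟶ F0 (Spec (CommRingCat.of C)) :=
  pullback.lift
    (pullback.lift (planeToBase C) (affinePoint i (MvPolynomial.X 0)) (terminal.hom_ext _ _))
    (pullback.lift (planeToBase C) (affinePoint j (MvPolynomial.X 1)) (terminal.hom_ext _ _))
    ((pullback.lift_fst _ _ _).trans (pullback.lift_fst _ _ _).symm)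

/-- The equations `u₁ α₋ - σ₋ v₁ = u₂ α₊ - σ₊ v₂ = α₋ α₊ - σ₋ σ₊ u₃ = 0` in the chart `(i, j)`,
where `[α₋ : σ₋]` and `[α₊ : σ₊]` are the coordinates of the two factors. -/
def chartIdeal (u₁ u₂ u₃ v₁ v₂ : C) (i j : Fin 2) : Ideal (MvPolynomial (Fin 2) C) :=
  let p : Fin 2 → MvPolynomial (Fin 2) C := affineCoords i (MvPolynomial.X 0)
  let q : Fin 2 → MvPolynomial (Fin 2) C := affineCoords j (MvPolynomial.X 1)
  Ideal.span {MvPolynomial.C u₁ * p 0 - p 1 * MvPolynomial.C v₁,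
    MvPolynomial.C u₂ * q 0 - q 1 * MvPolynomial.C v₂,
    p 0 * q 0 - p 1 * q 1 * MvPolynomial.C u₃}

/-- The zero scheme of the equations in the chart `(i, j)`, as a locally closed subscheme of
`ℙ¹ × ℙ¹`. -/
def chartZeros (u₁ u₂ u₃ v₁ v₂ : C) (i j : Fin 2) :
    Spec (CommRingCat.of (MvPolynomial (Fin 2) C ⧸ chartIdeal u₁ u₂ u₃ v₁ v₂ i j)) ⟶
      F0 (Spec (CommRingCat.of C)) :=
  Spec.map (CommRingCat.ofHom (Ideal.Quotient.mk (chartIdeal u₁ u₂ u₃ v₁ v₂ i j))) ≫ chart C i j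

/-- The ideal sheaf on `ℙ¹ × ℙ¹` over `C` generated by the three bihomogeneous equations
`u₁ α₋ - σ₋ v₁`, `u₂ α₊ - σ₊ v₂`, `α₋ α₊ - σ₋ σ₊ u₃`. A section belongs to it iff its restriction
to each of the four standard charts lies in the ideal generated there by the dehomogenized
equations; since these ideals agree on the overlaps of the charts, the restriction of this ideal
sheaf to the chart `(i, j)` is the one given by `chartIdeal`. -/
def zeroIdeal (u₁ u₂ u₃ v₁ v₂ : C) : (F0 (Spec (CommRingCat.of C))).IdealSheafData :=
  ⨅ ij : Fin 2 × Fin 2, (chartZeros u₁ u₂ u₃ v₁ v₂ ij.1 ij.2).ker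

end Equations

/-! ### The fibration near its higher codimension singularities -/

/-- The local data of an `SU(5)` model over an affine base `Spec A` on which the line bundles are
trivialized: a function `w₀` whose zero locus is the divisor carrying the gauge group, and the
coefficients of the Weierstrass equation
`Y² + β₅ X Y + β₃ w₀² Y = X³ + β₄ w₀ X² + β₂ w₀³ X + β₀ w₀⁵`. -/
structure Model (A : Type) where
  w₀ : A
  β₀ : A
  β₂ : A
  β₃ : A
  β₄ : A
  β₅ : A

namespace Model

variable {A : Type} [CommRing A] (m : Model A)

/-- The coordinate ring `A[x, y, w] / (x w - w₀)` of the ambient space of the patch of the twofold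
blow-up in which the remaining singularities lie; the blow-down is
`(X, Y, w₀) = (x² w, x² w y, x w)`. -/
abbrev PatchRing : Type :=
  MvPolynomial (Fin 3) A ⧸
    Ideal.span {(MvPolynomial.X 0 * MvPolynomial.X 2 - MvPolynomial.C m.w₀ :
      MvPolynomial (Fin 3) A)}

def x : m.PatchRing := Ideal.Quotient.mk _ (MvPolynomial.X 0)

def y : m.PatchRing := Ideal.Quotient.mk _ (MvPolynomial.X 1)

def w : m.PatchRing := Ideal.Quotient.mk _ (MvPolynomial.X 2)

/-- `s = y + β₅ + w β₃`. -/
def s : m.PatchRing := m.y + algebraMap A _ m.β₅ + m.w * algebraMap A _ m.β₃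

/-- `t = x + β₄ + w β₂ + w² β₀`. -/
def t : m.PatchRing :=
  m.x + algebraMap A _ m.β₄ + m.w * algebraMap A _ m.β₂ + m.w ^ 2 * algebraMap A _ m.β₀

/-- The three functions `(x, w, t)`. -/
def u : Fin 3 → m.PatchRing := ![m.x, m.w, m.t]

/-- The ambient space of the patch. -/
abbrev patch : Scheme.{0} := Spec (CommRingCat.of m.PatchRing)

/-- The projection of the patch to the base. -/
def patchToBase : m.patch ⟶ Spec (CommRingCat.of A) :=
  Spec.map (CommRingCat.ofHom (algebraMap A m.PatchRing))

/-- The coordinate ring of the singular fibration `y s - x w t = 0` in the patch. -/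
abbrev FibrationRing : Type :=
  m.PatchRing ⧸ Ideal.span {m.y * m.s - m.x * m.w * m.t}

/-- The singular fibration `ℰ : y s - x w t = 0` in the patch. -/
abbrev fibration : Scheme.{0} := Spec (CommRingCat.of m.FibrationRing)

/-- The closed immersion of the fibration in the patch. -/
def fibrationι : m.fibration ⟶ m.patch :=
  Spec.map (CommRingCat.ofHom (Ideal.Quotient.mk _))

/-- The line `L_x : y = s = w = t = 0` for `i = 0`, `L_w : y = s = x = t = 0` for `i = 1`,
`L_t : y = s = x = w = 0` for `i = 2`. -/
def line (i : Fin 3) : Set m.patch :=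
  PrimeSpectrum.zeroLocus ({m.y, m.s} ∪ m.u '' {i}ᶜ)

/-- The union of the three lines. -/
def lines : Set m.patch := ⋃ i, m.line i

/-- The common point (in a family) `x = w = t = y = s = 0` of the three lines. -/
def triple : Set m.patch := PrimeSpectrum.zeroLocus {m.x, m.w, m.t, m.y, m.s}

lemma isClosed_lines : IsClosed m.lines :=
  isClosed_iUnion_of_finite fun _ => PrimeSpectrum.isClosed_zeroLocus _

/-- The open part of the fibration off the three lines. -/
def offLines : m.fibration.Opens :=
  ⟨m.fibrationι ⁻¹' m.linesᶜ, (m.isClosed_lines.preimage m.fibrationι.continuous).isOpen_compl⟩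

/-- For a permutation `(u₁, u₂, u₃)` of `(x, w, t)`, the subscheme
`ℰ_{u₁u₂} : u₁ α₋ - σ₋ y = u₂ α₊ - σ₊ s = α₋ α₊ - σ₋ σ₊ u₃ = 0` of the product of the patch with
`ℙ¹ × ℙ¹`. -/
def resolution (e : Equiv.Perm (Fin 3)) : Scheme.{0} :=
  (zeroIdeal (m.u (e 0)) (m.u (e 1)) (m.u (e 2)) m.y m.s).subscheme

/-- The projection of `ℰ_{u₁u₂}` to the patch. -/
def resolutionToPatch (e : Equiv.Perm (Fin 3)) : m.resolution e ⟶ m.patch :=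
  (zeroIdeal (m.u (e 0)) (m.u (e 1)) (m.u (e 2)) m.y m.s).subschemeι ≫ F0.toBase _

variable [Algebra ℂ A]

/-- The morphism `(x, w, t, y, s)` from the patch to the affine space `ℂ⁵`. -/
def coords : m.patch ⟶ Spec (CommRingCat.of (MvPolynomial (Fin 5) ℂ)) :=
  Spec.map (CommRingCat.ofHom (MvPolynomial.aeval ![m.x, m.w, m.t, m.y, m.s] :
    MvPolynomial (Fin 5) ℂ →ₐ[ℂ] m.PatchRing).toRingHom)

/-- The structure morphism of the patch over the complex numbers. -/
def patchToC : m.patch ⟶ Spec (CommRingCat.of ℂ) :=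
  Spec.map (CommRingCat.ofHom (algebraMap ℂ m.PatchRing))

end Model

/-- A scheme `F` over `S` (in the applications, the spectrum of a field) that consists of two
projective lines meeting at one point: it is reduced, it is the union of two closed subschemes
isomorphic to the projective line, and the scheme-theoretic intersection of these is one reduced
rational point. -/
def IsTwoLinesMeetingAtPoint {F S : Scheme.{0}} (f : F ⟶ S) : Prop :=
  IsReduced F ∧ ∃ i j : P1 S ⟶ F, i ≫ f = P1.toBase S ∧ j ≫ f = P1.toBase S ∧
    IsClosedImmersion i ∧ IsClosedImmersion j ∧
    Set.range i ∪ Set.range j = Set.univ ∧ IsIso (pullback.fst i j ≫ P1.toBase S)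

end

end SU5

namespace SU5

noncomputable section

section

/-! ### Points of the projective line -/

/-! Everything is done with functors of points. A morphism `T ⟶ P1Z` landing in one standard chart
is `pt i a` for a unique global section `a`, and two such morphisms agree iff the cross product of
their coordinates vanishes (`pt_eq_pt_iff`). Since the three equations are bihomogeneous, being a
zero of them does not depend on the charts used, and the closed subscheme cut out by `zeroIdeal`
represents the zeros (`isZeroScheme_zeroIdeal`). Base change, gluing and the symmetry between the
two factors then become formal.

Write `(v₁, v₂) = (y, s)`. Any zero forces `v₁ v₂ = u₁ u₂ u₃`, so the projection factors through ℰ.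
If one of `v₁, v₂, u₁u₂, u₁u₃, u₂u₃` is invertible, there is exactly one zero over each such base
(`uniqueZero_of_isUnit`). The points of ℰ where all five vanish are exactly those of the lines, so
`π` is an isomorphism elsewhere. Over a residue field at a point of one line only one `uᵢ` survives
and the equations leave a ℙ¹; at a triple point they reduce to `α₋ α₊ = 0`, two lines meeting in
`([0 : 1], [0 : 1])`.

For the local geometry, three of the four charts cover, and each is the base change along `(u₁, u₂,
u₃, v₁, v₂)` of a monomial map `𝔸⁴ ⟶ 𝔸⁵`, for instance `(u₁, u₂, a, b) ↦ (u₁, u₂, ab, u₁a, u₂b)`.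
Where these five functions are smooth coordinates, the charts are smooth over `𝔸⁴`, hence over `ℂ`,
and questions about local rings descend to polynomial rings along flat maps. Going-down bounds
dimensions from below. Descent of divisibility separates the resolutions: on `ℰ_{u₁u₂}` the pairs
`(u₁, y)` and `(u₂, s)` are comparable for divisibility at every point, whereas near a triple point
no other pair `(uᵢ, y)` or `(uᵢ, s)` is, so the pattern recovers the permutation. That ℰ is singular
along the lines is an infinitesimal lifting argument in the style of the Jacobian criterion
(`eq_zero_of_formallySmooth`).

For flatness, `y` (or `s`) is a free variable over `A[x, w] / (xw - w₀)`. After elimination ℰ and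
each chart become a free `A`-algebra modulo one function, which is flat as soon as that function is
a nonzerodivisor modulo every maximal ideal of `A` (`flat_quotient_span_singleton`). Nonzerodivisors
are tested by maps to Laurent polynomial rings, one for each branch of a hyperbola `ab = c`, which
together detect the fibre (`HyperbolaRing.mem_map_of_laurent`). The absence of common zeros of the
coefficients prevents the tested functions from vanishing on a branch. -/

lemma eval₂_smul_of_mem_grading {R : Type} [CommRing R] (g : ℤ →+* R) (c : R) (v : Fin 2 → R)
    {n : ℕ} {f : MvPolynomial (Fin 2) ℤ} (hf : f ∈ grading n) :
    f.eval₂ g (fun k => c * v k) = c ^ n * f.eval₂ g v := by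
  rw [MvPolynomial.eval₂_eq', MvPolynomial.eval₂_eq', Finset.mul_sum]
  refine Finset.sum_congr rfl fun d hd => ?_
  have hdeg : ∑ k, d k = n := by
    rw [← Finsupp.degree_eq_sum, Finsupp.degree_eq_weight_one]
    exact hf (MvPolynomial.mem_support_iff.mp hd)
  simp only [mul_pow, Finset.prod_mul_distrib, Finset.prod_pow_eq_pow_sum, hdeg]
  ring

lemma X_mem_grading (i : Fin 2) : (MvPolynomial.X i : MvPolynomial (Fin 2) ℤ) ∈ grading 1 :=
  MvPolynomial.isHomogeneous_X ℤ i

lemma affineCoords_self {R : Type} [CommRing R] (i : Fin 2) (a : R) : affineCoords i a i = 1 :=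
  if_pos rfl

/-- The coordinate `X (1 - i) / X i` of the `i`-th chart. -/
abbrev frac (i : Fin 2) : HomogeneousLocalization.Away grading (MvPolynomial.X i) :=
  HomogeneousLocalization.Away.isLocalizationElem (𝒜 := grading)
    (X_mem_grading i) (X_mem_grading (1 - i))

lemma evalAway_mk {R : Type} [CommRing R] (i : Fin 2) (a : R) (n : ℕ)
    (f : MvPolynomial (Fin 2) ℤ) (hf : f ∈ grading (n • 1)) :
    evalAway i a (HomogeneousLocalization.Away.mk grading (X_mem_grading i) n f hf)
      = f.eval₂ (Int.castRingHom R) (affineCoords i a) := by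
  set z := HomogeneousLocalization.Away.mk grading (X_mem_grading i) n f hf
  have hz : z.val * algebraMap (MvPolynomial (Fin 2) ℤ)
      (Localization.Away (MvPolynomial.X i : MvPolynomial (Fin 2) ℤ)) (MvPolynomial.X i ^ n) =
      algebraMap (MvPolynomial (Fin 2) ℤ) _ f := by
    rw [show z.val = Localization.mk f (⟨MvPolynomial.X i ^ n, n, rfl⟩ :
        Submonoid.powers (MvPolynomial.X i : MvPolynomial (Fin 2) ℤ)) from rfl,
      Localization.mk_eq_mk']
    exact IsLocalization.mk'_spec _ _ _
  have := congrArg (IsLocalization.Away.lift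
    (S := Localization.Away (MvPolynomial.X i : MvPolynomial (Fin 2) ℤ))
    (MvPolynomial.X i : MvPolynomial (Fin 2) ℤ) (g := MvPolynomial.eval₂Hom (Int.castRingHom R) (affineCoords i a))
    (by simp [affineCoords_self])) hz
  rw [map_mul, IsLocalization.Away.lift_eq, IsLocalization.Away.lift_eq] at this
  simp only [map_pow, MvPolynomial.coe_eval₂Hom, MvPolynomial.eval₂_X] at this
  have h1 : affineCoords i a i ^ n = 1 := by rw [affineCoords_self, one_pow]
  exact ((mul_one _).symm.trans (congrArg _ h1.symm)).trans this

lemma evalAway_frac {R : Type} [CommRing R] (i : Fin 2) (a : R) : evalAway i a (frac i) = a := by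
  refine (evalAway_mk i a 1 _ _).trans ?_
  fin_cases i <;> simp [affineCoords]

/-- By homogeneity, a form `f` of degree `n` satisfies `f / X_i ^ n = f(T)`, where `T` has `i`-th
coordinate `1` and other coordinate `frac i`. So `frac i` generates the chart ring over ℤ. -/
lemma awayHom_ext {R : Type} [CommRing R] {i : Fin 2}
    {ψ ψ' : HomogeneousLocalization.Away grading (MvPolynomial.X i) →+* R}
    (h : ψ (frac i) = ψ' (frac i)) : ψ = ψ' := by
  let A := HomogeneousLocalization.Away grading (MvPolynomial.X i)
  let T : Fin 2 → A := affineCoords i (frac i)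
  have key : ∀ z : A, ∃ f : MvPolynomial (Fin 2) ℤ, z = f.eval₂ (Int.castRingHom A) T := by
    intro z
    obtain ⟨n, f, hf, rfl⟩ := HomogeneousLocalization.Away.mk_surjective
      (𝒜 := grading) (X_mem_grading i) z
    refine ⟨f, HomogeneousLocalization.val_injective _ ?_⟩
    set L := Localization (Submonoid.powers (MvPolynomial.X i : MvPolynomial (Fin 2) ℤ))
    have hu : IsUnit (algebraMap (MvPolynomial (Fin 2) ℤ) L (MvPolynomial.X i)) :=
      IsLocalization.Away.algebraMap_isUnit _
    have h1 : (f.eval₂ (Int.castRingHom A) T).val =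
        f.eval₂ (Int.castRingHom L) (fun k => algebraMap A L (T k)) := by
      have := MvPolynomial.eval₂_comp_left (algebraMap A L) (Int.castRingHom A) T f
      refine this.trans ?_
      congr 1
      exact RingHom.ext_int _ _
    have h2 : ∀ k, algebraMap (MvPolynomial (Fin 2) ℤ) L (MvPolynomial.X i) * algebraMap A L (T k) =
        algebraMap (MvPolynomial (Fin 2) ℤ) L (MvPolynomial.X k) := by
      intro k
      by_cases hk : k = i
      · subst hk
        simp [T, affineCoords]
      · have hk' : k = 1 - i := by omega
        subst hk'
        simp only [T, affineCoords, if_neg hk]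
        rw [show algebraMap A L (frac i) = Localization.mk (MvPolynomial.X (1 - i) ^ 1)
          (⟨MvPolynomial.X i ^ 1, 1, rfl⟩ :
        Submonoid.powers (MvPolynomial.X i : MvPolynomial (Fin 2) ℤ)) from rfl, Localization.mk_eq_mk', mul_comm]
        have := IsLocalization.mk'_spec L (MvPolynomial.X (1 - i) ^ 1)
          (⟨MvPolynomial.X i ^ 1, 1, rfl⟩ :
            Submonoid.powers (MvPolynomial.X i : MvPolynomial (Fin 2) ℤ))
        simp only [pow_one] at this ⊢
        exact this
    rw [h1, show (HomogeneousLocalization.Away.mk grading (X_mem_grading i) n f hf).val =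
      Localization.mk f (⟨MvPolynomial.X i ^ n, n, rfl⟩ :
        Submonoid.powers (MvPolynomial.X i : MvPolynomial (Fin 2) ℤ)) from rfl, Localization.mk_eq_mk',
      IsLocalization.mk'_eq_iff_eq_mul]
    have h3 := eval₂_smul_of_mem_grading (Int.castRingHom L)
      (algebraMap (MvPolynomial (Fin 2) ℤ) L (MvPolynomial.X i)) (fun k => algebraMap A L (T k)) hf
    simp only [h2] at h3
    rw [map_pow, mul_comm]
    simp only [smul_eq_mul, mul_one] at h3
    rw [← h3]
    have := MvPolynomial.eval₂_comp_left (algebraMap (MvPolynomial (Fin 2) ℤ) L)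
      (Int.castRingHom _) MvPolynomial.X f
    rw [show Int.castRingHom (MvPolynomial (Fin 2) ℤ) = MvPolynomial.C from
      RingHom.ext_int _ _, MvPolynomial.eval₂_eta] at this
    rw [this]
    congr 1
    exact RingHom.ext_int _ _
  ext z
  obtain ⟨f, rfl⟩ := key z
  have hT : ∀ k, ψ (T k) = ψ' (T k) := by
    intro k
    by_cases hk : k = i <;> simp [T, affineCoords, hk, h]
  rw [MvPolynomial.eval₂_comp_left ψ, MvPolynomial.eval₂_comp_left ψ']
  congr 1
  · exact RingHom.ext_int _ _
  · exact funext hT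

lemma eq_evalAway {R : Type} [CommRing R] {i : Fin 2}
    (ψ : HomogeneousLocalization.Away grading (MvPolynomial.X i) →+* R) :
    ψ = evalAway i (ψ (frac i)) :=
  awayHom_ext (evalAway_frac i _).symm

/-- The standard open subset `X i ≠ 0` of the projective line. -/
def P1Z.U (i : Fin 2) : P1Z.Opens := Proj.basicOpen grading (MvPolynomial.X i)

lemma adjoin_X_eq_top : Algebra.adjoin (grading 0)
    (Set.range fun i : Fin 2 => (MvPolynomial.X i : MvPolynomial (Fin 2) ℤ)) = ⊤ := by
  refine eq_top_iff.mpr fun f _ => ?_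
  induction f using MvPolynomial.induction_on with
  | C n => simp
  | add p q hp hq => exact add_mem (hp trivial) (hq trivial)
  | mul_X p i hp => exact mul_mem (hp trivial) (Algebra.subset_adjoin ⟨i, rfl⟩)

lemma P1Z.iSup_U : ⨆ i, P1Z.U i = ⊤ :=
  Proj.iSup_basicOpen_eq_top' grading (fun i : Fin 2 => MvPolynomial.X i)
    (fun i => ⟨1, X_mem_grading i⟩) adjoin_X_eq_top

end

/-! ### Scheme-valued points of the projective line and their coordinates -/

section

/-- The open immersion of the `i`-th chart of the projective line. -/
def chartι (i : Fin 2) :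
    Spec (CommRingCat.of (HomogeneousLocalization.Away grading (MvPolynomial.X i))) ⟶ P1Z :=
  Proj.awayι grading (MvPolynomial.X i) (X_mem_grading i) Nat.one_pos

instance (i : Fin 2) : IsOpenImmersion (chartι i) :=
  inferInstanceAs (IsOpenImmersion (Proj.awayι grading (MvPolynomial.X i) _ _))

lemma opensRange_chartι (i : Fin 2) : (chartι i).opensRange = P1Z.U i :=
  Proj.opensRange_awayι grading _ (X_mem_grading i) Nat.one_pos

lemma chartι_preimage (i : Fin 2) : chartι i ⁻¹ᵁ P1Z.U (1 - i) = PrimeSpectrum.basicOpen (frac i) :=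
  Proj.awayι_preimage_basicOpen grading (X_mem_grading i) Nat.one_pos (X_mem_grading (1 - i))
    Nat.one_pos

lemma affinePoint_eq {R : Type} [CommRing R] (i : Fin 2) (a : R) :
    affinePoint i a = Spec.map (CommRingCat.ofHom (evalAway i a)) ≫ chartι i := rfl

lemma SpecMap_affinePoint {R S : Type} [CommRing R] [CommRing S] (φ : R →+* S) (i : Fin 2) (a : R) :
    Spec.map (CommRingCat.ofHom φ) ≫ affinePoint i a = affinePoint i (φ a) := by
  rw [affinePoint_eq, affinePoint_eq, ← Category.assoc, ← Spec.map_comp, ← CommRingCat.ofHom_comp,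
    awayHom_ext (ψ := φ.comp (evalAway i a)) (ψ' := evalAway i (φ a))]
  simp only [RingHom.comp_apply, evalAway_frac]

variable {T T' : Scheme.{0}}

/-- The `T`-valued point of the projective line with homogeneous coordinates `affineCoords i a`. -/
def pt (i : Fin 2) (a : Γ(T, ⊤)) : T ⟶ P1Z := T.toSpecΓ ≫ affinePoint (R := Γ(T, ⊤)) i a

lemma comp_pt (g : T' ⟶ T) (i : Fin 2) (a : Γ(T, ⊤)) : g ≫ pt i a = pt i (g.appTop a) := by
  rw [pt, pt, ← Category.assoc, Scheme.toSpecΓ_naturality, Category.assoc]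
  congr 1
  exact SpecMap_affinePoint g.appTop.hom i a

/-- The ring homomorphism on global sections given by a morphism to an affine scheme. -/
def toΓ {R : Type} [CommRing R] (g : T ⟶ Spec (CommRingCat.of R)) : R →+* Γ(T, ⊤) :=
  ((Scheme.ΓSpecIso (CommRingCat.of R)).inv ≫ g.appTop).hom

lemma eq_toΓ {R : Type} [CommRing R] (g : T ⟶ Spec (CommRingCat.of R)) :
    g = T.toSpecΓ ≫ Spec.map (CommRingCat.ofHom (toΓ g)) := by
  have := Scheme.toSpecΓ_naturality g
  rw [show CommRingCat.ofHom (toΓ g) = (Scheme.ΓSpecIso (CommRingCat.of R)).inv ≫ g.appTop from rfl,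
    Spec.map_comp, ← Category.assoc, ← this, Category.assoc]
  simp

lemma toΓ_ext {R : Type} [CommRing R] {g g' : T ⟶ Spec (CommRingCat.of R)}
    (h : ∀ r, toΓ g r = toΓ g' r) : g = g' := by
  rw [eq_toΓ g, eq_toΓ g', RingHom.ext h]

/-- The morphism to an affine scheme given by a ring homomorphism to global sections. -/
def ofΓ {R : Type} [CommRing R] (φ : R →+* Γ(T, ⊤)) : T ⟶ Spec (CommRingCat.of R) :=
  T.toSpecΓ ≫ Spec.map (CommRingCat.ofHom φ)

@[simp]
lemma toΓ_ofΓ {R : Type} [CommRing R] (φ : R →+* Γ(T, ⊤)) : toΓ (ofΓ φ) = φ := by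
  ext r
  simp [toΓ, ofΓ]

lemma toΓ_comp {R : Type} [CommRing R] (g : T ⟶ Spec (CommRingCat.of R)) (f : T' ⟶ T) (r : R) :
    toΓ (f ≫ g) r = f.appTop (toΓ g r) := by
  simp only [toΓ, Scheme.Hom.comp_appTop]
  rfl

@[simp]
lemma toΓ_SpecMap {R S : Type} [CommRing R] [CommRing S] (g : T ⟶ Spec (CommRingCat.of S))
    (φ : R →+* S) (r : R) :
    toΓ (g ≫ Spec.map (CommRingCat.ofHom φ)) r = toΓ g (φ r) := by
  simp only [toΓ, Scheme.Hom.comp_appTop, ← Category.assoc, ← Scheme.ΓSpecIso_inv_naturality]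
  rfl

lemma preimage_basicOpen {R : Type} [CommRing R] (g : T ⟶ Spec (CommRingCat.of R)) (r : R) :
    g ⁻¹ᵁ PrimeSpectrum.basicOpen r = T.basicOpen (toΓ g r) := by
  have : PrimeSpectrum.basicOpen r = (Spec (CommRingCat.of R)).basicOpen
      ((Scheme.ΓSpecIso (CommRingCat.of R)).inv r) := by
    rw [basicOpen_eq_of_affine]
  rw [this, Scheme.preimage_basicOpen_top]
  rfl

lemma toΓ_comp_affinePoint {R : Type} [CommRing R] (g : T ⟶ Spec (CommRingCat.of R)) (i : Fin 2)
    (a : R) : g ≫ affinePoint i a = pt i (toΓ g a) := by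
  conv_lhs => rw [eq_toΓ g]
  rw [Category.assoc, SpecMap_affinePoint, pt]

lemma pt_eq (i : Fin 2) (a : Γ(T, ⊤)) : pt i a = ofΓ (evalAway i a) ≫ chartι i := by
  rw [ofΓ, Category.assoc]
  rfl

lemma pt_mem_U (i : Fin 2) (a : Γ(T, ⊤)) (x : T) : pt i a x ∈ P1Z.U i := by
  rw [← opensRange_chartι]
  exact ⟨_, rfl⟩

lemma exists_pt (g : T ⟶ P1Z) (i : Fin 2) (h : ∀ x, g x ∈ P1Z.U i) : ∃ a, g = pt i a := by
  have hr : Set.range g ⊆ Set.range (chartι i) := by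
    rintro _ ⟨x, rfl⟩
    have := h x
    rwa [← opensRange_chartι] at this
  refine ⟨toΓ (IsOpenImmersion.lift (chartι i) g hr) (frac i), ?_⟩
  rw [pt_eq, ← eq_evalAway, ofΓ, ← eq_toΓ, IsOpenImmersion.lift_fac]

lemma pt_injective (i : Fin 2) {a b : Γ(T, ⊤)} (h : pt i a = pt i b) : a = b := by
  rw [pt_eq, pt_eq, cancel_mono] at h
  have := congrArg (fun g => toΓ g (frac i)) h
  simpa only [toΓ_ofΓ, evalAway_frac] using this

lemma pt_preimage (i : Fin 2) (a : Γ(T, ⊤)) : pt i a ⁻¹ᵁ P1Z.U (1 - i) = T.basicOpen a := by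
  rw [pt_eq, Scheme.Hom.comp_preimage, chartι_preimage, preimage_basicOpen, toΓ_ofΓ, evalAway_frac]

lemma pt_preimage_self (i : Fin 2) (a : Γ(T, ⊤)) : pt i a ⁻¹ᵁ P1Z.U i = ⊤ :=
  top_le_iff.mp fun x _ => pt_mem_U i a x

/-- Since `a` is a unit, the point factors through the overlap of the two charts, the spectrum of
the degree zero fractions with denominator a power of `X₀X₁`. There the two chart coordinates are
inverse to each other, so the coordinate in the other chart is `b`. -/
lemma affinePoint_flip {R : Type} [CommRing R] {a b : R} (h : a * b = 1) (i : Fin 2) :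
    affinePoint i a = affinePoint (1 - i) b := by
  have hi : 1 - (1 - i) = i := by omega
  let x : MvPolynomial (Fin 2) ℤ := MvPolynomial.X i * MvPolynomial.X (1 - i)
  have hx : x = MvPolynomial.X (1 - i) * MvPolynomial.X i := mul_comm _ _
  let m₁ := HomogeneousLocalization.awayMap grading (X_mem_grading (1 - i)) (rfl : x = _)
  let m₂ := HomogeneousLocalization.awayMap grading (X_mem_grading i) hx
  let _ := m₁.toAlgebra
  have hloc : IsLocalization.Away (frac i) (HomogeneousLocalization.Away grading x) :=
    HomogeneousLocalization.Away.isLocalization_mul (X_mem_grading i) (X_mem_grading (1 - i))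
      rfl one_ne_zero
  have ha : IsUnit (evalAway i a (frac i)) := by
    rw [evalAway_frac]
    exact IsUnit.of_mul_eq_one b h
  let Φ : HomogeneousLocalization.Away grading x →+* R := IsLocalization.Away.lift (frac i) ha
  have hΦ : Φ.comp m₁ = evalAway i a := IsLocalization.Away.lift_comp (frac i) ha
  have hmul : m₁ (frac i) * m₂ (frac (1 - i)) = 1 := by
    refine HomogeneousLocalization.val_injective _ ?_
    rw [HomogeneousLocalization.awayMap_mk, HomogeneousLocalization.awayMap_mk,
      HomogeneousLocalization.val_mul, HomogeneousLocalization.val_one]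
    refine (Localization.mk_mul _ _ _ _).trans ?_
    rw [← Localization.mk_one, Localization.mk_eq_mk_iff, Localization.r_iff_exists]
    refine ⟨1, ?_⟩
    simp only [Submonoid.coe_mul, hi, x, OneMemClass.coe_one]
    ring
  have hΦ₂ : Φ.comp m₂ = evalAway (1 - i) b := by
    refine awayHom_ext ?_
    rw [evalAway_frac, RingHom.comp_apply]
    have h1 : Φ (m₁ (frac i)) = a := by
      rw [← RingHom.comp_apply, hΦ, evalAway_frac]
    have h2 := congrArg Φ hmul
    rw [map_mul, h1, map_one] at h2
    calc Φ (m₂ (frac (1 - i))) = (a * b) * Φ (m₂ (frac (1 - i))) := by rw [h, one_mul]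
      _ = b * (a * Φ (m₂ (frac (1 - i)))) := by ring
      _ = b := by rw [h2, mul_one]
  have e₁ := Proj.SpecMap_awayMap_awayι grading (X_mem_grading i) Nat.one_pos
    (X_mem_grading (1 - i)) (rfl : x = _)
  have e₂ := Proj.SpecMap_awayMap_awayι grading (X_mem_grading (1 - i)) Nat.one_pos
    (X_mem_grading i) hx
  rw [affinePoint_eq, affinePoint_eq, ← hΦ, ← hΦ₂, CommRingCat.ofHom_comp, CommRingCat.ofHom_comp,
    Spec.map_comp, Spec.map_comp, Category.assoc, Category.assoc]
  congr 1
  exact e₁.trans e₂.symm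

lemma pt_flip {a b : Γ(T, ⊤)} (h : a * b = 1) (i : Fin 2) : pt i a = pt (1 - i) b := by
  rw [pt, pt, affinePoint_flip h]

/-- The preimage of the other chart under `pt i a` is the locus where `a` is invertible. The
equality makes this all of `T`, so `a` is a unit, and its inverse must be `b` because coordinates in
a fixed chart are unique. -/
lemma mul_eq_one_of_pt_eq {a b : Γ(T, ⊤)} {i : Fin 2} (h : pt i a = pt (1 - i) b) :
    a * b = 1 := by
  have h1 : T.basicOpen a = ⊤ := by
    rw [← pt_preimage i, h, pt_preimage_self]
  have h2 : IsUnit a := by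
    refine T.toRingedSpace.isUnit_of_isUnit_germ ⊤ a fun x hx => ?_
    exact (T.mem_basicOpen a x hx).mp (h1.ge hx)
  obtain ⟨c, hc⟩ := h2.exists_right_inv
  rw [pt_flip hc] at h
  rw [← pt_injective _ h, hc]

/-- Two points of the projective line agree iff their homogeneous coordinates are proportional. -/
lemma pt_eq_pt_iff {i j : Fin 2} {a b : Γ(T, ⊤)} : pt i a = pt j b ↔
    affineCoords i a 0 * affineCoords j b 1 = affineCoords i a 1 * affineCoords j b 0 := by
  have h1 : (1 - 1 : Fin 2) = 0 := rfl
  have h0 : (1 - 0 : Fin 2) = 1 := rfl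
  have hne : (1 : Fin 2) ≠ 0 := by decide
  fin_cases i <;> fin_cases j
  · simpa [affineCoords, eq_comm] using
      (⟨pt_injective 0, fun h => by rw [h]⟩ : pt 0 a = pt 0 b ↔ a = b)
  · simpa [affineCoords, eq_comm] using
      (⟨mul_eq_one_of_pt_eq (i := 0), fun h => pt_flip h 0⟩ : pt 0 a = pt 1 b ↔ a * b = 1)
  · simpa [affineCoords, eq_comm] using
      (⟨mul_eq_one_of_pt_eq (i := 1), fun h => pt_flip h 1⟩ : pt 1 a = pt 0 b ↔ a * b = 1)
  · simpa [affineCoords, eq_comm] using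
      (⟨pt_injective 1, fun h => by rw [h]⟩ : pt 1 a = pt 1 b ↔ a = b)

end

/-! ### Properness, points and charts of ℙ¹ and ℙ¹ × ℙ¹ -/

section

instance : Algebra.FiniteType (grading 0) (MvPolynomial (Fin 2) ℤ) :=
  ⟨⟨Finset.univ.image fun i : Fin 2 => MvPolynomial.X i, by
    simpa using adjoin_X_eq_top⟩⟩

instance isProper_P1Z : IsProper (terminal.from P1Z) := by
  -- The degree zero part of the graded ring consists of constants, so properness of `Proj` over its
  -- degree zero part becomes properness over ℤ.
  have hsurj : Function.Surjective (algebraMap ℤ (grading 0)) := by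
    rintro ⟨f, hf⟩
    obtain ⟨n, rfl⟩ : ∃ n, f = MvPolynomial.C n :=
      ⟨_, (MvPolynomial.totalDegree_eq_zero_iff_eq_C).mp
        (Nat.le_zero.mp (MvPolynomial.IsHomogeneous.totalDegree_le hf))⟩
    exact ⟨n, Subtype.ext rfl⟩
  have h1 : IsClosedImmersion (Spec.map (CommRingCat.ofHom (algebraMap ℤ (grading 0)))) :=
    IsClosedImmersion.spec_of_surjective _ hsurj
  have h2 : terminal.from P1Z = Proj.toSpecZero grading ≫
      Spec.map (CommRingCat.ofHom (algebraMap ℤ (grading 0))) ≫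
      (specZIsTerminal.uniqueUpToIso terminalIsTerminal).hom := terminal.hom_ext _ _
  rw [h2]
  have h3 : IsProper (Proj.toSpecZero grading) := inferInstance
  exact MorphismProperty.comp_mem _ _ _ h3 inferInstance

instance (S : Scheme.{0}) : IsProper (P1.toBase S) :=
  inferInstanceAs (IsProper (pullback.fst _ _))

instance (S : Scheme.{0}) : IsProper (F0.toBase S) :=
  inferInstanceAs (IsProper (pullback.fst (P1.toBase S) (P1.toBase S) ≫ P1.toBase S))

variable {S T T' : Scheme.{0}}

/-- The projection of the projective line over `S` to the projective line over `ℤ`. -/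
def P1.P (S : Scheme.{0}) : P1 S ⟶ P1Z := pullback.snd _ _

lemma P1.hom_ext {f g : T ⟶ P1 S} (h₁ : f ≫ P1.toBase S = g ≫ P1.toBase S)
    (h₂ : f ≫ P1.P S = g ≫ P1.P S) : f = g :=
  pullback.hom_ext h₁ h₂

/-- The point of the projective line over `S` given by a point of `S` and a point of the
projective line over `ℤ`. -/
def P1.lift (f : T ⟶ S) (p : T ⟶ P1Z) : T ⟶ P1 S :=
  pullback.lift f p (terminal.hom_ext _ _)

@[simp]
lemma P1.lift_toBase (f : T ⟶ S) (p : T ⟶ P1Z) : P1.lift f p ≫ P1.toBase S = f :=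
  pullback.lift_fst _ _ _

@[simp]
lemma P1.lift_P (f : T ⟶ S) (p : T ⟶ P1Z) : P1.lift f p ≫ P1.P S = p :=
  pullback.lift_snd _ _ _

/-- The first projection of `ℙ¹ × ℙ¹`. -/
def F0.fst (S : Scheme.{0}) : F0 S ⟶ P1 S := pullback.fst _ _

/-- The second projection of `ℙ¹ × ℙ¹`. -/
def F0.snd (S : Scheme.{0}) : F0 S ⟶ P1 S := pullback.snd _ _

/-- The first projection of `ℙ¹ × ℙ¹` to the projective line over `ℤ`. -/
def F0.P (S : Scheme.{0}) : F0 S ⟶ P1Z := F0.fst S ≫ P1.P S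

/-- The second projection of `ℙ¹ × ℙ¹` to the projective line over `ℤ`. -/
def F0.Q (S : Scheme.{0}) : F0 S ⟶ P1Z := F0.snd S ≫ P1.P S

@[simp]
lemma F0.fst_toBase (S : Scheme.{0}) : F0.fst S ≫ P1.toBase S = F0.toBase S := rfl

@[simp]
lemma F0.snd_toBase (S : Scheme.{0}) : F0.snd S ≫ P1.toBase S = F0.toBase S :=
  pullback.condition.symm

@[simp]
lemma F0.fst_P (S : Scheme.{0}) : F0.fst S ≫ P1.P S = F0.P S := rfl

@[simp]
lemma F0.snd_P (S : Scheme.{0}) : F0.snd S ≫ P1.P S = F0.Q S := rfl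

instance (S : Scheme.{0}) : IsProper (F0.fst S) :=
  inferInstanceAs (IsProper (pullback.fst _ _))

instance (S : Scheme.{0}) : IsProper (F0.snd S) :=
  inferInstanceAs (IsProper (pullback.snd _ _))

lemma F0.hom_ext {f g : T ⟶ F0 S} (h₁ : f ≫ F0.toBase S = g ≫ F0.toBase S)
    (h₂ : f ≫ F0.P S = g ≫ F0.P S) (h₃ : f ≫ F0.Q S = g ≫ F0.Q S) : f = g := by
  have e₁ : f ≫ F0.fst S = g ≫ F0.fst S := P1.hom_ext (by simpa using h₁) (by simpa using h₂)
  have e₂ : f ≫ F0.snd S = g ≫ F0.snd S := P1.hom_ext (by simpa using h₁) (by simpa using h₃)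
  exact pullback.hom_ext e₁ e₂

/-- The point of `ℙ¹ × ℙ¹` over `S` given by a point of `S` and two points of the projective
line over `ℤ`. -/
def F0.lift (f : T ⟶ S) (p q : T ⟶ P1Z) : T ⟶ F0 S :=
  pullback.lift (P1.lift f p) (P1.lift f q) (by simp)

@[simp]
lemma F0.lift_fst (f : T ⟶ S) (p q : T ⟶ P1Z) : F0.lift f p q ≫ F0.fst S = P1.lift f p :=
  pullback.lift_fst _ _ _

@[simp]
lemma F0.lift_fst_assoc (f : T ⟶ S) (p q : T ⟶ P1Z) {Z : Scheme.{0}} (h : P1 S ⟶ Z) :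
    F0.lift f p q ≫ F0.fst S ≫ h = P1.lift f p ≫ h := by
  rw [← Category.assoc, F0.lift_fst]

@[simp]
lemma F0.lift_snd (f : T ⟶ S) (p q : T ⟶ P1Z) : F0.lift f p q ≫ F0.snd S = P1.lift f q :=
  pullback.lift_snd _ _ _

@[simp]
lemma F0.lift_snd_assoc (f : T ⟶ S) (p q : T ⟶ P1Z) {Z : Scheme.{0}} (h : P1 S ⟶ Z) :
    F0.lift f p q ≫ F0.snd S ≫ h = P1.lift f q ≫ h := by
  rw [← Category.assoc, F0.lift_snd]

@[simp]
lemma F0.lift_toBase (f : T ⟶ S) (p q : T ⟶ P1Z) : F0.lift f p q ≫ F0.toBase S = f := by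
  rw [← F0.fst_toBase, F0.lift_fst_assoc, P1.lift_toBase]

@[simp]
lemma F0.lift_toBase_assoc (f : T ⟶ S) (p q : T ⟶ P1Z) {Z : Scheme.{0}} (h : S ⟶ Z) :
    F0.lift f p q ≫ F0.toBase S ≫ h = f ≫ h := by
  rw [← Category.assoc, F0.lift_toBase]

@[simp]
lemma F0.lift_P (f : T ⟶ S) (p q : T ⟶ P1Z) : F0.lift f p q ≫ F0.P S = p := by
  rw [F0.P, F0.lift_fst_assoc, P1.lift_P]

@[simp]
lemma F0.lift_Q (f : T ⟶ S) (p q : T ⟶ P1Z) : F0.lift f p q ≫ F0.Q S = q := by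
  rw [F0.Q, F0.lift_snd_assoc, P1.lift_P]

lemma F0.comp_lift (g : T' ⟶ T) (f : T ⟶ S) (p q : T ⟶ P1Z) :
    g ≫ F0.lift f p q = F0.lift (g ≫ f) (g ≫ p) (g ≫ q) :=
  F0.hom_ext (by simp) (by simp) (by simp)

/-- The morphism of `ℙ¹ × ℙ¹` induced by a morphism of bases. -/
def F0.map (g : T ⟶ S) : F0 T ⟶ F0 S := F0.lift (F0.toBase T ≫ g) (F0.P T) (F0.Q T)

variable {C : Type} [CommRing C]

lemma comp_chart (g : T ⟶ Spec (CommRingCat.of (MvPolynomial (Fin 2) C))) (i j : Fin 2) :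
    g ≫ chart C i j = F0.lift (g ≫ planeToBase C) (pt i (toΓ g (MvPolynomial.X 0)))
      (pt j (toΓ g (MvPolynomial.X 1))) := by
  have h : chart C i j = F0.lift (planeToBase C) (affinePoint i (MvPolynomial.X 0))
    (affinePoint j (MvPolynomial.X 1)) := rfl
  rw [h, F0.comp_lift, toΓ_comp_affinePoint, toΓ_comp_affinePoint]

/-- The point of the affine plane over `C` with given coordinates. -/
def planePt (f : T ⟶ Spec (CommRingCat.of C)) (a b : Γ(T, ⊤)) :
    T ⟶ Spec (CommRingCat.of (MvPolynomial (Fin 2) C)) :=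
  ofΓ (MvPolynomial.eval₂Hom (toΓ f) ![a, b])

lemma planePt_toBase (f : T ⟶ Spec (CommRingCat.of C)) (a b : Γ(T, ⊤)) :
    planePt f a b ≫ planeToBase C = f := by
  refine toΓ_ext fun r => ?_
  rw [planePt, planeToBase, toΓ_SpecMap, toΓ_ofΓ]
  simp

lemma planePt_chart (f : T ⟶ Spec (CommRingCat.of C)) (a b : Γ(T, ⊤)) (i j : Fin 2) :
    planePt f a b ≫ chart C i j = F0.lift f (pt i a) (pt j b) := by
  rw [comp_chart, planePt_toBase]
  simp [planePt]

lemma eq_planePt (g : T ⟶ Spec (CommRingCat.of (MvPolynomial (Fin 2) C))) :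
    g = planePt (g ≫ planeToBase C) (toΓ g (MvPolynomial.X 0)) (toΓ g (MvPolynomial.X 1)) := by
  refine toΓ_ext fun r => ?_
  rw [planePt, toΓ_ofΓ]
  refine congrFun (congrArg DFunLike.coe
    (MvPolynomial.ringHom_ext (f := toΓ g) (g := MvPolynomial.eval₂Hom _ _) ?_ ?_)) r
  · intro c
    simp [planeToBase]
  · intro k
    fin_cases k <;> simp

/-- The open subset of `ℙ¹ × ℙ¹` covered by the chart `(i, j)`. -/
def F0.W (S : Scheme.{0}) (i j : Fin 2) : (F0 S).Opens :=
  F0.P S ⁻¹ᵁ P1Z.U i ⊓ F0.Q S ⁻¹ᵁ P1Z.U j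

lemma F0.exists_eq_lift (h : T ⟶ F0 S) (i j : Fin 2) (hh : ∀ x, h x ∈ F0.W S i j) :
    ∃ a b, h = F0.lift (h ≫ F0.toBase S) (pt i a) (pt j b) := by
  obtain ⟨a, ha⟩ := exists_pt (h ≫ F0.P S) i fun x => (hh x).1
  obtain ⟨b, hb⟩ := exists_pt (h ≫ F0.Q S) j fun x => (hh x).2
  exact ⟨a, b, F0.hom_ext (by simp) (by simp [ha]) (by simp [hb])⟩

lemma chart_mem_W (i j : Fin 2) (x) : chart C i j x ∈ F0.W (Spec (CommRingCat.of C)) i j := by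
  have h := comp_chart (𝟙 (Spec (CommRingCat.of (MvPolynomial (Fin 2) C)))) i j
  rw [Category.id_comp] at h
  have hP := congrArg (fun g => g ≫ F0.P _) h
  have hQ := congrArg (fun g => g ≫ F0.Q _) h
  simp only [F0.lift_P, F0.lift_Q] at hP hQ
  refine ⟨?_, ?_⟩
  · have := pt_mem_U i (toΓ (𝟙 _) (MvPolynomial.X 0 : MvPolynomial (Fin 2) C)) x
    rwa [← hP] at this
  · have := pt_mem_U j (toΓ (𝟙 _) (MvPolynomial.X 1 : MvPolynomial (Fin 2) C)) x
    rwa [← hQ] at this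

lemma opensRange_ι_le {X Y : Scheme.{0}} (f : X ⟶ Y) (U : Y.Opens) (h : ∀ x, f x ∈ U) :
    Set.range f ⊆ Set.range U.ι := by
  rintro _ ⟨x, rfl⟩
  rw [Scheme.Opens.range_ι]
  exact h x

/-- The chart `(i, j)` is an isomorphism onto the corresponding open subset. -/
lemma exists_chart_eq (i j : Fin 2) :
    ∃ e : Spec (CommRingCat.of (MvPolynomial (Fin 2) C)) ≅
      (F0.W (Spec (CommRingCat.of C)) i j).toScheme, e.hom ≫ (F0.W _ i j).ι = chart C i j := by
  -- The coordinates of the inclusion of the open subset itself define the map to the affine plane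
  -- that inverts the chart.
  obtain ⟨a, b, hab⟩ := F0.exists_eq_lift (F0.W (Spec (CommRingCat.of C)) i j).ι i j
    (fun x => x.2)
  let f := IsOpenImmersion.lift (F0.W (Spec (CommRingCat.of C)) i j).ι (chart C i j)
    (opensRange_ι_le _ _ (chart_mem_W i j))
  have hf : f ≫ (F0.W (Spec (CommRingCat.of C)) i j).ι = chart C i j :=
    IsOpenImmersion.lift_fac _ _ _
  have hg := planePt_chart ((F0.W (Spec (CommRingCat.of C)) i j).ι ≫ F0.toBase _) a b i j
  rw [← hab] at hg
  refine ⟨⟨f, planePt ((F0.W (Spec (CommRingCat.of C)) i j).ι ≫ F0.toBase _) a b, ?_, ?_⟩, hf⟩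
  · have h1 := comp_chart (f ≫ planePt ((F0.W (Spec (CommRingCat.of C)) i j).ι ≫ F0.toBase _) a b)
      i j
    have h2 := comp_chart (𝟙 (Spec (CommRingCat.of (MvPolynomial (Fin 2) C)))) i j
    rw [Category.assoc, hg, hf] at h1
    rw [Category.id_comp, h1] at h2
    rw [eq_planePt (f ≫ _), eq_planePt (𝟙 _)]
    congr 1
    · simpa using congrArg (fun g => g ≫ F0.toBase _) h2
    · exact pt_injective i (by simpa using congrArg (fun g => g ≫ F0.P _) h2)
    · exact pt_injective j (by simpa using congrArg (fun g => g ≫ F0.Q _) h2)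
  · rw [← cancel_mono (F0.W (Spec (CommRingCat.of C)) i j).ι, Category.assoc, hf, hg,
      Category.id_comp]

instance (i j : Fin 2) : IsOpenImmersion (chart C i j) := by
  obtain ⟨e, he⟩ := exists_chart_eq (C := C) i j
  rw [← he]
  infer_instance

lemma opensRange_chart (i j : Fin 2) : (chart C i j).opensRange = F0.W _ i j := by
  obtain ⟨e, he⟩ := exists_chart_eq (C := C) i j
  ext1
  change Set.range (chart C i j) = _
  rw [← he, Scheme.Hom.comp_base, TopCat.coe_comp, Set.range_comp, Set.range_eq_univ.mpr
    (show Function.Surjective e.hom from e.hom.homeomorph.surjective), Set.image_univ]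
  exact Scheme.Opens.range_ι _

lemma F0.exists_mem_W (x : F0 S) : ∃ i j, x ∈ F0.W S i j := by
  have hP : F0.P S x ∈ (⨆ i, P1Z.U i) := by rw [P1Z.iSup_U]; trivial
  have hQ : F0.Q S x ∈ (⨆ i, P1Z.U i) := by rw [P1Z.iSup_U]; trivial
  obtain ⟨i, hi⟩ := TopologicalSpace.Opens.mem_iSup.mp hP
  obtain ⟨j, hj⟩ := TopologicalSpace.Opens.mem_iSup.mp hQ
  exact ⟨i, j, hi, hj⟩

end

section

/-! ### The functor of points of the zero scheme -/

section Gluing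

variable {T X Y : Scheme.{0}}

/-- A section is determined by the morphism `pt 0 a` to the projective line, and morphisms can be
compared locally. -/
lemma Γ_ext {a b : Γ(T, ⊤)}
    (h : ∀ x : T, ∃ V : T.Opens, x ∈ V ∧ V.ι.appTop a = V.ι.appTop b) : a = b := by
  refine pt_injective 0 (Scheme.hom_ext_of_forall _ _ fun x => ?_)
  obtain ⟨V, hx, hV⟩ := h x
  exact ⟨V, hx, by rw [comp_pt, comp_pt, hV]⟩

/-- Lifts through a monomorphism are unique, so local lifts agree on overlaps and glue. -/
lemma exists_lift_of_forall (f : X ⟶ Y) [Mono f] (h : T ⟶ Y)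
    (H : ∀ x : T, ∃ V : T.Opens, x ∈ V ∧ ∃ l : V.toScheme ⟶ X, l ≫ f = V.ι ≫ h) :
    ∃ l : T ⟶ X, l ≫ f = h := by
  choose V hV l hl using H
  let 𝒰 := T.openCoverOfIsOpenCover V
    (TopologicalSpace.IsOpenCover.mk (top_le_iff.mp fun x _ =>
      TopologicalSpace.Opens.mem_iSup.mpr ⟨x, hV x⟩))
  let l' : ∀ x, 𝒰.X x ⟶ X := l
  have hl' : ∀ x, l' x ≫ f = 𝒰.f x ≫ h := hl
  refine ⟨𝒰.glueMorphisms l' fun x y => ?_, 𝒰.hom_ext _ _ fun x => ?_⟩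
  · rw [← cancel_mono f, Category.assoc, Category.assoc, hl', hl', pullback.condition_assoc]
  · rw [Scheme.Cover.ι_glueMorphisms_assoc, hl']

end Gluing

variable {R S : Type} [CommRing R] [CommRing S]

/-- The three bihomogeneous equations of the zero scheme. -/
def ZeroEqs (u₁ u₂ u₃ v₁ v₂ : R) (p q : Fin 2 → R) : Prop :=
  u₁ * p 0 - p 1 * v₁ = 0 ∧ u₂ * q 0 - q 1 * v₂ = 0 ∧ p 0 * q 0 - p 1 * q 1 * u₃ = 0

lemma map_affineCoords (φ : R →+* S) (i : Fin 2) (a : R) (k : Fin 2) :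
    φ (affineCoords i a k) = affineCoords i (φ a) k := by
  unfold affineCoords
  split_ifs <;> simp

lemma ZeroEqs.map {u₁ u₂ u₃ v₁ v₂ : R} {i j : Fin 2} {a b : R}
    (h : ZeroEqs u₁ u₂ u₃ v₁ v₂ (affineCoords i a) (affineCoords j b)) (φ : R →+* S) :
    ZeroEqs (φ u₁) (φ u₂) (φ u₃) (φ v₁) (φ v₂) (affineCoords i (φ a)) (affineCoords j (φ b)) := by
  obtain ⟨h₁, h₂, h₃⟩ := h
  have e₁ := congrArg φ h₁
  have e₂ := congrArg φ h₂
  have e₃ := congrArg φ h₃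
  simp only [map_sub, map_mul, map_zero, map_affineCoords] at e₁ e₂ e₃
  exact ⟨e₁, e₂, e₃⟩

lemma ZeroEqs.smul {u₁ u₂ u₃ v₁ v₂ : R} {p q : Fin 2 → R} (h : ZeroEqs u₁ u₂ u₃ v₁ v₂ p q)
    (c d : R) : ZeroEqs u₁ u₂ u₃ v₁ v₂ (c • p) (d • q) := by
  obtain ⟨h₁, h₂, h₃⟩ := h
  simp only [ZeroEqs, Pi.smul_apply, smul_eq_mul]
  refine ⟨?_, ?_, ?_⟩
  · linear_combination c * h₁
  · linear_combination d * h₂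
  · linear_combination c * d * h₃

/-- The `i`-th coordinate of the first point is `1`, so the proportionality factor can only be the
`i`-th coordinate of the second. -/
lemma affineCoords_proportional {i j : Fin 2} {a b : R}
    (h : affineCoords i a 0 * affineCoords j b 1 = affineCoords i a 1 * affineCoords j b 0) :
    affineCoords j b = affineCoords j b i • affineCoords i a := by
  funext k
  have := affineCoords_self i a
  fin_cases i <;> fin_cases k <;>
    simp only [Pi.smul_apply, smul_eq_mul, Fin.zero_eta, Fin.mk_one] at * <;>
    simp only [this, mul_one, one_mul] at * <;>
    first | linear_combination h | linear_combination -h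

variable {T T' X : Scheme.{0}} {C : Type} [CommRing C]

/-- The condition that a point of `ℙ¹ × ℙ¹` satisfies the three bihomogeneous equations. -/
def IsZero (u₁ u₂ u₃ v₁ v₂ : C) (h : T ⟶ F0 (Spec (CommRingCat.of C))) : Prop :=
  ∀ ⦃T' : Scheme.{0}⦄ (t : T' ⟶ T) (i j : Fin 2) (a b : Γ(T', ⊤)),
    t ≫ h ≫ F0.P _ = pt i a → t ≫ h ≫ F0.Q _ = pt j b →
    ZeroEqs (toΓ (t ≫ h ≫ F0.toBase _) u₁) (toΓ (t ≫ h ≫ F0.toBase _) u₂)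
      (toΓ (t ≫ h ≫ F0.toBase _) u₃) (toΓ (t ≫ h ≫ F0.toBase _) v₁) (toΓ (t ≫ h ≫ F0.toBase _) v₂)
      (affineCoords i a) (affineCoords j b)

variable {u₁ u₂ u₃ v₁ v₂ : C}

lemma IsZero.comp {h : T ⟶ F0 (Spec (CommRingCat.of C))} (hh : IsZero u₁ u₂ u₃ v₁ v₂ h)
    (t : T' ⟶ T) : IsZero u₁ u₂ u₃ v₁ v₂ (t ≫ h) := by
  intro T'' t' i j a b ha hb
  simpa using hh (t' ≫ t) i j a b (by simpa using ha) (by simpa using hb)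

lemma IsZero.zeroEqs {f : T ⟶ Spec (CommRingCat.of C)} {i j : Fin 2} {a b : Γ(T, ⊤)}
    (h : IsZero u₁ u₂ u₃ v₁ v₂ (F0.lift f (pt i a) (pt j b))) :
    ZeroEqs (toΓ f u₁) (toΓ f u₂) (toΓ f u₃) (toΓ f v₁) (toΓ f v₂)
      (affineCoords i a) (affineCoords j b) := by
  simpa using h (𝟙 T) i j a b (by simp) (by simp)

/-- One choice of coordinates suffices: any other choice, after any pullback, is proportional to it,
and the equations are bihomogeneous (`ZeroEqs.smul`). -/
lemma isZero_lift {f : T ⟶ Spec (CommRingCat.of C)} {i j : Fin 2} {a b : Γ(T, ⊤)}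
    (h : ZeroEqs (toΓ f u₁) (toΓ f u₂) (toΓ f u₃) (toΓ f v₁) (toΓ f v₂)
      (affineCoords i a) (affineCoords j b)) :
    IsZero u₁ u₂ u₃ v₁ v₂ (F0.lift f (pt i a) (pt j b)) := by
  intro T' t i' j' a' b' ha hb
  rw [F0.lift_P, comp_pt, pt_eq_pt_iff] at ha
  rw [F0.lift_Q, comp_pt, pt_eq_pt_iff] at hb
  rw [affineCoords_proportional ha, affineCoords_proportional hb]
  refine ZeroEqs.smul ?_ _ _
  simpa only [F0.lift_toBase, toΓ_comp] using h.map t.appTop.hom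

lemma isZero_of_forall {h : T ⟶ F0 (Spec (CommRingCat.of C))}
    (H : ∀ x : T, ∃ V : T.Opens, x ∈ V ∧ IsZero u₁ u₂ u₃ v₁ v₂ (V.ι ≫ h)) :
    IsZero u₁ u₂ u₃ v₁ v₂ h := by
  intro T' t i j a b ha hb
  have key : ∀ x : T', ∃ V : T'.Opens, x ∈ V ∧
      ZeroEqs (V.ι.appTop (toΓ (t ≫ h ≫ F0.toBase _) u₁))
        (V.ι.appTop (toΓ (t ≫ h ≫ F0.toBase _) u₂)) (V.ι.appTop (toΓ (t ≫ h ≫ F0.toBase _) u₃))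
        (V.ι.appTop (toΓ (t ≫ h ≫ F0.toBase _) v₁)) (V.ι.appTop (toΓ (t ≫ h ≫ F0.toBase _) v₂))
        (affineCoords i (V.ι.appTop a)) (affineCoords j (V.ι.appTop b)) := by
    intro x
    obtain ⟨V, hx, hV⟩ := H (t x)
    refine ⟨t ⁻¹ᵁ V, hx, ?_⟩
    have := hV (t ∣_ V) i j ((t ⁻¹ᵁ V).ι.appTop a) ((t ⁻¹ᵁ V).ι.appTop b)
      (by rw [Category.assoc, morphismRestrict_ι_assoc, ha, comp_pt])
      (by rw [Category.assoc, morphismRestrict_ι_assoc, hb, comp_pt])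
    simpa only [Category.assoc, morphismRestrict_ι_assoc, toΓ_comp (f := (t ⁻¹ᵁ V).ι)] using this
  refine ⟨Γ_ext fun x => ?_, Γ_ext fun x => ?_, Γ_ext fun x => ?_⟩ <;>
    obtain ⟨V, hx, h₁, h₂, h₃⟩ := key x <;>
    refine ⟨V, hx, ?_⟩ <;>
    simp only [map_sub, map_mul, map_zero, map_affineCoords]
  · exact h₁
  · exact h₂
  · exact h₃

/-- The ring of the zero scheme in the chart `(i, j)`. -/
abbrev ChartRing (u₁ u₂ u₃ v₁ v₂ : C) (i j : Fin 2) : Type :=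
  MvPolynomial (Fin 2) C ⧸ chartIdeal u₁ u₂ u₃ v₁ v₂ i j

lemma chartIdeal_le_ker_iff {φ : MvPolynomial (Fin 2) C →+* R} {i j : Fin 2} :
    chartIdeal u₁ u₂ u₃ v₁ v₂ i j ≤ RingHom.ker φ ↔
      ZeroEqs (φ (MvPolynomial.C u₁)) (φ (MvPolynomial.C u₂)) (φ (MvPolynomial.C u₃))
        (φ (MvPolynomial.C v₁)) (φ (MvPolynomial.C v₂))
        (affineCoords i (φ (MvPolynomial.X 0))) (affineCoords j (φ (MvPolynomial.X 1))) := by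
  simp only [chartIdeal, Ideal.span_le, Set.insert_subset_iff, Set.singleton_subset_iff,
    SetLike.mem_coe, RingHom.mem_ker, map_sub, map_mul, map_affineCoords, ZeroEqs]

lemma chartIdeal_le_ker_toΓ_iff
    {g : T ⟶ Spec (CommRingCat.of (MvPolynomial (Fin 2) C))} {i j : Fin 2} :
    chartIdeal u₁ u₂ u₃ v₁ v₂ i j ≤ RingHom.ker (toΓ g) ↔
      IsZero u₁ u₂ u₃ v₁ v₂ (g ≫ chart C i j) := by
  have h : ∀ c, toΓ (g ≫ planeToBase C) c = toΓ g (MvPolynomial.C c) := toΓ_SpecMap _ _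
  rw [chartIdeal_le_ker_iff, comp_chart]
  constructor
  · intro H
    refine isZero_lift ?_
    simpa only [h] using H
  · intro H
    simpa only [h] using H.zeroEqs

/-- The point of a closed subscheme of an affine scheme given by a ring homomorphism killing
the ideal. -/
lemma exists_comp_mk {A : Type} [CommRing A] (I : Ideal A) (g : T ⟶ Spec (CommRingCat.of A))
    (h : I ≤ RingHom.ker (toΓ g)) :
    ∃ l : T ⟶ Spec (CommRingCat.of (A ⧸ I)),
      l ≫ Spec.map (CommRingCat.ofHom (Ideal.Quotient.mk I)) = g := by
  refine ⟨ofΓ (Ideal.Quotient.lift I (toΓ g) h), toΓ_ext fun r => ?_⟩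
  rw [toΓ_SpecMap, toΓ_ofΓ]
  rfl

lemma le_ker_toΓ_comp_mk {A : Type} [CommRing A] (I : Ideal A)
    (l : T ⟶ Spec (CommRingCat.of (A ⧸ I))) :
    I ≤ RingHom.ker (toΓ (l ≫ Spec.map (CommRingCat.ofHom (Ideal.Quotient.mk I)))) := by
  intro r hr
  rw [RingHom.mem_ker, toΓ_SpecMap, Ideal.Quotient.eq_zero_iff_mem.mpr hr, map_zero]

lemma isZero_chartZeros (i j : Fin 2) :
    IsZero u₁ u₂ u₃ v₁ v₂ (chartZeros u₁ u₂ u₃ v₁ v₂ i j) := by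
  rw [chartZeros, ← chartIdeal_le_ker_toΓ_iff]
  simpa using le_ker_toΓ_comp_mk (chartIdeal u₁ u₂ u₃ v₁ v₂ i j) (𝟙 _)

/-- A scheme over `ℙ¹ × ℙ¹` that represents the zeros of the three bihomogeneous equations. -/
structure IsZeroScheme (u₁ u₂ u₃ v₁ v₂ : C) (f : X ⟶ F0 (Spec (CommRingCat.of C))) : Prop where
  mono : Mono f
  isZero : IsZero u₁ u₂ u₃ v₁ v₂ f
  exists_lift : ∀ ⦃T : Scheme.{0}⦄ (h : T ⟶ F0 (Spec (CommRingCat.of C))),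
    IsZero u₁ u₂ u₃ v₁ v₂ h → ∃ x : T ⟶ X, x ≫ f = h

/-- Locally a zero lies in one chart, where it is a point of the affine plane killing the chart
ideal, hence a point of the chart ring. The resulting local lifts glue because `f` is a
monomorphism. -/
lemma isZeroScheme_of_charts (f : X ⟶ F0 (Spec (CommRingCat.of C))) [hf : Mono f]
    (h : IsZero u₁ u₂ u₃ v₁ v₂ f)
    (hc : ∀ i j, ∃ c : Spec (CommRingCat.of (ChartRing u₁ u₂ u₃ v₁ v₂ i j)) ⟶ X,
      c ≫ f = chartZeros u₁ u₂ u₃ v₁ v₂ i j) : IsZeroScheme u₁ u₂ u₃ v₁ v₂ f := by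
  refine ⟨hf, h, fun T g hg => exists_lift_of_forall f g fun x => ?_⟩
  obtain ⟨i, j, hx⟩ := F0.exists_mem_W (g x)
  refine ⟨g ⁻¹ᵁ F0.W _ i j, hx, ?_⟩
  obtain ⟨a, b, hab⟩ := F0.exists_eq_lift ((g ⁻¹ᵁ F0.W _ i j).ι ≫ g) i j (fun y => y.2)
  rw [← planePt_chart] at hab
  have h1 := hg.comp (g ⁻¹ᵁ F0.W _ i j).ι
  rw [hab, ← chartIdeal_le_ker_toΓ_iff] at h1
  obtain ⟨l, hl⟩ := exists_comp_mk _ _ h1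
  obtain ⟨c, hc⟩ := hc i j
  exact ⟨l ≫ c, by rw [Category.assoc, hc, chartZeros, ← Category.assoc, hl]; exact hab.symm⟩

lemma comap_iInf_le {ι : Type} [Finite ι] {Y : Scheme.{0}} (I : ι → Y.IdealSheafData) (f : X ⟶ Y)
    [IsOpenImmersion f] : ⨅ k, (I k).comap f ≤ (⨅ k, I k).comap f := by
  intro U r hr
  rw [Scheme.IdealSheafData.ideal_comap_of_isOpenImmersion, Ideal.mem_comap,
    Scheme.IdealSheafData.ideal_iInf, iInf_apply, Ideal.mem_iInf]
  rw [Scheme.IdealSheafData.ideal_iInf, iInf_apply, Ideal.mem_iInf] at hr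
  intro k
  have := hr k
  rwa [Scheme.IdealSheafData.ideal_comap_of_isOpenImmersion, Ideal.mem_comap] at this

lemma ker_fst_le_comap_ker {Y Z : Scheme.{0}} (f : X ⟶ Y) [IsOpenImmersion f] (g : Z ⟶ Y)
    [QuasiCompact g] : (pullback.fst f g).ker ≤ g.ker.comap f := by
  intro U r hr
  rw [Scheme.ker_ideal_of_isPullback_of_isOpenImmersion _ _ _ _ (IsPullback.of_hasPullback f g)] at hr
  rwa [Scheme.IdealSheafData.ideal_comap_of_isOpenImmersion]

lemma mem_ker_top_iff {Z : Scheme.{0}} (g : Z ⟶ Spec (CommRingCat.of R)) [QuasiCompact g]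
    (r : R) : (Scheme.ΓSpecIso (CommRingCat.of R)).inv r ∈ g.ker.ideal ⟨⊤, isAffineOpen_top _⟩ ↔
      toΓ g r = 0 := by
  rw [Scheme.Hom.ker_apply, RingHom.mem_ker]
  rfl

lemma quasiCompact_chartZeros (i j : Fin 2) : QuasiCompact (chartZeros u₁ u₂ u₃ v₁ v₂ i j) := by
  have : QuasiCompact (chartZeros u₁ u₂ u₃ v₁ v₂ i j ≫ F0.toBase _) := inferInstance
  exact QuasiCompact.of_comp _ (F0.toBase _)

/-- The ideal sheaf is an infimum over four charts, so its restriction to the chart `(i, j)` could a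
priori be too small to contain `chartIdeal` there. An element of that ideal must vanish on the part,
inside the chart `(i, j)`, of the zero locus of every chart `k`; it does, because being a zero is
independent of the chart. -/
lemma isZero_subschemeι :
    IsZero u₁ u₂ u₃ v₁ v₂ (zeroIdeal u₁ u₂ u₃ v₁ v₂).subschemeι := by
  intro T' t i j a b ha hb
  set f := (zeroIdeal u₁ u₂ u₃ v₁ v₂).subschemeι with hf
  have h : planePt (t ≫ f ≫ F0.toBase _) a b ≫ chart C i j = t ≫ f := by
    rw [planePt_chart, ← ha, ← hb]
    exact F0.hom_ext (by simp) (by simp) (by simp)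
  suffices H : IsZero u₁ u₂ u₃ v₁ v₂ (planePt (t ≫ f ≫ F0.toBase _) a b ≫ chart C i j) by
    rw [planePt_chart] at H
    exact H.zeroEqs
  rw [← chartIdeal_le_ker_toΓ_iff, ← pullback.lift_fst (f := chart C i j) (g := f) _ _ h]
  intro r hr
  suffices H : toΓ (pullback.fst (chart C i j) f) r = 0 by
    rw [RingHom.mem_ker, toΓ_comp, H, map_zero]
  rw [← mem_ker_top_iff, Scheme.IdealSheafData.ker_fst_of_isClosedImmersion, hf,
    Scheme.IdealSheafData.ker_subschemeι]
  refine comap_iInf_le _ _ _ ?_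
  rw [Scheme.IdealSheafData.ideal_iInf, iInf_apply, Ideal.mem_iInf]
  intro k
  have : QuasiCompact (chartZeros u₁ u₂ u₃ v₁ v₂ k.1 k.2) := quasiCompact_chartZeros _ _
  refine ker_fst_le_comap_ker _ _ _ ?_
  rw [mem_ker_top_iff]
  refine chartIdeal_le_ker_toΓ_iff.mpr ?_ hr
  rw [pullback.condition]
  exact (isZero_chartZeros k.1 k.2).comp _

lemma isZeroScheme_zeroIdeal :
    IsZeroScheme u₁ u₂ u₃ v₁ v₂ (zeroIdeal u₁ u₂ u₃ v₁ v₂).subschemeι := by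
  refine isZeroScheme_of_charts _ isZero_subschemeι fun i j => ?_
  have h : (zeroIdeal u₁ u₂ u₃ v₁ v₂).subschemeι.ker ≤ (chartZeros u₁ u₂ u₃ v₁ v₂ i j).ker := by
    rw [Scheme.IdealSheafData.ker_subschemeι]
    exact iInf_le (fun ij : Fin 2 × Fin 2 => (chartZeros u₁ u₂ u₃ v₁ v₂ ij.1 ij.2).ker) (i, j)
  exact ⟨IsClosedImmersion.lift _ _ h, IsClosedImmersion.lift_fac _ _ _⟩


/-- The zero scheme of the equations commutes with base change. -/
lemma IsZeroScheme.of_isPullback {D : Type} [CommRing D] {φ : C →+* D} {X' : Scheme.{0}}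
    {f : X ⟶ F0 (Spec (CommRingCat.of C))} (hf : IsZeroScheme u₁ u₂ u₃ v₁ v₂ f)
    {g : X' ⟶ X} {f' : X' ⟶ F0 (Spec (CommRingCat.of D))}
    (H : IsPullback g f' f (F0.map (Spec.map (CommRingCat.ofHom φ)))) :
    IsZeroScheme (φ u₁) (φ u₂) (φ u₃) (φ v₁) (φ v₂) f' := by
  -- The condition involves only the two projections to `P1Z`, which `F0.map` preserves, and the
  -- pulled back values of the five functions.
  have key : ∀ {T : Scheme.{0}} (h : T ⟶ F0 (Spec (CommRingCat.of D))),
      IsZero (φ u₁) (φ u₂) (φ u₃) (φ v₁) (φ v₂) h ↔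
        IsZero u₁ u₂ u₃ v₁ v₂ (h ≫ F0.map (Spec.map (CommRingCat.ofHom φ))) := by
    intro T h
    unfold IsZero
    simp only [F0.map, Category.assoc, F0.lift_P, F0.lift_Q, F0.lift_toBase]
    simp only [← Category.assoc, toΓ_SpecMap]
  have := hf.mono
  refine ⟨(MorphismProperty.monomorphisms _).of_isPullback H hf.mono, ?_, ?_⟩
  · rw [key, ← H.w]
    exact hf.isZero.comp g
  · intro T h hh
    rw [key] at hh
    obtain ⟨x, hx⟩ := hf.exists_lift _ hh
    exact ⟨H.lift x h hx, H.lift_snd _ _ _⟩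

/-- The chart `(i, j)` of the zero scheme. -/
lemma IsZeroScheme.exists_isPullback {f : X ⟶ F0 (Spec (CommRingCat.of C))}
    (hf : IsZeroScheme u₁ u₂ u₃ v₁ v₂ f) (i j : Fin 2) :
    ∃ c : Spec (CommRingCat.of (ChartRing u₁ u₂ u₃ v₁ v₂ i j)) ⟶ X,
      c ≫ f = chartZeros u₁ u₂ u₃ v₁ v₂ i j ∧ IsPullback c (Spec.map (CommRingCat.ofHom
        (Ideal.Quotient.mk (chartIdeal u₁ u₂ u₃ v₁ v₂ i j)))) f (chart C i j) := by
  have := hf.mono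
  obtain ⟨c, hc⟩ := hf.exists_lift _ (isZero_chartZeros (u₁ := u₁) (u₂ := u₂) (u₃ := u₃)
    (v₁ := v₁) (v₂ := v₂) i j)
  have hle : ∀ s : PullbackCone f (SU5.chart C i j),
      chartIdeal u₁ u₂ u₃ v₁ v₂ i j ≤ RingHom.ker (toΓ s.snd) := by
    intro s
    rw [chartIdeal_le_ker_toΓ_iff, ← s.condition]
    exact hf.isZero.comp _
  choose l hl using fun s => exists_comp_mk _ _ (hle s)
  refine ⟨c, hc, ⟨⟨hc⟩, ⟨PullbackCone.IsLimit.mk _ l (fun s => ?_) hl (fun s m h₁ h₂ => ?_)⟩⟩⟩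
  · rw [← cancel_mono f, Category.assoc, hc, chartZeros, ← Category.assoc, hl, s.condition]
  · have : IsClosedImmersion (Spec.map (CommRingCat.ofHom
        (Ideal.Quotient.mk (chartIdeal u₁ u₂ u₃ v₁ v₂ i j)))) :=
      IsClosedImmersion.spec_of_surjective _ Ideal.Quotient.mk_surjective
    rw [← cancel_mono (Spec.map (CommRingCat.ofHom
        (Ideal.Quotient.mk (chartIdeal u₁ u₂ u₃ v₁ v₂ i j)))), h₂, hl]

/-- The open immersion of the chart `(i, j)` of the zero scheme. -/
def IsZeroScheme.chart {f : X ⟶ F0 (Spec (CommRingCat.of C))}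
    (hf : IsZeroScheme u₁ u₂ u₃ v₁ v₂ f) (i j : Fin 2) :
    Spec (CommRingCat.of (ChartRing u₁ u₂ u₃ v₁ v₂ i j)) ⟶ X :=
  (hf.exists_isPullback i j).choose

variable {f : X ⟶ F0 (Spec (CommRingCat.of C))} (hf : IsZeroScheme u₁ u₂ u₃ v₁ v₂ f)

@[simp]
lemma IsZeroScheme.chart_comp (i j : Fin 2) : hf.chart i j ≫ f = chartZeros u₁ u₂ u₃ v₁ v₂ i j :=
  (hf.exists_isPullback i j).choose_spec.1

lemma IsZeroScheme.isPullback_chart (i j : Fin 2) :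
    IsPullback (hf.chart i j) (Spec.map (CommRingCat.ofHom
        (Ideal.Quotient.mk (chartIdeal u₁ u₂ u₃ v₁ v₂ i j)))) f (SU5.chart C i j) :=
  (hf.exists_isPullback i j).choose_spec.2

lemma IsZeroScheme.isOpenImmersion_chart (i j : Fin 2) : IsOpenImmersion (hf.chart i j) :=
  (MorphismProperty.of_isPullback (P := @IsOpenImmersion) (hf.isPullback_chart i j).flip
    inferInstance)

lemma IsZeroScheme.range_chart (i j : Fin 2) :
    Set.range (hf.chart i j) = f ⁻¹' (F0.W (Spec (CommRingCat.of C)) i j) := by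
  have h := Scheme.image_preimage_eq_of_isPullback (hf.isPullback_chart i j).flip Set.univ
  rw [Set.preimage_univ, Set.image_univ, Set.image_univ] at h
  rw [h, ← opensRange_chart]
  rfl

end

section

/-! ### Unique zeros of the equations -/

/-- Local sections of a monomorphism glue to a section, and a split epimorphism that is a
monomorphism is an isomorphism. -/
lemma isIso_of_mono_of_local_sections {X Y : Scheme.{0}} (f : X ⟶ Y) [Mono f]
    (H : ∀ y : Y, ∃ V : Y.Opens, y ∈ V ∧ ∃ l : V.toScheme ⟶ X, l ≫ f = V.ι) : IsIso f := by
  obtain ⟨l, hl⟩ := exists_lift_of_forall f (𝟙 Y) (by simpa using H)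
  have : IsSplitEpi f := ⟨⟨l, hl⟩⟩
  exact isIso_of_mono_of_isSplitEpi f

/-! ### Solving the three equations over a ring -/

section Algebra

variable {R : Type} [CommRing R] {u₁ u₂ u₃ v₁ v₂ : R}

/-- The equation of ℰ lies in the ideal of the three equations in each of the four charts; this is
what makes the projection to the patch factor through ℰ. -/
lemma ZeroEqs.mul_eq {i j : Fin 2} {a b : R}
    (h : ZeroEqs u₁ u₂ u₃ v₁ v₂ (affineCoords i a) (affineCoords j b)) :
    v₁ * v₂ = u₁ * u₂ * u₃ := by
  obtain ⟨h₁, h₂, h₃⟩ := h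
  fin_cases i <;> fin_cases j <;> simp [affineCoords] at h₁ h₂ h₃
  · linear_combination (v₁ * v₂) * h₃ - u₃ * u₂ * h₁ - u₃ * a * v₁ * h₂
  · linear_combination (-v₁) * h₂ + u₂ * v₁ * h₃ - u₂ * u₃ * h₁
  · linear_combination (-v₂) * h₁ + u₁ * v₂ * h₃ - u₁ * u₃ * h₂
  · linear_combination (-v₂) * h₁ - u₁ * a * h₂ + u₁ * u₂ * h₃

/-- The equations have exactly one solution over every extension of the ring. -/
def UniqueZero (u₁ u₂ u₃ v₁ v₂ : R) : Prop :=
  ∃ (i j : Fin 2) (a b : R), ZeroEqs u₁ u₂ u₃ v₁ v₂ (affineCoords i a) (affineCoords j b) ∧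
    ∀ ⦃S : Type⦄ [CommRing S] (φ : R →+* S) (i' j' : Fin 2) (a' b' : S),
      ZeroEqs (φ u₁) (φ u₂) (φ u₃) (φ v₁) (φ v₂) (affineCoords i' a') (affineCoords j' b') →
      affineCoords i' a' 0 * affineCoords i (φ a) 1 = affineCoords i' a' 1 * affineCoords i (φ a) 0 ∧
      affineCoords j' b' 0 * affineCoords j (φ b) 1 = affineCoords j' b' 1 * affineCoords j (φ b) 0

@[simp] lemma affineCoords_zero_zero (a : R) : affineCoords 0 a 0 = 1 := rfl

@[simp] lemma affineCoords_zero_one (a : R) : affineCoords 0 a 1 = a := rfl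

@[simp] lemma affineCoords_one_zero (a : R) : affineCoords 1 a 0 = a := rfl

@[simp] lemma affineCoords_one_one (a : R) : affineCoords 1 a 1 = 1 := rfl

lemma isUnit_affineCoords_zero {i : Fin 2} {a c : R}
    (h : affineCoords i a 1 = affineCoords i a 0 * c) : IsUnit (affineCoords i a 0) := by
  fin_cases i <;> simp at h ⊢
  exact IsUnit.of_mul_eq_one _ h.symm

lemma isUnit_affineCoords_one {i : Fin 2} {a c : R}
    (h : affineCoords i a 0 = affineCoords i a 1 * c) : IsUnit (affineCoords i a 1) := by
  fin_cases i <;> simp at h ⊢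
  exact IsUnit.of_mul_eq_one _ h.symm

lemma ZeroEqs.swap {p q : Fin 2 → R} (h : ZeroEqs u₁ u₂ u₃ v₁ v₂ p q) :
    ZeroEqs u₂ u₁ u₃ v₂ v₁ q p :=
  ⟨h.2.1, h.1, by linear_combination h.2.2⟩

lemma UniqueZero.swap (h : UniqueZero u₁ u₂ u₃ v₁ v₂) : UniqueZero u₂ u₁ u₃ v₂ v₁ := by
  obtain ⟨i, j, a, b, h₁, h₂⟩ := h
  exact ⟨j, i, b, a, h₁.swap, fun S _ φ i' j' a' b' H => (h₂ φ j' i' b' a' H.swap).symm⟩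

lemma uniqueZero_of_isUnit_left (h : v₁ * v₂ = u₁ * u₂ * u₃) (hu : IsUnit v₁) :
    UniqueZero u₁ u₂ u₃ v₁ v₂ := by
  obtain ⟨c, hc⟩ := hu.exists_right_inv
  -- With `c = v₁⁻¹` the first equation reads `σ₋ = u₁ c α₋`, so `α₋` is a unit and the first point
  -- is `[1 : u₁c]`. Cancelling `α₋` in the third equation gives `[u₁u₃c : 1]` for the second.
  refine ⟨0, 1, u₁ * c, u₁ * u₃ * c, ⟨?_, ?_, ?_⟩, fun S _ φ i' j' a' b' H => ?_⟩
  · simp only [affineCoords_zero_zero, affineCoords_zero_one]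
    linear_combination (-u₁) * hc
  · simp only [affineCoords_one_zero, affineCoords_one_one]
    linear_combination (-c) * h + v₂ * hc
  · simp only [affineCoords_one_zero, affineCoords_one_one, affineCoords_zero_zero,
      affineCoords_zero_one]
    ring
  · obtain ⟨h₁, h₂, h₃⟩ := H
    have hc' := congrArg φ hc
    simp only [map_mul, map_one, affineCoords_one_zero, affineCoords_one_one,
      affineCoords_zero_zero, affineCoords_zero_one] at *
    have e : affineCoords i' a' 1 = affineCoords i' a' 0 * (φ u₁ * φ c) := by
      linear_combination (-φ c) * h₁ - affineCoords i' a' 1 * hc'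
    refine ⟨by linear_combination -e, (isUnit_affineCoords_zero e).mul_left_cancel ?_⟩
    linear_combination h₃ + affineCoords j' b' 1 * φ u₃ * e

lemma uniqueZero_of_isUnit_mul (h : v₁ * v₂ = u₁ * u₂ * u₃) (hu : IsUnit (u₁ * u₂)) :
    UniqueZero u₁ u₂ u₃ v₁ v₂ := by
  obtain ⟨c, hc⟩ := hu.exists_right_inv
  -- Here both `u₁` and `u₂` are units, and the first two equations give `[v₁/u₁ : 1]` and `[v₂/u₂ :
  -- 1]`, with `c` the inverse of `u₁u₂`.
  refine ⟨1, 1, v₁ * u₂ * c, v₂ * u₁ * c, ⟨?_, ?_, ?_⟩, fun S _ φ i' j' a' b' H => ?_⟩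
  · simp only [affineCoords_one_zero, affineCoords_one_one]
    linear_combination v₁ * hc
  · simp only [affineCoords_one_zero, affineCoords_one_one]
    linear_combination v₂ * hc
  · simp only [affineCoords_one_zero, affineCoords_one_one]
    linear_combination u₁ * u₂ * c * c * h + u₃ * (u₁ * u₂ * c + 1) * hc
  · obtain ⟨h₁, h₂, h₃⟩ := H
    have hc' := congrArg φ hc
    simp only [map_mul, map_one, affineCoords_one_zero, affineCoords_one_one] at *
    constructor
    · linear_combination φ u₂ * φ c * h₁ - affineCoords i' a' 0 * hc'
    · linear_combination φ u₁ * φ c * h₂ - affineCoords j' b' 0 * hc'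

lemma uniqueZero_of_isUnit_mul_right (h : v₁ * v₂ = u₁ * u₂ * u₃) (hu : IsUnit (u₁ * u₃)) :
    UniqueZero u₁ u₂ u₃ v₁ v₂ := by
  obtain ⟨c, hc⟩ := hu.exists_right_inv
  -- The first equation gives `[v₁/u₁ : 1]`; as `u₃` is a unit, the third then gives `σ₊ = (v₁ c)
  -- α₊` with `c` the inverse of `u₁u₃`.
  refine ⟨1, 0, v₁ * u₃ * c, v₁ * c, ⟨?_, ?_, ?_⟩, fun S _ φ i' j' a' b' H => ?_⟩
  · simp only [affineCoords_one_zero, affineCoords_one_one]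
    linear_combination v₁ * hc
  · simp only [affineCoords_zero_zero, affineCoords_zero_one]
    linear_combination (-c) * h - u₂ * hc
  · simp only [affineCoords_one_zero, affineCoords_one_one, affineCoords_zero_zero,
      affineCoords_zero_one]
    ring
  · obtain ⟨h₁, h₂, h₃⟩ := H
    have hc' := congrArg φ hc
    simp only [map_mul, map_one, affineCoords_one_zero, affineCoords_one_one,
      affineCoords_zero_zero, affineCoords_zero_one] at *
    have e : affineCoords i' a' 0 = affineCoords i' a' 1 * (φ v₁ * φ u₃ * φ c) := by
      linear_combination (φ u₃ * φ c) * h₁ - affineCoords i' a' 0 * hc'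
    refine ⟨by linear_combination e, (isUnit_affineCoords_one e).mul_left_cancel ?_⟩
    linear_combination φ u₁ * φ c * h₃ - φ c * affineCoords j' b' 0 * h₁ +
      affineCoords i' a' 1 * affineCoords j' b' 1 * hc'

/-- If one of five products is invertible, the equations have exactly one solution. -/
lemma uniqueZero_of_isUnit (h : v₁ * v₂ = u₁ * u₂ * u₃) (hu : IsUnit v₁ ∨ IsUnit v₂ ∨
    IsUnit (u₁ * u₂) ∨ IsUnit (u₁ * u₃) ∨ IsUnit (u₂ * u₃)) : UniqueZero u₁ u₂ u₃ v₁ v₂ := by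
  have h' : v₂ * v₁ = u₂ * u₁ * u₃ := by rw [mul_comm, h]; ring
  rcases hu with hu | hu | hu | hu | hu
  · exact uniqueZero_of_isUnit_left h hu
  · exact (uniqueZero_of_isUnit_left h' hu).swap
  · exact uniqueZero_of_isUnit_mul h hu
  · exact uniqueZero_of_isUnit_mul_right h hu
  · exact (uniqueZero_of_isUnit_mul_right h' hu).swap

end Algebra

variable {T X : Scheme.{0}} {C : Type} [CommRing C] {u₁ u₂ u₃ v₁ v₂ : C}

lemma isUnit_toΓ (t : T ⟶ Spec (CommRingCat.of C)) (r : C)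
    (h : ∀ z, t z ∈ PrimeSpectrum.basicOpen r) : IsUnit (toΓ t r) := by
  have h1 : T.basicOpen (toΓ t r) = ⊤ := by
    rw [← preimage_basicOpen]
    exact top_le_iff.mp fun z _ => h z
  refine T.toRingedSpace.isUnit_of_isUnit_germ ⊤ _ fun x hx => ?_
  exact (T.mem_basicOpen _ x hx).mp (h1.ge hx)

/-- Every point of `ℙ¹ × ℙ¹` is locally given by coordinates. -/
lemma F0.exists_local_eq_lift {S : Scheme.{0}} (h : T ⟶ F0 S) (z : T) :
    ∃ V : T.Opens, z ∈ V ∧ ∃ (i j : Fin 2) (a b : Γ(V.toScheme, ⊤)),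
      V.ι ≫ h = F0.lift (V.ι ≫ h ≫ F0.toBase S) (pt i a) (pt j b) := by
  obtain ⟨i, j, hx⟩ := F0.exists_mem_W (h z)
  obtain ⟨a, b, hab⟩ := F0.exists_eq_lift ((h ⁻¹ᵁ F0.W _ i j).ι ≫ h) i j (fun y => y.2)
  exact ⟨_, hx, i, j, a, b, by simpa using hab⟩

lemma IsZero.mul_eq {h : T ⟶ F0 (Spec (CommRingCat.of C))} (hh : IsZero u₁ u₂ u₃ v₁ v₂ h) :
    toΓ (h ≫ F0.toBase _) v₁ * toΓ (h ≫ F0.toBase _) v₂ =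
      toΓ (h ≫ F0.toBase _) u₁ * toΓ (h ≫ F0.toBase _) u₂ * toΓ (h ≫ F0.toBase _) u₃ := by
  refine Γ_ext fun z => ?_
  obtain ⟨V, hz, i, j, a, b, hV⟩ := F0.exists_local_eq_lift h z
  have h1 := hh.comp V.ι
  rw [hV] at h1
  have h2 := h1.zeroEqs.mul_eq
  simp only [toΓ_comp (f := V.ι)] at h2
  exact ⟨V, hz, by simpa only [map_mul] using h2⟩

lemma IsZero.eq_of_uniqueZero {t : T ⟶ Spec (CommRingCat.of C)}
    (ht : UniqueZero (toΓ t u₁) (toΓ t u₂) (toΓ t u₃) (toΓ t v₁) (toΓ t v₂))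
    {h h' : T ⟶ F0 (Spec (CommRingCat.of C))} (hh : IsZero u₁ u₂ u₃ v₁ v₂ h)
    (hh' : IsZero u₁ u₂ u₃ v₁ v₂ h') (e : h ≫ F0.toBase _ = t) (e' : h' ≫ F0.toBase _ = t) :
    h = h' := by
  obtain ⟨i, j, a, b, -, H⟩ := ht
  have key : ∀ {g : T ⟶ F0 (Spec (CommRingCat.of C))}, IsZero u₁ u₂ u₃ v₁ v₂ g →
      g ≫ F0.toBase _ = t → g = F0.lift t (pt i a) (pt j b) := by
    rintro g hg rfl
    refine Scheme.hom_ext_of_forall _ _ fun z => ?_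
    obtain ⟨V, hz, i', j', a', b', hV⟩ := F0.exists_local_eq_lift g z
    have h1 := hg.comp V.ι
    rw [hV] at h1
    have h2 := h1.zeroEqs
    rw [toΓ_comp, toΓ_comp, toΓ_comp, toΓ_comp, toΓ_comp] at h2
    obtain ⟨h3, h4⟩ := H V.ι.appTop.hom i' j' a' b' h2
    refine ⟨V, hz, ?_⟩
    rw [hV, F0.comp_lift, comp_pt, comp_pt, pt_eq_pt_iff.mpr h3, pt_eq_pt_iff.mpr h4]
  rw [key hh e, key hh' e']

lemma UniqueZero.exists_lift {f : X ⟶ F0 (Spec (CommRingCat.of C))}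
    (hf : IsZeroScheme u₁ u₂ u₃ v₁ v₂ f) {t : T ⟶ Spec (CommRingCat.of C)}
    (ht : UniqueZero (toΓ t u₁) (toΓ t u₂) (toΓ t u₃) (toΓ t v₁) (toΓ t v₂)) :
    ∃ x : T ⟶ X, x ≫ f ≫ F0.toBase _ = t := by
  obtain ⟨i, j, a, b, h, -⟩ := ht
  obtain ⟨x, hx⟩ := hf.exists_lift _ (isZero_lift h)
  exact ⟨x, by rw [← Category.assoc, hx, F0.lift_toBase]⟩

/-- The morphism to the hypersurface `v₁ v₂ = u₁ u₂ u₃` is an isomorphism over an open subset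
covered by the loci where one of five products is invertible. -/
lemma IsZeroScheme.isIso_morphismRestrict {f : X ⟶ F0 (Spec (CommRingCat.of C))}
    (hf : IsZeroScheme u₁ u₂ u₃ v₁ v₂ f) {Y : Scheme.{0}} (i : Y ⟶ Spec (CommRingCat.of C)) [Mono i]
    (π : X ⟶ Y) (hπ : π ≫ i = f ≫ F0.toBase _)
    (hi : toΓ i v₁ * toΓ i v₂ = toΓ i u₁ * toΓ i u₂ * toΓ i u₃) (V : Y.Opens)
    (hV : ∀ z ∈ V, ∃ r ∈ ({v₁, v₂, u₁ * u₂, u₁ * u₃, u₂ * u₃} : Set C),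
      i z ∈ PrimeSpectrum.basicOpen r) : IsIso (π ∣_ V) := by
  have := hf.mono
  -- Near each point over `V` one of the five products is invertible, so the equations have a unique
  -- zero there. Uniqueness makes the restricted morphism a monomorphism, existence gives it local
  -- sections.
  have hu : ∀ {T : Scheme.{0}} (t : T ⟶ Y) (z : T), t z ∈ V → ∃ W : T.Opens, z ∈ W ∧ W ≤ t ⁻¹ᵁ V ∧
      UniqueZero (toΓ (W.ι ≫ t ≫ i) u₁) (toΓ (W.ι ≫ t ≫ i) u₂) (toΓ (W.ι ≫ t ≫ i) u₃)
        (toΓ (W.ι ≫ t ≫ i) v₁) (toΓ (W.ι ≫ t ≫ i) v₂) := by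
    intro T t z hz
    obtain ⟨r, hr, hzr⟩ := hV _ hz
    refine ⟨(t ≫ i) ⁻¹ᵁ PrimeSpectrum.basicOpen r ⊓ t ⁻¹ᵁ V, ⟨hzr, hz⟩,
      inf_le_right, ?_⟩
    set W := (t ≫ i) ⁻¹ᵁ PrimeSpectrum.basicOpen r ⊓ t ⁻¹ᵁ V
    have hunit : IsUnit (toΓ (W.ι ≫ t ≫ i) r) := isUnit_toΓ _ _ fun y => y.2.1
    refine uniqueZero_of_isUnit ?_ ?_
    · rw [← Category.assoc]
      simp only [toΓ_comp (g := i), ← map_mul, hi]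
    · rcases hr with rfl | rfl | rfl | rfl | rfl
      · exact .inl hunit
      · exact .inr (.inl hunit)
      · exact .inr (.inr (.inl (by simpa only [map_mul] using hunit)))
      · exact .inr (.inr (.inr (.inl (by simpa only [map_mul] using hunit))))
      · exact .inr (.inr (.inr (.inr (by simpa only [map_mul] using hunit))))
  have hmono : Mono (π ∣_ V) := by
    refine ⟨fun {T} a b hab => ?_⟩
    rw [← cancel_mono (π ⁻¹ᵁ V).ι]
    refine Scheme.hom_ext_of_forall _ _ fun z => ?_
    have e : a ≫ (π ⁻¹ᵁ V).ι ≫ π = b ≫ (π ⁻¹ᵁ V).ι ≫ π := by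
      simp only [← morphismRestrict_ι, ← Category.assoc, hab]
    obtain ⟨W, hz, -, hW⟩ := hu (a ≫ (π ⁻¹ᵁ V).ι ≫ π) z (by
      rw [← morphismRestrict_ι, ← Category.assoc]; exact ((a ≫ π ∣_ V) z).2)
    refine ⟨W, hz, ?_⟩
    rw [← cancel_mono f]
    refine IsZero.eq_of_uniqueZero hW ?_ ?_ ?_ ?_
    · exact hf.isZero.comp _
    · exact hf.isZero.comp _
    · simp only [Category.assoc, hπ]
    · rw [e]
      simp only [Category.assoc, hπ]
  refine isIso_of_mono_of_local_sections _ fun z => ?_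
  obtain ⟨W, hz, -, hW⟩ := hu V.ι z z.2
  obtain ⟨x, hx⟩ := hW.exists_lift hf
  rw [← hπ, ← Category.assoc, ← Category.assoc, cancel_mono] at hx
  refine ⟨W, hz, IsOpenImmersion.lift (π ⁻¹ᵁ V).ι x ?_, ?_⟩
  · refine opensRange_ι_le _ _ fun y => ?_
    change (x ≫ π) y ∈ V
    rw [hx]
    exact (W.ι y).2
  · rw [← cancel_mono V.ι, Category.assoc, morphismRestrict_ι, IsOpenImmersion.lift_fac_assoc, hx]

end

section

/-! ### The symmetry of the equations and the charts of the zero scheme -/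

variable {S T X : Scheme.{0}}

/-- The exchange of the two factors of `ℙ¹ × ℙ¹`. -/
def F0.swap (S : Scheme.{0}) : F0 S ⟶ F0 S := F0.lift (F0.toBase S) (F0.Q S) (F0.P S)

@[simp]
lemma F0.swap_toBase (S : Scheme.{0}) : F0.swap S ≫ F0.toBase S = F0.toBase S :=
  F0.lift_toBase _ _ _

@[simp]
lemma F0.swap_P (S : Scheme.{0}) : F0.swap S ≫ F0.P S = F0.Q S := F0.lift_P _ _ _

@[simp]
lemma F0.swap_Q (S : Scheme.{0}) : F0.swap S ≫ F0.Q S = F0.P S := F0.lift_Q _ _ _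

@[simp]
lemma F0.swap_swap (S : Scheme.{0}) : F0.swap S ≫ F0.swap S = 𝟙 _ :=
  F0.hom_ext (by simp) (by simp) (by simp)

instance (S : Scheme.{0}) : IsIso (F0.swap S) :=
  ⟨F0.swap S, F0.swap_swap S, F0.swap_swap S⟩

variable {C : Type} [CommRing C] {u₁ u₂ u₃ v₁ v₂ : C}

lemma IsZero.swap {h : T ⟶ F0 (Spec (CommRingCat.of C))} (hh : IsZero u₁ u₂ u₃ v₁ v₂ h) :
    IsZero u₂ u₁ u₃ v₂ v₁ (h ≫ F0.swap _) := by
  intro T' t i j a b ha hb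
  have := hh t j i b a (by simpa using hb) (by simpa using ha)
  simpa using this.swap

lemma IsZeroScheme.swap {f : X ⟶ F0 (Spec (CommRingCat.of C))}
    (hf : IsZeroScheme u₁ u₂ u₃ v₁ v₂ f) : IsZeroScheme u₂ u₁ u₃ v₂ v₁ (f ≫ F0.swap _) := by
  have := hf.mono
  refine ⟨inferInstance, hf.isZero.swap, fun T h hh => ?_⟩
  obtain ⟨x, hx⟩ := hf.exists_lift _ hh.swap
  exact ⟨x, by rw [← Category.assoc, hx, Category.assoc, F0.swap_swap, Category.comp_id]⟩

/-- In the chart `(0, 0)` the third equation reads `1 = σ₋ σ₊ u₃`. Hence `σ₋` is invertible there,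
the zeros also lie in the chart `(1, 0)`, and the chart `(0, 0)` can be dropped. -/
lemma IsZeroScheme.exists_mem_range_chart {f : X ⟶ F0 (Spec (CommRingCat.of C))}
    (hf : IsZeroScheme u₁ u₂ u₃ v₁ v₂ f) (z : X) :
    z ∈ Set.range (hf.chart 1 1) ∨ z ∈ Set.range (hf.chart 0 1) ∨ z ∈ Set.range (hf.chart 1 0) := by
  obtain ⟨i, j, hP, hQ⟩ := F0.exists_mem_W (f z)
  have h00 : f z ∈ F0.W (Spec (CommRingCat.of C)) 0 0 → f z ∈ F0.W _ 1 0 := by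
    intro h
    obtain ⟨a, b, hab⟩ := F0.exists_eq_lift ((f ⁻¹ᵁ F0.W _ 0 0).ι ≫ f) 0 0 (fun y => y.2)
    have h1 := hf.isZero.comp (f ⁻¹ᵁ F0.W _ 0 0).ι
    rw [hab] at h1
    have h3 := h1.zeroEqs.2.2
    simp only [affineCoords_zero_zero, affineCoords_zero_one] at h3
    rw [pt_flip (b := b * toΓ (((f ⁻¹ᵁ F0.W _ 0 0).ι ≫ f) ≫ F0.toBase _) u₃)
      (by linear_combination -h3)] at hab
    have h4 := pt_mem_U (1 - 0) (b * toΓ (((f ⁻¹ᵁ F0.W _ 0 0).ι ≫ f) ≫ F0.toBase _) u₃) ⟨z, h⟩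
    refine ⟨?_, h.2⟩
    have h5 := congrArg (fun g => g ≫ F0.P _) hab
    simp only [F0.lift_P] at h5
    rw [← h5] at h4
    exact h4
  rw [hf.range_chart, hf.range_chart, hf.range_chart]
  fin_cases i <;> fin_cases j
  · exact .inr (.inr (h00 ⟨hP, hQ⟩))
  · exact .inr (.inl ⟨hP, hQ⟩)
  · exact .inr (.inr ⟨hP, hQ⟩)
  · exact .inl ⟨hP, hQ⟩

/-- The open cover of the zero scheme by three of its charts. -/
def IsZeroScheme.cover {f : X ⟶ F0 (Spec (CommRingCat.of C))}
    (hf : IsZeroScheme u₁ u₂ u₃ v₁ v₂ f) : X.OpenCover :=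
  Scheme.Cover.mkOfCovers (Fin 3) (fun k => Spec (CommRingCat.of
      (ChartRing u₁ u₂ u₃ v₁ v₂ (![1, 0, 1] k) (![1, 1, 0] k))))
    (fun k => hf.chart (![1, 0, 1] k) (![1, 1, 0] k))
    (fun z => by
      obtain ⟨y, h⟩ | ⟨y, h⟩ | ⟨y, h⟩ := hf.exists_mem_range_chart z
      exacts [⟨0, y, h⟩, ⟨1, y, h⟩, ⟨2, y, h⟩])
    (fun k => hf.isOpenImmersion_chart _ _)

/-! ### The fibres -/

lemma exists_local_pt (h : T ⟶ P1Z) (z : T) :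
    ∃ V : T.Opens, z ∈ V ∧ ∃ (i : Fin 2) (a : Γ(V.toScheme, ⊤)), V.ι ≫ h = pt i a := by
  have hP : h z ∈ (⨆ i, P1Z.U i) := by rw [P1Z.iSup_U]; trivial
  obtain ⟨i, hi⟩ := TopologicalSpace.Opens.mem_iSup.mp hP
  obtain ⟨a, ha⟩ := exists_pt ((h ⁻¹ᵁ P1Z.U i).ι ≫ h) i fun x => x.2
  exact ⟨_, hi, i, a, ha⟩

lemma isZero_of_forall_local {h : T ⟶ F0 (Spec (CommRingCat.of C))}
    (H : ∀ (V : T.Opens) (i j : Fin 2) (a b : Γ(V.toScheme, ⊤)), V.ι ≫ h ≫ F0.P _ = pt i a →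
      V.ι ≫ h ≫ F0.Q _ = pt j b → ZeroEqs (toΓ (V.ι ≫ h ≫ F0.toBase _) u₁)
        (toΓ (V.ι ≫ h ≫ F0.toBase _) u₂) (toΓ (V.ι ≫ h ≫ F0.toBase _) u₃)
        (toΓ (V.ι ≫ h ≫ F0.toBase _) v₁) (toΓ (V.ι ≫ h ≫ F0.toBase _) v₂)
        (affineCoords i a) (affineCoords j b)) : IsZero u₁ u₂ u₃ v₁ v₂ h := by
  refine isZero_of_forall fun z => ?_
  obtain ⟨V, hz, i, j, a, b, hV⟩ := F0.exists_local_eq_lift h z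
  refine ⟨V, hz, ?_⟩
  rw [hV]
  refine isZero_lift (H V i j a b ?_ ?_)
  · rw [← Category.assoc, hV, F0.lift_P]
  · rw [← Category.assoc, hV, F0.lift_Q]

/-- To compare two points of the zero scheme it suffices to do so in coordinates. -/
lemma eq_of_forall_local {h h' : T ⟶ P1Z}
    (H : ∀ (V : T.Opens) (i j : Fin 2) (a b : Γ(V.toScheme, ⊤)), V.ι ≫ h = pt i a →
      V.ι ≫ h' = pt j b →
      affineCoords i a 0 * affineCoords j b 1 = affineCoords i a 1 * affineCoords j b 0) :
    h = h' := by
  refine Scheme.hom_ext_of_forall _ _ fun z => ?_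
  obtain ⟨V, hz, i, a, ha⟩ := exists_local_pt h z
  obtain ⟨V', hz', i', a', ha'⟩ := exists_local_pt h' z
  refine ⟨V ⊓ V', ⟨hz, hz'⟩, ?_⟩
  have e : (V ⊓ V').ι ≫ h = pt i ((T.homOfLE inf_le_left : (V ⊓ V').toScheme ⟶ V).appTop a) := by
    rw [← comp_pt, ← ha, Scheme.homOfLE_ι_assoc]
  have e' : (V ⊓ V').ι ≫ h' =
      pt i' ((T.homOfLE inf_le_right : (V ⊓ V').toScheme ⟶ V').appTop a') := by
    rw [← comp_pt, ← ha', Scheme.homOfLE_ι_assoc]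
  rw [e, e', pt_eq_pt_iff]
  exact H _ _ _ _ _ e e'

/-- A scheme over `S` that is isomorphic to the projective line over `S`. -/
def IsLine (f : X ⟶ S) : Prop := ∃ φ : X ≅ P1 S, φ.hom ≫ P1.toBase S = f

lemma isLine_of_snd {f : X ⟶ F0 S} (h : IsIso (f ≫ F0.snd S)) : IsLine (f ≫ F0.toBase S) :=
  ⟨asIso (f ≫ F0.snd S), by simp⟩

lemma toΓ_zero (t : T ⟶ Spec (CommRingCat.of C)) : toΓ t (0 : C) = 0 := map_zero _

lemma IsZero.P_eq {h : T ⟶ F0 (Spec (CommRingCat.of C))} (hu : IsUnit u₁)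
    (hh : IsZero u₁ 0 0 0 0 h) : h ≫ F0.P _ = pt 1 0 := by
  refine Scheme.hom_ext_of_forall _ _ fun z => ?_
  obtain ⟨V, hz, i, j, a, b, hV⟩ := F0.exists_local_eq_lift h z
  have h1 := hh.comp V.ι
  rw [hV] at h1
  have h2 := h1.zeroEqs.1
  simp only [toΓ_zero, mul_zero, sub_zero] at h2
  refine ⟨V, hz, ?_⟩
  rw [← Category.assoc, hV, F0.lift_P, comp_pt, pt_eq_pt_iff]
  rw [(hu.map (toΓ (V.ι ≫ h ≫ F0.toBase _))).mul_right_eq_zero] at h2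
  simp [h2]

/-- The first equation becomes `u₁ α₋ = 0` and pins the first point at `[0 : 1]`. The other two are
then vacuous, so the second factor is free. -/
lemma IsZeroScheme.isLine_left {f : X ⟶ F0 (Spec (CommRingCat.of C))} (hu : IsUnit u₁)
    (hf : IsZeroScheme u₁ 0 0 0 0 f) : IsLine (f ≫ F0.toBase _) := by
  have := hf.mono
  refine isLine_of_snd ?_
  have hm : Mono (f ≫ F0.snd _) := by
    refine ⟨fun a b hab => ?_⟩
    rw [← cancel_mono f]
    have h1 := congrArg (fun g => g ≫ P1.toBase _) hab
    have h2 := congrArg (fun g => g ≫ P1.P _) hab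
    refine F0.hom_ext (by simpa using h1) ?_ (by simpa using h2)
    rw [(hf.isZero.comp a).P_eq hu, (hf.isZero.comp b).P_eq hu]
  obtain ⟨l, hl⟩ := hf.exists_lift (F0.lift (P1.toBase _) (pt 1 0) (P1.P _)) (by
    refine isZero_of_forall_local fun V i j a b ha hb => ?_
    rw [F0.lift_P, comp_pt, map_zero, pt_eq_pt_iff] at ha
    simp only [affineCoords_one_zero, affineCoords_one_one, zero_mul, one_mul] at ha
    simp [ZeroEqs, ← ha])
  have : IsSplitEpi (f ≫ F0.snd _) := ⟨⟨l, P1.hom_ext (by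
    rw [Category.assoc, Category.assoc, F0.snd_toBase, ← Category.assoc, hl]; simp) (by
    rw [Category.assoc, Category.assoc, F0.snd_P, ← Category.assoc, hl]; simp)⟩⟩
  exact isIso_of_mono_of_isSplitEpi _

lemma IsZeroScheme.isLine_right {f : X ⟶ F0 (Spec (CommRingCat.of C))} (hu : IsUnit u₂)
    (hf : IsZeroScheme 0 u₂ 0 0 0 f) : IsLine (f ≫ F0.toBase _) := by
  simpa using hf.swap.isLine_left hu

/-- Only `α₋ α₊ = σ₋ σ₊ u₃` remains. With `u₃` a unit it is the graph of the isomorphism `[α : σ] ↦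
[u₃ σ : α]` of the projective line, hence isomorphic to either factor. -/
lemma IsZeroScheme.isLine_middle {f : X ⟶ F0 (Spec (CommRingCat.of C))} (hu : IsUnit u₃)
    (hf : IsZeroScheme 0 0 u₃ 0 0 f) : IsLine (f ≫ F0.toBase _) := by
  have := hf.mono
  obtain ⟨c, hc⟩ := hu.exists_right_inv
  refine isLine_of_snd ?_
  have hm : Mono (f ≫ F0.snd _) := by
    refine ⟨fun {T} x y hxy => ?_⟩
    rw [← cancel_mono f]
    have h1 := congrArg (fun g => g ≫ P1.toBase _) hxy
    have h2 := congrArg (fun g => g ≫ P1.P _) hxy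
    simp only [Category.assoc, F0.snd_toBase, F0.snd_P] at h1 h2
    refine F0.hom_ext (by simpa using h1) (eq_of_forall_local fun V i i' a a' ha ha' => ?_)
      (by simpa using h2)
    refine Γ_ext fun z => ?_
    obtain ⟨W, hz, j, b, hb⟩ := exists_local_pt (V.ι ≫ x ≫ f ≫ F0.Q _) z
    refine ⟨W, hz, ?_⟩
    have e := (hf.isZero.comp x) (W.ι ≫ V.ι) i j (W.ι.appTop a) b
      (by rw [Category.assoc, ha, comp_pt]) (by simpa using hb)
    have e' := (hf.isZero.comp y) (W.ι ≫ V.ι) i' j (W.ι.appTop a') b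
      (by rw [Category.assoc, ha', comp_pt]) (by rw [← hb]; simp [h2])
    have hbase : (W.ι ≫ V.ι) ≫ (y ≫ f) ≫ F0.toBase _ = (W.ι ≫ V.ι) ≫ (x ≫ f) ≫ F0.toBase _ := by
      rw [Category.assoc y, ← h1, Category.assoc x]
    rw [hbase] at e'
    have e₃ := e.2.2
    have e₃' := e'.2.2
    have hc' := congrArg (toΓ ((W.ι ≫ V.ι) ≫ (x ≫ f) ≫ F0.toBase _)) hc
    simp only [map_mul, map_one, map_affineCoords] at hc' ⊢
    fin_cases j
    · simp only [Fin.zero_eta, affineCoords_zero_zero, affineCoords_zero_one] at e₃ e₃'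
      linear_combination affineCoords i' (W.ι.appTop a') 1 * e₃ -
        affineCoords i (W.ι.appTop a) 1 * e₃'
    · simp only [Fin.mk_one, affineCoords_one_zero, affineCoords_one_one] at e₃ e₃'
      linear_combination
        (affineCoords i' (W.ι.appTop a') 0 * e₃ - affineCoords i (W.ι.appTop a) 0 * e₃') *
          toΓ ((W.ι ≫ V.ι) ≫ (x ≫ f) ≫ F0.toBase _) c -
        (affineCoords i (W.ι.appTop a) 0 * affineCoords i' (W.ι.appTop a') 1 -
          affineCoords i (W.ι.appTop a) 1 * affineCoords i' (W.ι.appTop a') 0) * hc'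
  refine isIso_of_mono_of_local_sections _ fun z => ?_
  obtain ⟨V, hz, j, b, hb⟩ := exists_local_pt (P1.P _) z
  refine ⟨V, hz, ?_⟩
  suffices H : ∃ (i : Fin 2) (a : Γ(V.toScheme, ⊤)), IsZero 0 0 u₃ 0 0
      (F0.lift (V.ι ≫ P1.toBase _) (pt i a) (pt j b)) by
    obtain ⟨i, a, H⟩ := H
    obtain ⟨l, hl⟩ := hf.exists_lift _ H
    refine ⟨l, P1.hom_ext ?_ ?_⟩
    · rw [Category.assoc, Category.assoc, F0.snd_toBase, ← Category.assoc, hl, F0.lift_toBase]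
    · rw [Category.assoc, Category.assoc, F0.snd_P, ← Category.assoc, hl, F0.lift_Q, hb]
  have hc' := congrArg (toΓ (V.ι ≫ P1.toBase _)) hc
  simp only [map_mul, map_one] at hc'
  fin_cases j
  · refine ⟨1, b * toΓ (V.ι ≫ P1.toBase _) u₃, isZero_lift ?_⟩
    simp [ZeroEqs]
  · refine ⟨0, b * toΓ (V.ι ≫ P1.toBase _) c, isZero_lift ?_⟩
    simp only [ZeroEqs, toΓ_zero, Fin.mk_one, affineCoords_one_zero, affineCoords_one_one,
      affineCoords_zero_zero, affineCoords_zero_one]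
    refine ⟨by ring, by ring, ?_⟩
    linear_combination (-b) * hc'

/-! ### The reducible fibre over a triple point -/

section TwoLines

lemma isZero_lift_left : IsZero (0 : C) 0 0 0 0
    (F0.lift (P1.toBase (Spec (CommRingCat.of C))) (pt 1 0) (P1.P _)) := by
  refine isZero_of_forall_local fun V i j a b ha hb => ?_
  rw [F0.lift_P, comp_pt, map_zero, pt_eq_pt_iff] at ha
  simp only [affineCoords_one_zero, affineCoords_one_one, zero_mul, one_mul] at ha
  simp [ZeroEqs, ← ha]

lemma isZero_lift_right : IsZero (0 : C) 0 0 0 0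
    (F0.lift (P1.toBase (Spec (CommRingCat.of C))) (P1.P _) (pt 1 0)) := by
  refine isZero_of_forall_local fun V i j a b ha hb => ?_
  rw [F0.lift_Q, comp_pt, map_zero, pt_eq_pt_iff] at hb
  simp only [affineCoords_one_zero, affineCoords_one_one, zero_mul, one_mul] at hb
  simp [ZeroEqs, ← hb]

/-- With all coefficients zero the chart ideal is generated by the squarefree element `ab`, `b` or
`a` in the charts `(1, 1)`, `(0, 1)`, `(1, 0)`. -/
lemma isReduced_chartRing {k : Type} [Field k] (i j : Fin 2)
    (hij : (i = 1 ∧ j = 1) ∨ (i = 0 ∧ j = 1) ∨ (i = 1 ∧ j = 0)) :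
    _root_.IsReduced (ChartRing (0 : k) 0 0 0 0 i j) := by
  have hX : ∀ n : Fin 2, Prime (MvPolynomial.X n : MvPolynomial (Fin 2) k) :=
    fun n => MvPolynomial.X_prime
  have key : ∀ r : MvPolynomial (Fin 2) k, Squarefree r →
      chartIdeal (0 : k) 0 0 0 0 i j = Ideal.span {r} →
      _root_.IsReduced (ChartRing (0 : k) 0 0 0 0 i j) := by
    intro r hr h
    refine (Ideal.isRadical_iff_quotient_reduced _).mp ?_
    rw [h, ← isRadical_iff_span_singleton]
    exact hr.isRadical
  obtain ⟨rfl, rfl⟩ | ⟨rfl, rfl⟩ | ⟨rfl, rfl⟩ := hij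
  · refine key (MvPolynomial.X 0 * MvPolynomial.X 1) ?_ ?_
    · refine squarefree_mul_iff.mpr ⟨?_, (hX 0).squarefree, (hX 1).squarefree⟩
      refine (hX 0).irreducible.isRelPrime_iff_not_dvd.mpr fun h => ?_
      rw [MvPolynomial.X_dvd_X] at h
      simp at h
    · simp [chartIdeal]
  · refine key (MvPolynomial.X 1) (hX 1).squarefree ?_
    simp [chartIdeal]
  · refine key (MvPolynomial.X 0) (hX 0).squarefree ?_
    simp [chartIdeal]

lemma IsZero.eq_or_eq {K : Type} [Field K] {h : Spec (CommRingCat.of K) ⟶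
    F0 (Spec (CommRingCat.of C))} (hh : IsZero (0 : C) 0 0 0 0 h) :
    h ≫ F0.P _ = pt 1 0 ∨ h ≫ F0.Q _ = pt 1 0 := by
  have hsub : Subsingleton (Spec (CommRingCat.of K)) :=
    inferInstanceAs (Subsingleton (PrimeSpectrum K))
  obtain ⟨i, j, hij⟩ := F0.exists_mem_W (h (⊥ : PrimeSpectrum K))
  obtain ⟨a, b, hab⟩ := F0.exists_eq_lift h i j fun x => by
    rwa [Subsingleton.elim x (⊥ : PrimeSpectrum K)]
  rw [hab] at hh ⊢
  have h3 := hh.zeroEqs.2.2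
  rw [toΓ_zero, mul_zero, sub_zero] at h3
  have hdom : IsDomain Γ(Spec (CommRingCat.of K), ⊤) :=
    (Scheme.ΓSpecIso (CommRingCat.of K)).commRingCatIsoToRingEquiv.toMulEquiv.isDomain K
  rw [F0.lift_P, F0.lift_Q]
  refine (mul_eq_zero.mp h3).imp (fun h => ?_) (fun h => ?_) <;> rw [pt_eq_pt_iff, h] <;> simp

/-- The zero scheme of the equations with vanishing coefficients over a field. -/
lemma IsZeroScheme.isTwoLinesMeetingAtPoint {k : Type} [Field k]
    {f : X ⟶ F0 (Spec (CommRingCat.of k))} (hf : IsZeroScheme (0 : k) 0 0 0 0 f) :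
    IsTwoLinesMeetingAtPoint (f ≫ F0.toBase _) := by
  have := hf.mono
  obtain ⟨i, hi⟩ := hf.exists_lift _ isZero_lift_left
  obtain ⟨j, hj⟩ := hf.exists_lift _ isZero_lift_right
  have hi' : i ≫ f ≫ F0.toBase _ = P1.toBase _ := by rw [← Category.assoc, hi, F0.lift_toBase]
  have hj' : j ≫ f ≫ F0.toBase _ = P1.toBase _ := by rw [← Category.assoc, hj, F0.lift_toBase]
  refine ⟨?_, i, j, hi', hj', ?_, ?_, ?_, ?_⟩
  · have : ∀ l, IsReduced (hf.cover.X l) := by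
      intro l
      have : _root_.IsReduced (ChartRing (0 : k) 0 0 0 0 (![1, 0, 1] l) (![1, 1, 0] l)) := by
        refine isReduced_chartRing _ _ ?_
        change Fin 3 at l
        fin_cases l <;> simp
      exact inferInstanceAs (IsReduced (Spec (CommRingCat.of
        (ChartRing (0 : k) 0 0 0 0 (![1, 0, 1] l) (![1, 1, 0] l)))))
    exact IsReduced.of_openCover _ hf.cover
  -- The line `[0 : 1] × ℙ¹` is a section of the second projection, and a first factor of a closed
  -- immersion is one too when the second factor is separated.
  · have h1 : i ≫ f ≫ F0.snd _ = 𝟙 _ := by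
      rw [← Category.assoc, hi, F0.lift_snd]
      exact P1.hom_ext (by simp) (by simp)
    have : IsClosedImmersion (i ≫ f ≫ F0.snd _) := by rw [h1]; infer_instance
    exact IsClosedImmersion.of_comp i (f ≫ F0.snd _)
  · have h1 : j ≫ f ≫ F0.fst _ = 𝟙 _ := by
      rw [← Category.assoc, hj, F0.lift_fst]
      exact P1.hom_ext (by simp) (by simp)
    have : IsClosedImmersion (j ≫ f ≫ F0.fst _) := by rw [h1]; infer_instance
    exact IsClosedImmersion.of_comp j (f ≫ F0.fst _)
  -- The covering is checked on residue field points, where `α₋ α₊ = 0` makes one of the two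
  -- coordinates vanish.
  · refine Set.eq_univ_of_forall fun z => ?_
    have hz : z ∈ Set.range (X.fromSpecResidueField z) := by
      rw [Scheme.range_fromSpecResidueField]; rfl
    have h0 : IsZero (0 : k) 0 0 0 0 (X.fromSpecResidueField z ≫ f) := hf.isZero.comp _
    obtain h | h := IsZero.eq_or_eq (K := X.residueField z) h0
    · left
      have : X.fromSpecResidueField z = P1.lift (X.fromSpecResidueField z ≫ f ≫ F0.toBase _)
          (X.fromSpecResidueField z ≫ f ≫ F0.Q _) ≫ i := by
        rw [← cancel_mono f, Category.assoc, hi, F0.comp_lift, P1.lift_toBase, P1.lift_P, comp_pt,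
          map_zero]
        exact F0.hom_ext (by simp) (by simpa using h) (by simp)
      rw [this] at hz
      obtain ⟨y, hy⟩ := hz
      exact ⟨_, hy⟩
    · right
      have : X.fromSpecResidueField z = P1.lift (X.fromSpecResidueField z ≫ f ≫ F0.toBase _)
          (X.fromSpecResidueField z ≫ f ≫ F0.P _) ≫ j := by
        rw [← cancel_mono f, Category.assoc, hj, F0.comp_lift, P1.lift_toBase, P1.lift_P, comp_pt,
          map_zero]
        exact F0.hom_ext (by simp) (by simp) (by simpa using h)
      rw [this] at hz
      obtain ⟨y, hy⟩ := hz
      exact ⟨_, hy⟩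
  -- A point of both lines has both coordinates `[0 : 1]`, so the fibre product of the lines is the
  -- base itself, embedded by `pt 1 0`.
  · have hO : P1.lift (𝟙 _) (pt 1 0) ≫ i = P1.lift (𝟙 _) (pt 1 0) ≫ j := by
      rw [← cancel_mono f, Category.assoc, Category.assoc, hi, hj]
      refine F0.hom_ext ?_ ?_ ?_ <;> simp [comp_pt]
    have hc := congrArg (fun g => g ≫ f) (pullback.condition (f := i) (g := j))
    simp only [Category.assoc, hi, hj] at hc
    have h0 := congrArg (fun g => g ≫ F0.toBase _) hc
    have h1 := congrArg (fun g => g ≫ F0.P _) hc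
    have h2 := congrArg (fun g => g ≫ F0.Q _) hc
    simp only [Category.assoc, F0.lift_toBase, F0.lift_P, F0.lift_Q, comp_pt, map_zero] at h0 h1 h2
    have e₁ := pullback.lift_fst (f := i) (g := j) _ _ hO
    have e₂ := pullback.lift_snd (f := i) (g := j) _ _ hO
    refine ⟨pullback.lift _ _ hO, ?_, ?_⟩
    · refine pullback.hom_ext ?_ ?_
      · rw [Category.assoc, Category.assoc, e₁, Category.id_comp]
        exact P1.hom_ext (by simp) (by simp [comp_pt, h2])
      · rw [Category.assoc, Category.assoc, e₂, Category.id_comp]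
        exact P1.hom_ext (by simp [h0]) (by simp [comp_pt, ← h1])
    · rw [← Category.assoc, pullback.lift_fst, P1.lift_toBase]

end TwoLines

/-- The base change of a scheme over `ℙ¹ × ℙ¹`. -/
lemma isPullback_F0_map {S' X' : Scheme.{0}} {f : X ⟶ F0 S} {g : S' ⟶ S} {p : X' ⟶ X}
    {q : X' ⟶ S'} (H : IsPullback p q (f ≫ F0.toBase S) g) :
    IsPullback p (F0.lift q (p ≫ f ≫ F0.P S) (p ≫ f ≫ F0.Q S)) f (F0.map g) := by
  have hw := H.w
  refine ⟨⟨F0.hom_ext ?_ ?_ ?_⟩, ⟨PullbackCone.IsLimit.mk _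
    (fun s => H.lift s.fst (s.snd ≫ F0.toBase _) ?_) (fun s => ?_) (fun s => ?_)
    (fun s m h₁ h₂ => ?_)⟩⟩
  · simp [F0.map, hw]
  · simp [F0.map]
  · simp [F0.map]
  · have := congrArg (fun g => g ≫ F0.toBase _) s.condition
    simpa [F0.map] using this
  · exact H.lift_fst _ _ _
  · have h1 := congrArg (fun g => g ≫ F0.P _) s.condition
    have h2 := congrArg (fun g => g ≫ F0.Q _) s.condition
    simp only [F0.map, Category.assoc, F0.lift_P, F0.lift_Q] at h1 h2
    refine F0.hom_ext ?_ ?_ ?_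
    · simp
    · simp [h1]
    · simp [h2]
  · refine H.hom_ext ?_ ?_
    · rw [h₁, H.lift_fst]
    · rw [H.lift_snd, ← h₂]
      simp

end

section

/-! ### The small resolutions and their fibres -/

namespace Model

variable {A : Type} [CommRing A] (m : Model A) (e : Equiv.Perm (Fin 3))

lemma x_mul_w : m.x * m.w = algebraMap A _ m.w₀ := by
  rw [x, w, ← map_mul]
  exact (Ideal.Quotient.mk_eq_mk_iff_sub_mem _ _).mpr (Ideal.subset_span rfl)

lemma prod_u : m.u (e 0) * m.u (e 1) * m.u (e 2) = m.x * m.w * m.t := by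
  have h := Equiv.prod_comp e m.u
  rwa [Fin.prod_univ_three, Fin.prod_univ_three] at h

lemma forall_iff_perm {P : Fin 3 → Prop} : (∀ k, P k) ↔ P (e 0) ∧ P (e 1) ∧ P (e 2) := by
  rw [← e.forall_congr_right]
  exact ⟨fun h => ⟨h 0, h 1, h 2⟩, fun h k => by fin_cases k <;> simp [h]⟩

lemma mem_line_iff {p : m.patch} {i : Fin 3} : p ∈ m.line i ↔
    m.y ∈ p.asIdeal ∧ m.s ∈ p.asIdeal ∧ ∀ k, k ≠ i → m.u k ∈ p.asIdeal := by
  change _ ∪ _ ⊆ (p.asIdeal : Set m.PatchRing) ↔ _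
  rw [Set.union_subset_iff, Set.insert_subset_iff,
    Set.singleton_subset_iff, and_assoc]
  refine and_congr Iff.rfl (and_congr Iff.rfl ⟨fun h k hk => h ⟨k, hk, rfl⟩, ?_⟩)
  rintro h _ ⟨k, hk, rfl⟩
  exact h k hk

lemma mem_triple_iff {p : m.patch} : p ∈ m.triple ↔
    m.y ∈ p.asIdeal ∧ m.s ∈ p.asIdeal ∧ ∀ k, m.u k ∈ p.asIdeal := by
  change _ ⊆ (p.asIdeal : Set m.PatchRing) ↔ _
  simp only [Set.insert_subset_iff, Set.singleton_subset_iff, SetLike.mem_coe, Fin.forall_fin_succ]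
  simp [u]
  tauto

/-- The union of the lines is the locus where `y`, `s` and at least two of the `uᵢ` vanish; it is
written in the order of `e` to match the equations of the resolution. -/
lemma mem_lines_iff {p : m.patch} : p ∈ m.lines ↔ m.y ∈ p.asIdeal ∧ m.s ∈ p.asIdeal ∧
    ((m.u (e 1) ∈ p.asIdeal ∧ m.u (e 2) ∈ p.asIdeal) ∨
      (m.u (e 0) ∈ p.asIdeal ∧ m.u (e 2) ∈ p.asIdeal) ∨
      (m.u (e 0) ∈ p.asIdeal ∧ m.u (e 1) ∈ p.asIdeal)) := by
  rw [lines, Set.mem_iUnion, ← e.exists_congr_right]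
  simp only [mem_line_iff, exists_and_left, forall_iff_perm e, ne_eq, EmbeddingLike.apply_eq_iff_eq,
    Fin.exists_fin_succ]
  simp

/-- The closed immersion of the resolution. -/
def resolutionι : m.resolution e ⟶ F0 (Spec (CommRingCat.of m.PatchRing)) :=
  (zeroIdeal (m.u (e 0)) (m.u (e 1)) (m.u (e 2)) m.y m.s).subschemeι

instance : IsClosedImmersion (m.resolutionι e) :=
  inferInstanceAs (IsClosedImmersion
    (zeroIdeal (m.u (e 0)) (m.u (e 1)) (m.u (e 2)) m.y m.s).subschemeι)

lemma resolutionι_toBase :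
    m.resolutionι e ≫ F0.toBase (Spec (CommRingCat.of m.PatchRing)) = m.resolutionToPatch e := rfl

lemma isZeroScheme_resolution :
    IsZeroScheme (m.u (e 0)) (m.u (e 1)) (m.u (e 2)) m.y m.s (m.resolutionι e) :=
  isZeroScheme_zeroIdeal

instance : IsClosedImmersion m.fibrationι :=
  IsClosedImmersion.spec_of_surjective _ Ideal.Quotient.mk_surjective

lemma exists_resolutionToFibration :
    ∃ π : m.resolution e ⟶ m.fibration, π ≫ m.fibrationι = m.resolutionToPatch e := by
  refine exists_comp_mk _ _ ?_
  rw [Ideal.span_singleton_le_iff_mem, RingHom.mem_ker, map_sub, sub_eq_zero, ← m.prod_u e]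
  have h := (m.isZeroScheme_resolution e).isZero.mul_eq
  rw [resolutionι_toBase] at h
  simpa only [map_mul] using h

/-- The morphism from the resolution to the fibration. -/
def π : m.resolution e ⟶ m.fibration := (m.exists_resolutionToFibration e).choose

@[simp]
lemma π_fibrationι : m.π e ≫ m.fibrationι = m.resolutionToPatch e :=
  (m.exists_resolutionToFibration e).choose_spec

instance : IsProper (m.resolutionToPatch e) :=
  inferInstanceAs (IsProper (m.resolutionι e ≫ F0.toBase (Spec (CommRingCat.of m.PatchRing))))

instance : IsProper (m.π e) := by
  have : IsProper (m.π e ≫ m.fibrationι) := by rw [π_fibrationι]; infer_instance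
  exact IsProper.of_comp _ m.fibrationι

lemma toΓ_fibrationι :
    toΓ m.fibrationι m.y * toΓ m.fibrationι m.s =
      toΓ m.fibrationι (m.u (e 0)) * toΓ m.fibrationι (m.u (e 1)) *
        toΓ m.fibrationι (m.u (e 2)) := by
  have h : toΓ (𝟙 _ ≫ m.fibrationι) (m.y * m.s - m.x * m.w * m.t) = 0 :=
    le_ker_toΓ_comp_mk (Ideal.span {m.y * m.s - m.x * m.w * m.t}) (𝟙 _) (Ideal.subset_span rfl)
  rw [Category.id_comp, map_sub, sub_eq_zero, ← m.prod_u e] at h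
  simpa only [map_mul] using h

/-- If `y`, `s` and the three products `uᵢuⱼ` lie in a prime ideal, then so do at least two of the
`uᵢ`, and the point is on a line. So off the lines one of the five products is nonzero. An arbitrary
open `V` is allowed because the smoothness of ℰ off the lines is deduced from this isomorphism. -/
lemma isIso_π_restrict {V : m.fibration.Opens} (hV : V ≤ m.offLines) :
    IsIso (m.π e ∣_ V) := by
  refine (m.isZeroScheme_resolution e).isIso_morphismRestrict m.fibrationι (m.π e)
    (m.π_fibrationι e) (m.toΓ_fibrationι e) _ fun z hz => ?_
  have h : m.fibrationι z ∉ m.lines := hV hz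
  by_contra! H
  simp only [Set.mem_insert_iff, Set.mem_singleton_iff, forall_eq_or_imp, forall_eq] at H
  obtain ⟨h₁, h₂, h₃, h₄, h₅⟩ := H
  have hp := (m.fibrationι z).isPrime
  have hm : ∀ r, m.fibrationι z ∉ PrimeSpectrum.basicOpen r → r ∈ (m.fibrationι z).asIdeal :=
    fun r hr => not_not.mp hr
  have h₃ := hp.mem_or_mem (hm _ h₃)
  have h₄ := hp.mem_or_mem (hm _ h₄)
  have h₅ := hp.mem_or_mem (hm _ h₅)
  refine h ((m.mem_lines_iff e).mpr ⟨hm _ h₁, hm _ h₂, ?_⟩)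
  tauto

/-- Fibres inherit the functorial description by base change: the fibre is the zero scheme of the
five residues, and which of these vanish is read off from the prime ideal of `q`. -/
lemma exists_isZeroScheme_fiber (q : m.fibration) :
    ∃ (φ : m.PatchRing →+* m.fibration.residueField q)
      (f : (m.π e).fiber q ⟶ F0 (Spec (CommRingCat.of (m.fibration.residueField q)))),
      (∀ r, φ r = 0 ↔ r ∈ (m.fibrationι q).asIdeal) ∧
      IsZeroScheme (φ (m.u (e 0))) (φ (m.u (e 1))) (φ (m.u (e 2))) (φ m.y) (φ m.s) f ∧
      f ≫ F0.toBase _ = (m.π e).fiberToSpecResidueField q := by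
  obtain ⟨φ, hφ⟩ : ∃ φ : m.PatchRing →+* m.fibration.residueField q,
      Spec.map (CommRingCat.ofHom φ) = m.fibration.fromSpecResidueField q ≫ m.fibrationι :=
    ⟨(Spec.preimage (m.fibration.fromSpecResidueField q ≫ m.fibrationι)).hom,
      Spec.map_preimage _⟩
  -- Since the embedding of ℰ in the patch is a monomorphism, the fibre over `q` may be computed
  -- over the patch.
  have H : IsPullback ((m.π e).fiberι q) ((m.π e).fiberToSpecResidueField q)
      (m.resolutionι e ≫ F0.toBase _) (Spec.map (CommRingCat.ofHom φ)) := by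
    have h1 : IsPullback ((m.π e).fiberι q) ((m.π e).fiberToSpecResidueField q) (m.π e)
      (m.fibration.fromSpecResidueField q) := IsPullback.of_hasPullback _ _
    rw [resolutionι_toBase, ← π_fibrationι]
    refine ⟨⟨?_⟩, ⟨PullbackCone.IsLimit.mk _ (fun s => h1.lift s.fst s.snd ?_) (fun s => ?_)
      (fun s => ?_) (fun s l hl₁ hl₂ => ?_)⟩⟩
    · rw [← Category.assoc, h1.w, Category.assoc]
      exact congrArg _ hφ.symm
    · rw [← cancel_mono m.fibrationι, Category.assoc, s.condition, Category.assoc]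
      exact congrArg _ hφ
    · exact h1.lift_fst _ _ _
    · exact h1.lift_snd _ _ _
    · exact h1.hom_ext (by rw [hl₁, h1.lift_fst]) (by rw [hl₂, h1.lift_snd])
  refine ⟨φ, _, fun r => ?_, (m.isZeroScheme_resolution e).of_isPullback (isPullback_F0_map H),
    F0.lift_toBase _ _ _⟩
  have h2 : m.fibrationι q = Spec.map (CommRingCat.ofHom φ)
      (⊥ : PrimeSpectrum (m.fibration.residueField q)) := by
    rw [hφ]
    exact congrArg m.fibrationι (Scheme.fromSpecResidueField_apply q _).symm
  rw [h2]
  rfl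

/-- Exactly one of the `uᵢ` is nonzero at `q`; its place in `(u₁, u₂, u₃)` decides whether the line
is `[0 : 1] × ℙ¹`, `ℙ¹ × [0 : 1]` or a graph. -/
theorem exists_iso_fiber (q : m.fibration) (h : m.fibrationι q ∈ m.lines)
    (h' : m.fibrationι q ∉ m.triple) :
    IsLine (S := Spec (m.fibration.residueField q)) ((m.π e).fiberToSpecResidueField q) := by
  obtain ⟨φ, f, hφ, hf, hb⟩ := m.exists_isZeroScheme_fiber e q
  rw [← hb]
  rw [mem_triple_iff, forall_iff_perm e] at h'
  rw [m.mem_lines_iff e] at h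
  simp only [← hφ] at h h'
  obtain ⟨h₁, h₂, h₃⟩ := h
  rw [h₁, h₂] at hf
  obtain ⟨h₃, h₄⟩ | ⟨h₃, h₄⟩ | ⟨h₃, h₄⟩ := h₃ <;> rw [h₃, h₄] at hf
  · exact hf.isLine_left (isUnit_iff_ne_zero.mpr fun h => h' ⟨h₁, h₂, h, h₃, h₄⟩)
  · exact hf.isLine_right (isUnit_iff_ne_zero.mpr fun h => h' ⟨h₁, h₂, h₃, h, h₄⟩)
  · exact hf.isLine_middle (isUnit_iff_ne_zero.mpr fun h => h' ⟨h₁, h₂, h₃, h₄, h⟩)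

theorem isTwoLinesMeetingAtPoint_fiber (q : m.fibration) (h : m.fibrationι q ∈ m.triple) :
    IsTwoLinesMeetingAtPoint ((m.π e).fiberToSpecResidueField q) := by
  obtain ⟨φ, f, hφ, hf, hb⟩ := m.exists_isZeroScheme_fiber e q
  rw [← hb]
  rw [mem_triple_iff, forall_iff_perm e] at h
  simp only [← hφ] at h
  obtain ⟨h₁, h₂, h₃, h₄, h₅⟩ := h
  rw [h₁, h₂, h₃, h₄, h₅] at hf
  exact hf.isTwoLinesMeetingAtPoint

theorem resolution_mem_divisor_iff (p : m.resolution e) :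
    (m.resolutionToPatch e ≫ m.patchToBase) p ∈ PrimeSpectrum.zeroLocus {m.w₀} ↔
      m.resolutionToPatch e p ∈ PrimeSpectrum.zeroLocus {m.w * m.x} := by
  change {m.w₀} ⊆ (Ideal.comap (algebraMap A m.PatchRing)
    (m.resolutionToPatch e p).asIdeal : Set A) ↔ {m.w * m.x} ⊆ ((m.resolutionToPatch e p).asIdeal :
      Set m.PatchRing)
  rw [Set.singleton_subset_iff, Set.singleton_subset_iff, SetLike.mem_coe, Ideal.mem_comap,
    ← x_mul_w, mul_comm m.w m.x, SetLike.mem_coe]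

end Model

end

section

/-! ### The charts as base changes of affine spaces -/

lemma isPushout_of_forall {A B D P : Type} [CommRing A] [CommRing B] [CommRing D] [CommRing P]
    (f : A →+* B) (g : A →+* D) (h : B →+* P) (k : D →+* P) (w : h.comp f = k.comp g)
    (H : ∀ (T : Type) [CommRing T] (φ : B →+* T) (ψ : D →+* T), φ.comp f = ψ.comp g →
      ∃ χ : P →+* T, χ.comp h = φ ∧ χ.comp k = ψ)
    (H' : ∀ (T : Type) [CommRing T] (χ χ' : P →+* T), χ.comp h = χ'.comp h →
      χ.comp k = χ'.comp k → χ = χ') :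
    IsPushout (CommRingCat.ofHom f) (CommRingCat.ofHom g) (CommRingCat.ofHom h)
      (CommRingCat.ofHom k) := by
  have hw : ∀ s : PushoutCocone (CommRingCat.ofHom f) (CommRingCat.ofHom g),
      s.inl.hom.comp f = s.inr.hom.comp g := fun s => congrArg CommRingCat.Hom.hom s.condition
  choose χ hχ hχ' using fun s : PushoutCocone (CommRingCat.ofHom f) (CommRingCat.ofHom g) =>
    H s.pt s.inl.hom s.inr.hom (hw s)
  refine ⟨⟨by rw [← CommRingCat.ofHom_comp, w, CommRingCat.ofHom_comp]⟩,
    ⟨PushoutCocone.IsColimit.mk _ (fun s => CommRingCat.ofHom (χ s)) (fun s => ?_) (fun s => ?_)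
      (fun s m h₁ h₂ => ?_)⟩⟩
  · exact CommRingCat.hom_ext (hχ s)
  · exact CommRingCat.hom_ext (hχ' s)
  · refine CommRingCat.hom_ext (H' _ _ _ ?_ ?_)
    · exact (congrArg CommRingCat.Hom.hom h₁).trans (hχ s).symm
    · exact (congrArg CommRingCat.Hom.hom h₂).trans (hχ' s).symm

lemma zeroEqs_mk {C : Type} [CommRing C] (u₁ u₂ u₃ v₁ v₂ : C) (i j : Fin 2) : ZeroEqs (algebraMap C (ChartRing u₁ u₂ u₃ v₁ v₂ i j) u₁)
    (algebraMap C _ u₂) (algebraMap C _ u₃) (algebraMap C _ v₁) (algebraMap C _ v₂)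
    (affineCoords i (Ideal.Quotient.mk _ (MvPolynomial.X 0)))
    (affineCoords j (Ideal.Quotient.mk _ (MvPolynomial.X 1))) :=
  chartIdeal_le_ker_iff.mp (Ideal.mk_ker (I := chartIdeal u₁ u₂ u₃ v₁ v₂ i j)).ge

section

variable {C : Type} [CommRing C] [Algebra ℂ C]

/-- The ring homomorphism from a polynomial ring with given values at the variables. -/
def evalHom {n : ℕ} (v : Fin n → C) : MvPolynomial (Fin n) ℂ →+* C :=
  (MvPolynomial.aeval v : MvPolynomial (Fin n) ℂ →ₐ[ℂ] C).toRingHom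

@[simp]
lemma evalHom_X {n : ℕ} (v : Fin n → C) (k : Fin n) : evalHom v (MvPolynomial.X k) = v k :=
  MvPolynomial.aeval_X v k

@[simp]
lemma evalHom_C {n : ℕ} (v : Fin n → C) (c : ℂ) : evalHom v (MvPolynomial.C c) = algebraMap ℂ C c :=
  MvPolynomial.aeval_C v c

variable {u₁ u₂ u₃ v₁ v₂ : C}

/-- A homomorphism from the chart ring is a homomorphism from `C` together with a solution of the
equations. If the polynomials `κ` and `(a, b)` form a solution over `ℂ[X₀, …, X₃]` and every
variable occurs among them, this is the same as compatible homomorphisms from `C` and from the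
polynomial ring. So the chart is a base change of `κ : 𝔸⁴ ⟶ 𝔸⁵`. -/
lemma isPushout_chartRing (i j : Fin 2) (κ : Fin 5 → MvPolynomial (Fin 4) ℂ)
    (a b : MvPolynomial (Fin 4) ℂ) (l : Fin 4 → ChartRing u₁ u₂ u₃ v₁ v₂ i j)
    (h₁ : ZeroEqs (κ 0) (κ 1) (κ 2) (κ 3) (κ 4) (affineCoords i a) (affineCoords j b))
    (h₂ : ∀ n, evalHom l (κ n) = algebraMap C _ (![u₁, u₂, u₃, v₁, v₂] n))
    (ha : evalHom l a = Ideal.Quotient.mk _ (MvPolynomial.X 0))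
    (hb : evalHom l b = Ideal.Quotient.mk _ (MvPolynomial.X 1))
    (h₃ : ∀ n, (∃ n', MvPolynomial.X n = κ n') ∨ MvPolynomial.X n = a ∨ MvPolynomial.X n = b) :
    IsPushout (CommRingCat.ofHom (evalHom ![u₁, u₂, u₃, v₁, v₂])) (CommRingCat.ofHom (evalHom κ))
      (CommRingCat.ofHom (algebraMap C (ChartRing u₁ u₂ u₃ v₁ v₂ i j)))
      (CommRingCat.ofHom (evalHom l)) := by
  refine isPushout_of_forall _ _ _ _ ?_ (fun T _ φ ψ h => ?_) (fun T _ χ χ' h h' => ?_)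
  · refine MvPolynomial.ringHom_ext (fun c => ?_) (fun n => ?_)
    · simp [← MvPolynomial.algebraMap_eq, ← IsScalarTower.algebraMap_apply]
    · simp [h₂]
  · have hκ : ∀ n, ψ (κ n) = φ (![u₁, u₂, u₃, v₁, v₂] n) := fun n => by
      simpa using (RingHom.congr_fun h (MvPolynomial.X n)).symm
    have hc : ∀ c, ψ (MvPolynomial.C c) = φ (algebraMap ℂ C c) := fun c => by
      simpa using (RingHom.congr_fun h (MvPolynomial.C c)).symm
    have hle : chartIdeal u₁ u₂ u₃ v₁ v₂ i j ≤
        RingHom.ker (MvPolynomial.eval₂Hom φ ![ψ a, ψ b]) := by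
      rw [chartIdeal_le_ker_iff]
      have := h₁.map ψ
      rw [hκ, hκ, hκ, hκ, hκ] at this
      simpa using this
    let χ : ChartRing u₁ u₂ u₃ v₁ v₂ i j →+* T := Ideal.Quotient.lift _ _ hle
    have hχC : ∀ r, χ (algebraMap C _ r) = φ r := fun r =>
      (Ideal.Quotient.lift_mk _ _ _).trans (by simp)
    have hχX : ∀ r, χ (Ideal.Quotient.mk _ r) = MvPolynomial.eval₂Hom φ ![ψ a, ψ b] r := fun r =>
      Ideal.Quotient.lift_mk _ _ _
    refine ⟨χ, RingHom.ext hχC, MvPolynomial.ringHom_ext (fun c => ?_) (fun n => ?_)⟩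
    · rw [hc, ← hχC, RingHom.comp_apply, evalHom_C, ← IsScalarTower.algebraMap_apply]
    · rw [RingHom.comp_apply]
      obtain ⟨n', hn⟩ | hn | hn := h₃ n
      · rw [hn, h₂, hχC, hκ]
      · rw [hn, ha, hχX]
        simp
      · rw [hn, hb, hχX]
        simp
  · refine Ideal.Quotient.ringHom_ext (MvPolynomial.ringHom_ext (fun c => ?_) (fun n => ?_))
    · exact RingHom.congr_fun h c
    · fin_cases n
      · have := RingHom.congr_fun h' a
        simp only [RingHom.comp_apply, ha] at this
        exact this
      · have := RingHom.congr_fun h' b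
        simp only [RingHom.comp_apply, hb] at this
        exact this

variable (u₁ u₂ u₃ v₁ v₂)

/-- The coordinates `(u₁, u₂, a, b)` of the chart `(1, 1)`. -/
def chartCoords₁₁ : Fin 4 → ChartRing u₁ u₂ u₃ v₁ v₂ 1 1 :=
  ![algebraMap C _ u₁, algebraMap C _ u₂, Ideal.Quotient.mk _ (MvPolynomial.X 0),
    Ideal.Quotient.mk _ (MvPolynomial.X 1)]

/-- The coordinates `(v₁, u₂, u₃, a)` of the chart `(0, 1)`. -/
def chartCoords₀₁ : Fin 4 → ChartRing u₁ u₂ u₃ v₁ v₂ 0 1 :=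
  ![algebraMap C _ v₁, algebraMap C _ u₂, algebraMap C _ u₃,
    Ideal.Quotient.mk _ (MvPolynomial.X 0)]

/-- The functions `(u₁, u₂, u₃, v₁, v₂)` in terms of the coordinates of the chart `(1, 1)`. -/
def monomials₁₁ : Fin 5 → MvPolynomial (Fin 4) ℂ :=
  ![.X 0, .X 1, .X 2 * .X 3, .X 0 * .X 2, .X 1 * .X 3]

/-- The functions `(u₁, u₂, u₃, v₁, v₂)` in terms of the coordinates of the chart `(0, 1)`. -/
def monomials₀₁ : Fin 5 → MvPolynomial (Fin 4) ℂ :=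
  ![.X 3 * .X 0, .X 1, .X 2, .X 0, .X 1 * .X 2 * .X 3]

/-- In this chart `u₃ = ab`, `v₁ = u₁a` and `v₂ = u₂b`, so `u₁, u₂, a, b` are free. -/
lemma isPushout₁₁ :
    IsPushout (CommRingCat.ofHom (evalHom ![u₁, u₂, u₃, v₁, v₂]))
      (CommRingCat.ofHom (evalHom monomials₁₁))
      (CommRingCat.ofHom (algebraMap C (ChartRing u₁ u₂ u₃ v₁ v₂ 1 1)))
      (CommRingCat.ofHom (evalHom (chartCoords₁₁ u₁ u₂ u₃ v₁ v₂))) := by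
  obtain ⟨h₁, h₂, h₃⟩ := zeroEqs_mk u₁ u₂ u₃ v₁ v₂ 1 1
  simp only [affineCoords_one_zero, affineCoords_one_one, one_mul, mul_one] at h₁ h₂ h₃
  refine isPushout_chartRing 1 1 _ (.X 2) (.X 3) _ ?_ (fun n => ?_) ?_ ?_ (fun n => ?_)
  · simp [ZeroEqs, monomials₁₁]
  · fin_cases n <;> simp [monomials₁₁, chartCoords₁₁]
    · linear_combination h₃
    · linear_combination h₁
    · linear_combination h₂
  · simp [chartCoords₁₁]
  · simp [chartCoords₁₁]
  · fin_cases n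
    · exact .inl ⟨0, rfl⟩
    · exact .inl ⟨1, rfl⟩
    · exact .inr (.inl rfl)
    · exact .inr (.inr rfl)

/-- In this chart `u₁ = a v₁`, `b = a u₃` and `v₂ = u₂ b`, which eliminates `u₁`, `b` and `v₂`. -/
lemma isPushout₀₁ :
    IsPushout (CommRingCat.ofHom (evalHom ![u₁, u₂, u₃, v₁, v₂]))
      (CommRingCat.ofHom (evalHom monomials₀₁))
      (CommRingCat.ofHom (algebraMap C (ChartRing u₁ u₂ u₃ v₁ v₂ 0 1)))
      (CommRingCat.ofHom (evalHom (chartCoords₀₁ u₁ u₂ u₃ v₁ v₂))) := by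
  obtain ⟨h₁, h₂, h₃⟩ := zeroEqs_mk u₁ u₂ u₃ v₁ v₂ 0 1
  simp only [affineCoords_one_zero, affineCoords_one_one, affineCoords_zero_zero,
    affineCoords_zero_one, one_mul, mul_one] at h₁ h₂ h₃
  refine isPushout_chartRing 0 1 _ (.X 3) (.X 3 * .X 2) _ ?_ (fun n => ?_) ?_ ?_ (fun n => ?_)
  · simp only [ZeroEqs, monomials₀₁]
    refine ⟨by simp, by simp; ring, by simp⟩
  · fin_cases n <;> simp [monomials₀₁, chartCoords₀₁]
    · linear_combination -h₁
    · linear_combination h₂ - algebraMap C (ChartRing u₁ u₂ u₃ v₁ v₂ 0 1) u₂ * h₃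
  · simp [chartCoords₀₁]
  · simp [chartCoords₀₁]
    linear_combination -h₃
  · fin_cases n
    · exact .inl ⟨3, rfl⟩
    · exact .inl ⟨1, rfl⟩
    · exact .inl ⟨2, rfl⟩
    · exact .inr (.inl rfl)

end

end

section

/-! ### Smoothness of the zero scheme -/

instance : IsZariskiLocalAtSource (@Smooth : MorphismProperty Scheme.{0}) :=
  HasRingHomProperty.instIsZariskiLocalAtSource (P := @Smooth)

instance : IsZariskiLocalAtSource (@Flat : MorphismProperty Scheme.{0}) :=
  HasRingHomProperty.instIsZariskiLocalAtSource (P := @Flat)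

lemma of_forall_exists_isOpenImmersion (P : MorphismProperty Scheme.{0}) [IsZariskiLocalAtSource P]
    {X Y : Scheme.{0}} (f : X ⟶ Y) (H : ∀ x : X, ∃ (Z : Scheme.{0}) (j : Z ⟶ X),
      IsOpenImmersion j ∧ x ∈ Set.range j ∧ P (j ≫ f)) : P f := by
  choose Z j hj hx hP using H
  exact IsZariskiLocalAtSource.of_openCover
    (Scheme.Cover.mkOfCovers X Z j (fun x => ⟨x, hx x⟩) hj : X.OpenCover) hP

section

variable {C : Type} [CommRing C] {u₁ u₂ u₃ v₁ v₂ : C} {X : Scheme.{0}}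

lemma chartZeros_toBase (i j : Fin 2) : chartZeros u₁ u₂ u₃ v₁ v₂ i j ≫ F0.toBase _ =
    Spec.map (CommRingCat.ofHom (algebraMap C (ChartRing u₁ u₂ u₃ v₁ v₂ i j))) := by
  have h := comp_chart (𝟙 (Spec (CommRingCat.of (MvPolynomial (Fin 2) C)))) i j
  rw [Category.id_comp, Category.id_comp] at h
  rw [chartZeros, h, Category.assoc, F0.lift_toBase, planeToBase, ← Spec.map_comp,
    ← CommRingCat.ofHom_comp]
  rfl

lemma IsZeroScheme.chart_toBase {f : X ⟶ F0 (Spec (CommRingCat.of C))}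
    (hf : IsZeroScheme u₁ u₂ u₃ v₁ v₂ f) (i j : Fin 2) : hf.chart i j ≫ f ≫ F0.toBase _ =
      Spec.map (CommRingCat.ofHom (algebraMap C (ChartRing u₁ u₂ u₃ v₁ v₂ i j))) := by
  rw [← Category.assoc, hf.chart_comp, chartZeros_toBase]

lemma IsZeroScheme.range_swap_chart {f : X ⟶ F0 (Spec (CommRingCat.of C))}
    (hf : IsZeroScheme u₁ u₂ u₃ v₁ v₂ f) (i j : Fin 2) :
    Set.range (hf.swap.chart j i) = Set.range (hf.chart i j) := by
  rw [hf.swap.range_chart, hf.range_chart]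
  ext z
  change ((f ≫ F0.swap _) ≫ F0.P _) z ∈ P1Z.U j ∧ ((f ≫ F0.swap _) ≫ F0.Q _) z ∈ P1Z.U i ↔
    (f ≫ F0.P _) z ∈ P1Z.U i ∧ (f ≫ F0.Q _) z ∈ P1Z.U j
  rw [Category.assoc, Category.assoc, F0.swap_P, F0.swap_Q, and_comm]

lemma IsZeroScheme.swap_toBase (f : X ⟶ F0 (Spec (CommRingCat.of C))) :
    (f ≫ F0.swap _) ≫ F0.toBase _ = f ≫ F0.toBase _ := by
  rw [Category.assoc, F0.swap_toBase]

end

variable {C : Type} [CommRing C] [Algebra ℂ C]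

/-- The structure morphism of an affine scheme over the complex numbers. -/
def toC (C : Type) [CommRing C] [Algebra ℂ C] :
    Spec (CommRingCat.of C) ⟶ Spec (CommRingCat.of ℂ) :=
  Spec.map (CommRingCat.ofHom (algebraMap ℂ C))

/-- The morphism to affine space given by functions. -/
def toAffine {n : ℕ} (v : Fin n → C) :
    Spec (CommRingCat.of C) ⟶ Spec (CommRingCat.of (MvPolynomial (Fin n) ℂ)) :=
  Spec.map (CommRingCat.ofHom (evalHom v))

lemma toAffine_toC {n : ℕ} (v : Fin n → C) : toAffine v ≫ toC _ = toC C := by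
  rw [toAffine, toC, toC, ← Spec.map_comp, ← CommRingCat.ofHom_comp]
  congr 2
  exact RingHom.ext fun c => evalHom_C v c

instance (n : ℕ) : Smooth (toC (MvPolynomial (Fin n) ℂ)) := by
  rw [toC, HasRingHomProperty.Spec_iff (P := @Smooth), CommRingCat.hom_ofHom,
    RingHom.smooth_algebraMap]
  exact {}

lemma isPullback_restrict {X Y Z W : Scheme.{0}} {k : X ⟶ Y} {p : X ⟶ Z} {κ : Y ⟶ W} {g : Z ⟶ W}
    (H : IsPullback k p κ g) (U : Z.Opens) :
    IsPullback ((p ⁻¹ᵁ U).ι ≫ k) (p ∣_ U) κ (U.ι ≫ g) :=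
  (isPullback_morphismRestrict p U).flip.paste_horiz H

lemma smooth_restrict {X Y Z W : Scheme.{0}} {k : X ⟶ Y} {p : X ⟶ Z} {κ : Y ⟶ W} {g : Z ⟶ W}
    (H : IsPullback k p κ g) (U : Z.Opens) (hU : Smooth (U.ι ≫ g)) :
    Smooth ((p ⁻¹ᵁ U).ι ≫ k) :=
  MorphismProperty.of_isPullback (isPullback_restrict H U).flip hU

variable (u₁ u₂ u₃ v₁ v₂ : C)

lemma isPullback_chart₁₁ :
    IsPullback (toAffine (chartCoords₁₁ u₁ u₂ u₃ v₁ v₂))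
      (Spec.map (CommRingCat.ofHom (algebraMap C (ChartRing u₁ u₂ u₃ v₁ v₂ 1 1))))
      (toAffine monomials₁₁) (toAffine ![u₁, u₂, u₃, v₁, v₂]) :=
  (isPullback_SpecMap_of_isPushout _ _ _ _ (isPushout₁₁ u₁ u₂ u₃ v₁ v₂)).flip

lemma isPullback_chart₀₁ :
    IsPullback (toAffine (chartCoords₀₁ u₁ u₂ u₃ v₁ v₂))
      (Spec.map (CommRingCat.ofHom (algebraMap C (ChartRing u₁ u₂ u₃ v₁ v₂ 0 1))))
      (toAffine monomials₀₁) (toAffine ![u₁, u₂, u₃, v₁, v₂]) :=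
  (isPullback_SpecMap_of_isPushout _ _ _ _ (isPushout₀₁ u₁ u₂ u₃ v₁ v₂)).flip

variable {u₁ u₂ u₃ v₁ v₂} {X : Scheme.{0}}

lemma smooth_toAffine_comp {n : ℕ} {v : Fin n → C} (σ : Equiv.Perm (Fin n))
    {U : (Spec (CommRingCat.of C)).Opens} (hU : Smooth (U.ι ≫ toAffine v)) :
    Smooth (U.ι ≫ toAffine (v ∘ σ)) := by
  have h : toAffine (v ∘ σ) = toAffine v ≫ Spec.map (CommRingCat.ofHom
      (MvPolynomial.renameEquiv ℂ σ).toRingEquiv.toRingHom) := by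
    rw [toAffine, toAffine, ← Spec.map_comp, ← CommRingCat.ofHom_comp]
    congr 2
    refine MvPolynomial.ringHom_ext (fun c => ?_) (fun k => ?_) <;> simp
  have : IsIso (CommRingCat.ofHom (MvPolynomial.renameEquiv ℂ σ).toRingEquiv.toRingHom) :=
    (MvPolynomial.renameEquiv ℂ σ).toRingEquiv.toCommRingCatIso.isIso_hom
  rw [h, ← Category.assoc]
  exact MorphismProperty.comp_mem _ _ _ hU inferInstance

lemma smooth_toAffine_swap {U : (Spec (CommRingCat.of C)).Opens}
    (hU : Smooth (U.ι ≫ toAffine ![u₁, u₂, u₃, v₁, v₂])) :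
    Smooth (U.ι ≫ toAffine ![u₂, u₁, u₃, v₂, v₁]) := by
  have := smooth_toAffine_comp (Equiv.swap 0 1 * Equiv.swap 3 4) hU
  convert! this using 3
  funext k
  fin_cases k <;> rfl

/-- Over `U` each chart is smooth over `𝔸⁴`, as a base change of the smooth map `U ⟶ 𝔸⁵`, and `𝔸⁴`
is smooth over `ℂ`. The chart `(1, 0)` is treated as the chart `(0, 1)` of the swapped equations. -/
lemma IsZeroScheme.smooth {f : X ⟶ F0 (Spec (CommRingCat.of C))}
    (hf : IsZeroScheme u₁ u₂ u₃ v₁ v₂ f) {U : (Spec (CommRingCat.of C)).Opens}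
    (hU : Smooth (U.ι ≫ toAffine ![u₁, u₂, u₃, v₁, v₂])) :
    Smooth (((f ≫ F0.toBase _) ⁻¹ᵁ U).ι ≫ (f ≫ F0.toBase _) ≫ toC C) := by
  have key : ∀ {S : Type} [CommRing S] [Algebra ℂ S] (c : Spec (CommRingCat.of S) ⟶ X)
      [IsOpenImmersion c] (k : Fin 4 → S), c ≫ (f ≫ F0.toBase _) ≫ toC C = toC S →
      Smooth (((c ≫ f ≫ F0.toBase _) ⁻¹ᵁ U).ι ≫ toAffine k) →
      ∀ z : (f ≫ F0.toBase _) ⁻¹ᵁ U, z.1 ∈ Set.range c →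
      ∃ (Z : Scheme.{0}) (j : Z ⟶ (f ≫ F0.toBase _) ⁻¹ᵁ U), IsOpenImmersion j ∧ z ∈ Set.range j ∧
        Smooth (j ≫ ((f ≫ F0.toBase _) ⁻¹ᵁ U).ι ≫ (f ≫ F0.toBase _) ≫ toC C) := by
    rintro S _ _ c _ k hc hk z ⟨y, hy⟩
    have hz : c y ∈ (f ≫ F0.toBase _) ⁻¹ᵁ U := by rw [hy]; exact z.2
    refine ⟨_, c ∣_ ((f ≫ F0.toBase _) ⁻¹ᵁ U), inferInstance, ⟨⟨y, hz⟩, ?_⟩, ?_⟩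
    · exact Subtype.ext ((morphismRestrict_base_coe _ _ _).trans hy)
    · rw [morphismRestrict_ι_assoc, hc, ← toAffine_toC k, ← Category.assoc]
      have := hk
      exact MorphismProperty.comp_mem _ _ _ hk inferInstance
  refine of_forall_exists_isOpenImmersion @Smooth _ fun z => ?_
  have h : ∀ {S : Type} [CommRing S] [Algebra ℂ S] [Algebra C S] [IsScalarTower ℂ C S],
      Spec.map (CommRingCat.ofHom (algebraMap C S)) ≫ toC C = toC S := by
    intro S _ _ _ _
    rw [toC, ← Spec.map_comp, ← CommRingCat.ofHom_comp, ← IsScalarTower.algebraMap_eq, toC]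
  obtain hz | hz | hz := hf.exists_mem_range_chart z.1
  · have := hf.isOpenImmersion_chart 1 1
    refine key (hf.chart 1 1) (chartCoords₁₁ u₁ u₂ u₃ v₁ v₂) ?_ ?_ z hz
    · rw [← Category.assoc, hf.chart_toBase, h]
    · rw [hf.chart_toBase]
      exact smooth_restrict (isPullback_chart₁₁ u₁ u₂ u₃ v₁ v₂) U hU
  · have := hf.isOpenImmersion_chart 0 1
    refine key (hf.chart 0 1) (chartCoords₀₁ u₁ u₂ u₃ v₁ v₂) ?_ ?_ z hz
    · rw [← Category.assoc, hf.chart_toBase, h]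
    · rw [hf.chart_toBase]
      exact smooth_restrict (isPullback_chart₀₁ u₁ u₂ u₃ v₁ v₂) U hU
  · have := hf.swap.isOpenImmersion_chart 0 1
    rw [← hf.range_swap_chart] at hz
    have hb := hf.swap.chart_toBase 0 1
    rw [IsZeroScheme.swap_toBase] at hb
    refine key (hf.swap.chart 0 1) (chartCoords₀₁ u₂ u₁ u₃ v₂ v₁) ?_ ?_ z hz
    · rw [← Category.assoc, hb, h]
    · rw [hb]
      exact smooth_restrict (isPullback_chart₀₁ u₂ u₁ u₃ v₂ v₁) U (smooth_toAffine_swap hU)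

end

section

/-! ### Commutative algebra: flat local homomorphisms from polynomial rings -/

section

variable {R O : Type} [CommRing R] [CommRing O] [IsLocalRing O]

/-- Divisibility descends along a flat homomorphism to a local ring up to a factor which becomes
a unit. -/
lemma exists_dvd_of_flat {θ : R →+* O} (hθ : θ.Flat) {a b : R} (h : θ a ∣ θ b) :
    ∃ t, IsUnit (θ t) ∧ a ∣ t * b := by
  algebraize [θ]
  let p := (IsLocalRing.maximalIdeal O).comap θ
  have hu : ∀ t : p.primeCompl, IsUnit (θ t) := fun t => by
    by_contra ht
    exact t.2 ht
  let θ' : Localization.AtPrime p →+* O := IsLocalization.lift (M := p.primeCompl) hu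
  algebraize [θ']
  have : IsScalarTower R (Localization.AtPrime p) O :=
    .of_algebraMap_eq fun r => (IsLocalization.lift_eq hu r).symm
  have : Module.Flat (Localization.AtPrime p) O :=
    (Module.flat_iff_of_isLocalization (Localization.AtPrime p) p.primeCompl O).mpr inferInstance
  have hθ' : ∀ r, θ' (algebraMap R _ r) = θ r := fun r => IsLocalization.lift_eq hu r
  have : IsLocalHom (algebraMap (Localization.AtPrime p) O) := by
    refine ⟨fun x hx => ?_⟩
    obtain ⟨⟨r, d⟩, hr⟩ := IsLocalization.surj p.primeCompl x
    have h1 : θ' x * θ d = θ r := by rw [← hθ', ← hθ', ← map_mul]; exact congrArg θ' hr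
    have h2 : IsUnit (θ r) := h1 ▸ (show IsUnit (θ' x) from hx).mul (hu d)
    have h3 : IsUnit (x * algebraMap R _ d.1) := by
      rw [hr]
      exact IsLocalization.map_units _ (⟨r, fun h => h h2⟩ : p.primeCompl)
    exact isUnit_of_mul_isUnit_left h3
  -- A flat local homomorphism is faithfully flat, so principal ideals are contracted from their
  -- extensions and the divisibility descends to the localization. Clearing denominators costs the
  -- factor `d' * d`, which lies outside the contracted prime.
  have : Module.FaithfullyFlat (Localization.AtPrime p) O :=
    Module.FaithfullyFlat.of_flat_of_isLocalHom
  have h' : algebraMap R (Localization.AtPrime p) a ∣ algebraMap R _ b := by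
    rw [← Ideal.mem_span_singleton, ← Ideal.comap_map_eq_self_of_faithfullyFlat (B := O)
      (Ideal.span {algebraMap R (Localization.AtPrime p) a}), Ideal.mem_comap, Ideal.map_span,
      Set.image_singleton, Ideal.mem_span_singleton]
    change θ' _ ∣ θ' _
    rwa [hθ', hθ']
  obtain ⟨c, hc⟩ := h'
  obtain ⟨⟨r, d⟩, hr⟩ := IsLocalization.surj p.primeCompl c
  have h2 : algebraMap R (Localization.AtPrime p) (d * b) = algebraMap R _ (a * r) := by
    rw [map_mul, map_mul, hc, ← hr]
    ring
  obtain ⟨d', hd⟩ := IsLocalization.exists_of_eq (M := p.primeCompl) h2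
  refine ⟨d' * d, ?_, ⟨d' * r, ?_⟩⟩
  · rw [map_mul]
    exact (hu d').mul (hu d)
  · linear_combination hd

lemma eq_zero_of_flat [IsDomain R] {θ : R →+* O} (hθ : θ.Flat) {r : R} (h : θ r = 0) : r = 0 := by
  obtain ⟨t, ht, h⟩ := exists_dvd_of_flat hθ (a := 0) (b := r) (by simp [h])
  rw [zero_dvd_iff, mul_eq_zero] at h
  refine h.resolve_left fun h0 => ?_
  rw [h0, map_zero] at ht
  exact not_isUnit_zero ht

/-- Flat homomorphisms have going-down, so a chain of primes ending below the contraction of `P`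
lifts to a chain of the same length. -/
lemma length_le_ringKrullDim_of_flat {R O : Type} [CommRing R] [CommRing O] {θ : R →+* O}
    (hθ : θ.Flat) (l : LTSeries (PrimeSpectrum R)) (P : Ideal O) [P.IsPrime]
    (h : l.last.asIdeal ≤ P.comap θ) : (l.length : WithBot ℕ∞) ≤ ringKrullDim O := by
  algebraize [θ]
  have : P.LiesOver (P.comap θ) := ⟨rfl⟩
  obtain ⟨Q, -, hQ, hQ'⟩ := Ideal.exists_ideal_le_liesOver_of_le (p := l.last.asIdeal)
    (q := P.comap θ) P h
  obtain ⟨L, hL, -⟩ := Ideal.exists_ltSeries_of_hasGoingDown l Q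
  rw [← hL]
  exact Order.LTSeries.length_le_krullDim L

end

section

variable {n : ℕ}

/-- The endomorphism of a polynomial ring that sends the variables in `s` to zero. -/
def kill (s : Finset (Fin n)) : MvPolynomial (Fin n) ℂ →+* MvPolynomial (Fin n) ℂ :=
  evalHom fun i => if i ∈ s then 0 else .X i

@[simp]
lemma kill_X (s : Finset (Fin n)) (i : Fin n) :
    kill s (.X i) = if i ∈ s then 0 else (.X i : MvPolynomial (Fin n) ℂ) := evalHom_X _ _

@[simp]
lemma kill_C (s : Finset (Fin n)) (c : ℂ) :
    kill s (.C c) = (.C c : MvPolynomial (Fin n) ℂ) := evalHom_C _ _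

/-- Modulo an ideal containing the variables in `s`, setting those variables to zero changes
nothing. -/
lemma ker_kill_le {s : Finset (Fin n)} {I : Ideal (MvPolynomial (Fin n) ℂ)}
    (h : ∀ i ∈ s, MvPolynomial.X i ∈ I) : RingHom.ker (kill s) ≤ I := by
  intro r hr
  have e : (Ideal.Quotient.mk I).comp (kill s) = Ideal.Quotient.mk I := by
    refine MvPolynomial.ringHom_ext (fun c => by simp) fun i => ?_
    by_cases hi : i ∈ s
    · simpa [hi] using (Ideal.Quotient.eq_zero_iff_mem.mpr (h i hi)).symm
    · simp [hi]
  rw [← Ideal.Quotient.eq_zero_iff_mem, ← e, RingHom.comp_apply, hr, map_zero]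

/-- The kernel of a homomorphism to a domain, as a point of the prime spectrum. -/
def kerPoint {R S : Type} [CommRing R] [CommRing S] [IsDomain S] (f : R →+* S) : PrimeSpectrum R :=
  ⟨RingHom.ker f, RingHom.ker_isPrime f⟩

lemma kerPoint_lt {R S S' : Type} [CommRing R] [CommRing S] [IsDomain S] [CommRing S'] [IsDomain S']
    {f : R →+* S} {f' : R →+* S'} (g : S →+* S') (h : g.comp f = f') {r : R} (h₁ : f r ≠ 0)
    (h₂ : f' r = 0) : kerPoint f < kerPoint f' := by
  refine lt_of_le_of_ne ?_ fun e => h₁ ?_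
  · intro x (hx : f x = 0)
    change f' x = 0
    rw [← h, RingHom.comp_apply, hx, map_zero]
  · have : r ∈ (kerPoint f').asIdeal := h₂
    rw [← e] at this
    exact this

variable {O : Type} [CommRing O] [IsLocalRing O]

lemma exists_ltSeries_two {α : Type} [Preorder α] {a b c : α} (h₁ : a < b) (h₂ : b < c) :
    ∃ l : LTSeries α, l.length = 2 ∧ l.last = c :=
  ⟨⟨2, ![a, b, c], fun i => by fin_cases i; exacts [h₁, h₂]⟩, rfl, rfl⟩

lemma exists_ltSeries_three {α : Type} [Preorder α] {a b c d : α} (h₁ : a < b) (h₂ : b < c)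
    (h₃ : c < d) : ∃ l : LTSeries α, l.length = 3 ∧ l.last = d :=
  ⟨⟨3, ![a, b, c, d], fun i => by fin_cases i; exacts [h₁, h₂, h₃]⟩, rfl, rfl⟩

/-- The chain `0 < (Xᵢ) < (Xᵢ, Xⱼ)` lies below the contraction of the maximal ideal and lifts by
going-down. -/
lemma two_le_ringKrullDim_of_flat {θ : MvPolynomial (Fin n) ℂ →+* O} (hθ : θ.Flat) {i j : Fin n}
    (hij : i ≠ j) (hi : θ (.X i) ∈ IsLocalRing.maximalIdeal O)
    (hj : θ (.X j) ∈ IsLocalRing.maximalIdeal O) : 2 ≤ ringKrullDim O := by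
  have h₁ : kerPoint (RingHom.id (MvPolynomial (Fin n) ℂ)) < kerPoint (kill {i}) :=
    kerPoint_lt (kill {i}) (RingHom.comp_id _) (r := .X i) (MvPolynomial.X_ne_zero i) (by simp)
  have h₂ : kerPoint (kill {i}) < kerPoint (kill {i, j}) :=
    kerPoint_lt (kill {j}) (MvPolynomial.ringHom_ext (fun c => by simp) fun k => by
      by_cases hk : k = i <;> simp [hk]) (r := .X j) (by
        simp [hij.symm, MvPolynomial.X_ne_zero]) (by simp)
  obtain ⟨l, hl, hl'⟩ := exists_ltSeries_two h₁ h₂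
  have := length_le_ringKrullDim_of_flat hθ l (IsLocalRing.maximalIdeal O) (by
    rw [hl']
    refine ker_kill_le fun k hk => ?_
    simp only [Finset.mem_insert, Finset.mem_singleton] at hk
    rcases hk with rfl | rfl
    exacts [hi, hj])
  rw [hl] at this
  exact this

/-- The equation of the fibration in the affine space with coordinates `(u₁, u₂, u₃, v₁, v₂)`. -/
def conePolynomial : MvPolynomial (Fin 5) ℂ := .X 3 * .X 4 - .X 0 * .X 1 * .X 2

/-- The prime of the line where all coordinates but `u₁` vanish is the top of a chain of length
three in the ring of the cone. The chain is made of kernels of homomorphisms to a polynomial ring,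
so primality comes for free. -/
lemma three_le_ringKrullDim_of_flat
    {θ : MvPolynomial (Fin 5) ℂ ⧸ Ideal.span {conePolynomial} →+* O} (hθ : θ.Flat)
    (h : ∀ i, i ≠ 0 → θ (Ideal.Quotient.mk _ (.X i)) ∈ IsLocalRing.maximalIdeal O) :
    3 ≤ ringKrullDim O := by
  -- This parametrizes the cone by the chart `(1, 0)` of its resolution: `X 0 = v₂`, `X 1 = u₁`, `X
  -- 2 = u₃`, and `X 3` is the fibre coordinate. Killing `X 3`, `X 0`, `X 2` in turn makes `u₂`,
  -- `v₂`, `u₃` vanish one after another, which gives strictness.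
  let κ : MvPolynomial (Fin 5) ℂ →+* MvPolynomial (Fin 4) ℂ :=
    evalHom ![.X 1, .X 3 * .X 0, .X 2, .X 1 * .X 2 * .X 3, .X 0]
  have hκ0 : Ideal.span {conePolynomial} ≤ RingHom.ker κ := by
    rw [Ideal.span_singleton_le_iff_mem, RingHom.mem_ker]
    simp [conePolynomial, κ]
    ring
  let ψ : MvPolynomial (Fin 5) ℂ ⧸ Ideal.span {conePolynomial} →+* MvPolynomial (Fin 4) ℂ :=
    Ideal.Quotient.lift _ κ hκ0
  have hψ : ∀ a, ψ (Ideal.Quotient.mk _ a) = κ a := fun a => Ideal.Quotient.lift_mk _ _ _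
  have hk : ∀ s t : Finset (Fin 4), (kill (s ∪ t)) = (kill t).comp (kill s) := fun s t =>
    MvPolynomial.ringHom_ext (fun c => by simp) fun k => by
      by_cases hk : k ∈ s <;> simp [hk]
  have h₁ : kerPoint ψ < kerPoint ((kill {3}).comp ψ) :=
    kerPoint_lt (kill {3}) rfl (r := Ideal.Quotient.mk _ (.X 1))
      (by simp [hψ, κ, MvPolynomial.X_ne_zero]) (by simp [hψ, κ])
  have h₂ : kerPoint ((kill {3}).comp ψ) < kerPoint ((kill {3, 0}).comp ψ) :=
    kerPoint_lt (kill {0}) (by rw [← RingHom.comp_assoc, ← hk]; rfl)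
      (r := Ideal.Quotient.mk _ (.X 4))
      (by simp [hψ, κ, MvPolynomial.X_ne_zero]) (by simp [hψ, κ])
  have h₃ : kerPoint ((kill {3, 0}).comp ψ) < kerPoint ((kill {3, 0, 2}).comp ψ) :=
    kerPoint_lt (kill {2}) (by rw [← RingHom.comp_assoc, ← hk]; rfl)
      (r := Ideal.Quotient.mk _ (.X 2))
      (by simp [hψ, κ, MvPolynomial.X_ne_zero]) (by simp [hψ, κ])
  obtain ⟨l, hl, hl'⟩ := exists_ltSeries_three h₁ h₂ h₃
  have := length_le_ringKrullDim_of_flat hθ l (IsLocalRing.maximalIdeal O) (by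
    rw [hl']
    intro r hr
    obtain ⟨r, rfl⟩ := Ideal.Quotient.mk_surjective r
    -- After the three variables are killed only `u₁` survives, so the last kernel is contained in
    -- the ideal generated by the other four coordinates.
    have e₁ : (kill {3, 0, 2}).comp κ = (evalHom ![.X 1, 0, 0, 0, 0]) :=
      MvPolynomial.ringHom_ext (fun c => by simp [κ]) fun k => by
        fin_cases k <;> simp [κ]
    have e₂ : (evalHom ![.X 0, .X 0, .X 0, .X 0] : _ →+* MvPolynomial (Fin 5) ℂ).comp
        ((kill {3, 0, 2}).comp κ) = kill {1, 2, 3, 4} :=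
      e₁ ▸ MvPolynomial.ringHom_ext (fun c => by simp) fun k => by
        fin_cases k <;> simp
    have hr' : kill {3, 0, 2} (κ r) = 0 := hr
    have : r ∈ RingHom.ker (kill {1, 2, 3, 4}) := by
      rw [RingHom.mem_ker, ← e₂, RingHom.comp_apply, RingHom.comp_apply, hr', map_zero]
    refine ker_kill_le (I := (IsLocalRing.maximalIdeal O).comap (θ.comp (Ideal.Quotient.mk _)))
      (fun k hk => h k ?_) this
    rintro rfl
    simp at hk)
  rw [hl] at this
  exact this

end

end

section

/-! ### Local rings -/

section

variable {X Z : Scheme.{0}} {R : Type} [CommRing R]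

lemma eq_of_specMap_eq {S : Type} [CommRing S] {f g : R →+* S}
    (h : Spec.map (CommRingCat.ofHom f) = Spec.map (CommRingCat.ofHom g)) : f = g :=
  congrArg CommRingCat.Hom.hom (Spec.map_injective h)

/-- The homomorphism to the local ring at `x` given by a morphism to an affine scheme. -/
def stalkHom (p : X ⟶ Spec (CommRingCat.of R)) (x : X) : R →+* X.presheaf.stalk x :=
  (Spec.preimage (X.fromSpecStalk x ≫ p)).hom

lemma specMap_stalkHom (p : X ⟶ Spec (CommRingCat.of R)) (x : X) :
    Spec.map (CommRingCat.ofHom (stalkHom p x)) = X.fromSpecStalk x ≫ p :=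
  Spec.map_preimage _

lemma stalkHom_specMap (p : X ⟶ Spec (CommRingCat.of R)) {R₀ : Type} [CommRing R₀] (a : R₀ →+* R)
    (x : X) :
    stalkHom (p ≫ Spec.map (CommRingCat.ofHom a)) x = (stalkHom p x).comp a := by
  apply eq_of_specMap_eq
  rw [specMap_stalkHom, CommRingCat.ofHom_comp, Spec.map_comp, specMap_stalkHom, Category.assoc]

lemma stalkHom_comp (j : Z ⟶ X) (p : X ⟶ Spec (CommRingCat.of R)) (z : Z) :
    stalkHom (j ≫ p) z = (j.stalkMap z).hom.comp (stalkHom p (j z)) := by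
  apply eq_of_specMap_eq
  rw [specMap_stalkHom, CommRingCat.ofHom_comp, Spec.map_comp, specMap_stalkHom,
    CommRingCat.ofHom_hom, ← Category.assoc, ← Category.assoc,
    Scheme.SpecMap_stalkMap_fromSpecStalk]

lemma stalkHom_mem_maximalIdeal_iff (p : X ⟶ Spec (CommRingCat.of R)) (x : X) {r : R} :
    stalkHom p x r ∈ IsLocalRing.maximalIdeal (X.presheaf.stalk x) ↔ r ∈ (p x).asIdeal := by
  have h : p x = Spec.map (CommRingCat.ofHom (stalkHom p x))
      (IsLocalRing.closedPoint (X.presheaf.stalk x)) := by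
    rw [specMap_stalkHom]
    exact congrArg p (Scheme.fromSpecStalk_closedPoint).symm
  rw [h]
  rfl

lemma flat_stalkHom_id (x : Spec (CommRingCat.of R)) : (stalkHom (𝟙 _) x).Flat := by
  have h : stalkHom (𝟙 _) x = (StructureSheaf.toStalk R x).hom := by
    apply eq_of_specMap_eq
    rw [specMap_stalkHom, Category.comp_id]
    exact Spec.fromSpecStalk_eq' _ _
  rw [h]
  have H : ∀ x : PrimeSpectrum R,
      Module.Flat R ((Spec.structureSheaf R).presheaf.stalk x) := fun x =>
    IsLocalization.flat (R := R) ((Spec.structureSheaf R).presheaf.stalk x) x.asIdeal.primeCompl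
  exact H x

lemma flat_stalkHom (p : X ⟶ Spec (CommRingCat.of R)) (x : X) [Flat p] : (stalkHom p x).Flat := by
  rw [← Category.comp_id p, stalkHom_comp]
  exact RingHom.Flat.comp (flat_stalkHom_id _) (Flat.stalkMap p x)

lemma flat_stalkHom_of_restrict (p : X ⟶ Spec (CommRingCat.of R)) (V : X.Opens)
    (h : Flat (V.ι ≫ p)) (x : X) (hx : x ∈ V) : (stalkHom p x).Flat := by
  obtain ⟨v, rfl⟩ : ∃ v, V.ι v = x := ⟨⟨x, hx⟩, rfl⟩
  have h1 : (stalkHom (V.ι ≫ p) v).Flat := flat_stalkHom _ _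
  rw [stalkHom_comp] at h1
  have h2 := h1.comp (RingHom.Flat.of_bijective
    (ConcreteCategory.bijective_of_isIso (inv (V.ι.stalkMap v))))
  have h3 : (inv (V.ι.stalkMap v)).hom.comp ((V.ι.stalkMap v).hom.comp (stalkHom p (V.ι v))) =
      stalkHom p (V.ι v) := by
    rw [← RingHom.comp_assoc, ← CommRingCat.hom_comp, IsIso.hom_inv_id]
    exact RingHom.id_comp _
  rw [h3] at h2
  exact h2

lemma ringKrullDim_stalk (j : Z ⟶ X) [IsOpenImmersion j] (z : Z) :
    ringKrullDim (X.presheaf.stalk (j z)) = ringKrullDim (Z.presheaf.stalk z) :=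
  ringKrullDim_eq_of_ringEquiv (asIso (j.stalkMap z)).commRingCatIsoToRingEquiv

lemma stalkHom_dvd_iff (j : Z ⟶ X) [IsOpenImmersion j] (p : X ⟶ Spec (CommRingCat.of R)) (z : Z)
    {r r' : R} : stalkHom (j ≫ p) z r ∣ stalkHom (j ≫ p) z r' ↔
      stalkHom p (j z) r ∣ stalkHom p (j z) r' := by
  rw [stalkHom_comp]
  exact map_dvd_iff (asIso (j.stalkMap z)).commRingCatIsoToRingEquiv

end

end

section

/-! ### Codimensions -/

section

variable {C : Type} [CommRing C] [Algebra ℂ C] {u₁ u₂ u₃ v₁ v₂ : C} {X : Scheme.{0}}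

lemma flat_stalkHom_of_isPullback {S D : Type} [CommRing S] [CommRing D] {n : ℕ}
    {k : Spec (CommRingCat.of S) ⟶ Spec (CommRingCat.of D)}
    {p : Spec (CommRingCat.of S) ⟶ Spec (CommRingCat.of C)}
    {κ : Spec (CommRingCat.of D) ⟶ Spec (CommRingCat.of (MvPolynomial (Fin n) ℂ))} {v : Fin n → C}
    (H : IsPullback k p κ (toAffine v)) {U : (Spec (CommRingCat.of C)).Opens}
    (hU : Smooth (U.ι ≫ toAffine v)) (z : Spec (CommRingCat.of S)) (hz : p z ∈ U) :
    (stalkHom k z).Flat :=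
  flat_stalkHom_of_restrict k (p ⁻¹ᵁ U) (by have := smooth_restrict H U hU; infer_instance) z hz

lemma stalkHom_toAffine_mem_iff {n : ℕ} (v : Fin n → C) (z : Spec (CommRingCat.of C)) (i : Fin n) :
    stalkHom (toAffine v) z (.X i) ∈ IsLocalRing.maximalIdeal _ ↔ v i ∈ z.asIdeal := by
  rw [stalkHom_mem_maximalIdeal_iff]
  change evalHom v (.X i) ∈ z.asIdeal ↔ _
  rw [evalHom_X]

/-- Here `u₃ = ab`, so if `u₃` vanishes then `a` or `b` does. In each of the three cases two of the
four coordinates `u₁, u₂, a, b` vanish at the point. -/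
lemma two_le_ringKrullDim_chart₁₁ {U : (Spec (CommRingCat.of C)).Opens}
    (hU : Smooth (U.ι ≫ toAffine ![u₁, u₂, u₃, v₁, v₂]))
    (z : Spec (CommRingCat.of (ChartRing u₁ u₂ u₃ v₁ v₂ 1 1)))
    {q : Spec (CommRingCat.of C)}
    (hz : Spec.map (CommRingCat.ofHom (algebraMap C (ChartRing u₁ u₂ u₃ v₁ v₂ 1 1))) z = q)
    (hq : q ∈ U)
    (h : (u₂ ∈ q.asIdeal ∧ u₃ ∈ q.asIdeal) ∨ (u₁ ∈ q.asIdeal ∧ u₃ ∈ q.asIdeal) ∨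
      (u₁ ∈ q.asIdeal ∧ u₂ ∈ q.asIdeal)) :
    2 ≤ ringKrullDim ((Spec (CommRingCat.of (ChartRing u₁ u₂ u₃ v₁ v₂ 1 1))).presheaf.stalk z) := by
  have hflat := flat_stalkHom_of_isPullback (isPullback_chart₁₁ u₁ u₂ u₃ v₁ v₂) hU z (by rwa [hz])
  have key : ∀ i j : Fin 4, i ≠ j → chartCoords₁₁ u₁ u₂ u₃ v₁ v₂ i ∈ z.asIdeal →
      chartCoords₁₁ u₁ u₂ u₃ v₁ v₂ j ∈ z.asIdeal → _ := fun i j hij hi hj =>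
    two_le_ringKrullDim_of_flat hflat hij ((stalkHom_toAffine_mem_iff _ _ _).mpr hi)
      ((stalkHom_toAffine_mem_iff _ _ _).mpr hj)
  have hm : ∀ r ∈ q.asIdeal, algebraMap C (ChartRing u₁ u₂ u₃ v₁ v₂ 1 1) r ∈ z.asIdeal := by
    subst hz
    exact fun r hr => hr
  have hu : u₃ ∈ q.asIdeal → chartCoords₁₁ u₁ u₂ u₃ v₁ v₂ 2 ∈ z.asIdeal ∨
      chartCoords₁₁ u₁ u₂ u₃ v₁ v₂ 3 ∈ z.asIdeal := by
    intro hr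
    have h₃ := (zeroEqs_mk u₁ u₂ u₃ v₁ v₂ 1 1).2.2
    simp only [affineCoords_one_zero, affineCoords_one_one, one_mul, mul_one, sub_eq_zero] at h₃
    have h4 := hm _ hr
    rw [← h₃] at h4
    exact z.isPrime.mem_or_mem h4
  obtain ⟨h₁, h₂⟩ | ⟨h₁, h₂⟩ | ⟨h₁, h₂⟩ := h
  · obtain h₃ | h₃ := hu h₂
    · exact key 1 2 (by decide) (hm _ h₁) h₃
    · exact key 1 3 (by decide) (hm _ h₁) h₃
  · obtain h₃ | h₃ := hu h₂
    · exact key 0 2 (by decide) (hm _ h₁) h₃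
    · exact key 0 3 (by decide) (hm _ h₁) h₃
  · exact key 0 1 (by decide) (hm _ h₁) (hm _ h₂)

/-- All of `v₁, u₂, u₃` are coordinates of this chart; over the lines `v₁` vanishes, and so does at
least one of `u₂, u₃`. -/
lemma two_le_ringKrullDim_chart₀₁ {U : (Spec (CommRingCat.of C)).Opens}
    (hU : Smooth (U.ι ≫ toAffine ![u₁, u₂, u₃, v₁, v₂]))
    (z : Spec (CommRingCat.of (ChartRing u₁ u₂ u₃ v₁ v₂ 0 1)))
    {q : Spec (CommRingCat.of C)}
    (hz : Spec.map (CommRingCat.ofHom (algebraMap C (ChartRing u₁ u₂ u₃ v₁ v₂ 0 1))) z = q)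
    (hq : q ∈ U) (hv : v₁ ∈ q.asIdeal) (h : u₂ ∈ q.asIdeal ∨ u₃ ∈ q.asIdeal) :
    2 ≤ ringKrullDim ((Spec (CommRingCat.of (ChartRing u₁ u₂ u₃ v₁ v₂ 0 1))).presheaf.stalk z) := by
  have hflat := flat_stalkHom_of_isPullback (isPullback_chart₀₁ u₁ u₂ u₃ v₁ v₂) hU z (by rwa [hz])
  have key : ∀ i j : Fin 4, i ≠ j → chartCoords₀₁ u₁ u₂ u₃ v₁ v₂ i ∈ z.asIdeal →
      chartCoords₀₁ u₁ u₂ u₃ v₁ v₂ j ∈ z.asIdeal → _ := fun i j hij hi hj =>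
    two_le_ringKrullDim_of_flat hflat hij ((stalkHom_toAffine_mem_iff _ _ _).mpr hi)
      ((stalkHom_toAffine_mem_iff _ _ _).mpr hj)
  have hm : ∀ r ∈ q.asIdeal, algebraMap C (ChartRing u₁ u₂ u₃ v₁ v₂ 0 1) r ∈ z.asIdeal := by
    subst hz
    exact fun r hr => hr
  obtain h | h := h
  · exact key 0 1 (by decide) (hm _ hv) (hm _ h)
  · exact key 0 2 (by decide) (hm _ hv) (hm _ h)

lemma IsZeroScheme.two_le_ringKrullDim {f : X ⟶ F0 (Spec (CommRingCat.of C))}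
    (hf : IsZeroScheme u₁ u₂ u₃ v₁ v₂ f) {U : (Spec (CommRingCat.of C)).Opens}
    (hU : Smooth (U.ι ≫ toAffine ![u₁, u₂, u₃, v₁, v₂])) (x : X) {q : Spec (CommRingCat.of C)}
    (hx : (f ≫ F0.toBase _) x = q) (hq : q ∈ U) (h₁ : v₁ ∈ q.asIdeal) (h₂ : v₂ ∈ q.asIdeal)
    (h : (u₂ ∈ q.asIdeal ∧ u₃ ∈ q.asIdeal) ∨ (u₁ ∈ q.asIdeal ∧ u₃ ∈ q.asIdeal) ∨
      (u₁ ∈ q.asIdeal ∧ u₂ ∈ q.asIdeal)) :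
    2 ≤ ringKrullDim (X.presheaf.stalk x) := by
  have := hf.isOpenImmersion_chart 1 1
  have := hf.isOpenImmersion_chart 0 1
  have := hf.swap.isOpenImmersion_chart 0 1
  obtain ⟨z, rfl⟩ | ⟨z, rfl⟩ | hz := hf.exists_mem_range_chart x
  · rw [ringKrullDim_stalk]
    refine two_le_ringKrullDim_chart₁₁ hU z ?_ hq h
    rw [← hf.chart_toBase, ← hx]
    rfl
  · rw [ringKrullDim_stalk]
    refine two_le_ringKrullDim_chart₀₁ hU z (q := q) ?_ hq h₁ (by tauto)
    rw [← hf.chart_toBase, ← hx]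
    rfl
  · rw [← hf.range_swap_chart] at hz
    obtain ⟨z, rfl⟩ := hz
    rw [ringKrullDim_stalk]
    refine two_le_ringKrullDim_chart₀₁ (smooth_toAffine_swap hU) z (q := q) ?_ hq h₂ (by tauto)
    rw [← hf.swap.chart_toBase, swap_toBase, ← hx]
    rfl

/-- The hypersurface `F = 0` is the base change of the cone `v₁ v₂ = u₁ u₂ u₃` in `𝔸⁵`. -/
lemma isPushout_cone {F : C} (hF : F = v₁ * v₂ - u₁ * u₂ * u₃) :
    ∃ l : MvPolynomial (Fin 5) ℂ ⧸ Ideal.span {conePolynomial} →+* C ⧸ Ideal.span {F},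
      IsPushout (CommRingCat.ofHom (evalHom ![u₁, u₂, u₃, v₁, v₂]))
        (CommRingCat.ofHom (Ideal.Quotient.mk (Ideal.span {conePolynomial})))
        (CommRingCat.ofHom (Ideal.Quotient.mk (Ideal.span {F}))) (CommRingCat.ofHom l) := by
  have hc : evalHom ![u₁, u₂, u₃, v₁, v₂] conePolynomial = F := by
    simp [conePolynomial, hF]
  refine ⟨Ideal.Quotient.lift _ ((Ideal.Quotient.mk (Ideal.span {F})).comp
    (evalHom ![u₁, u₂, u₃, v₁, v₂])) ?_, isPushout_of_forall _ _ _ _ ?_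
      (fun T _ φ ψ h => ?_) (fun T _ χ χ' h h' => Ideal.Quotient.ringHom_ext h)⟩
  · change Ideal.span {conePolynomial} ≤ RingHom.ker _
    rw [Ideal.span_singleton_le_iff_mem, RingHom.mem_ker, RingHom.comp_apply, hc]
    exact Ideal.Quotient.eq_zero_iff_mem.mpr (Ideal.mem_span_singleton_self F)
  · rfl
  · have h0 : Ideal.Quotient.mk (Ideal.span {conePolynomial}) conePolynomial = 0 :=
      Ideal.Quotient.eq_zero_iff_mem.mpr (Ideal.mem_span_singleton_self _)
    have hφ : Ideal.span {F} ≤ RingHom.ker φ := by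
      rw [Ideal.span_singleton_le_iff_mem, RingHom.mem_ker, ← hc, ← RingHom.comp_apply, h,
        RingHom.comp_apply, h0, map_zero]
    refine ⟨Ideal.Quotient.lift _ φ hφ, rfl,
      Ideal.Quotient.ringHom_ext (RingHom.ext fun r => ?_)⟩
    simp only [RingHom.comp_apply, Ideal.Quotient.lift_mk]
    exact RingHom.congr_fun h r

lemma three_le_ringKrullDim {F : C} (hF : F = v₁ * v₂ - u₁ * u₂ * u₃)
    {U : (Spec (CommRingCat.of C)).Opens}
    (hU : Smooth (U.ι ≫ toAffine ![u₁, u₂, u₃, v₁, v₂]))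
    (z : Spec (CommRingCat.of (C ⧸ Ideal.span {F}))) {q : Spec (CommRingCat.of C)}
    (hz : Spec.map (CommRingCat.ofHom (Ideal.Quotient.mk (Ideal.span {F}))) z = q)
    (hq : q ∈ U) (h₁ : v₁ ∈ q.asIdeal) (h₂ : v₂ ∈ q.asIdeal) (h₃ : u₂ ∈ q.asIdeal)
    (h₄ : u₃ ∈ q.asIdeal) :
    3 ≤ ringKrullDim ((Spec (CommRingCat.of (C ⧸ Ideal.span {F}))).presheaf.stalk z) := by
  obtain ⟨l, hl⟩ := isPushout_cone hF
  have H := (isPullback_SpecMap_of_isPushout _ _ _ _ hl).flip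
  refine three_le_ringKrullDim_of_flat (flat_stalkHom_of_isPullback H hU z (by rwa [hz]))
    fun i hi => ?_
  rw [stalkHom_mem_maximalIdeal_iff]
  have hl' : l (Ideal.Quotient.mk _ (.X i)) =
      Ideal.Quotient.mk _ (![u₁, u₂, u₃, v₁, v₂] i) := by
    have := congrArg (fun g => g.hom (MvPolynomial.X i)) hl.w
    simp at this
    exact this.symm
  change l (Ideal.Quotient.mk _ (.X i)) ∈ z.asIdeal
  rw [hl']
  subst hz
  fin_cases i
  exacts [absurd rfl hi, h₃, h₄, h₁, h₂]

end

end

section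

/-! ### The singular locus of the fibration -/

section

/-- If `f (1 + e) = f² g`, then `f (1 + e - f g) = 0`, and the second factor is a unit. -/
lemma eq_zero_of_isUnit_mul_mem_span_sq {O : Type} [CommRing O] [IsLocalRing O] {f e : O}
    (he : e ∈ IsLocalRing.maximalIdeal O) (hf : f ∈ IsLocalRing.maximalIdeal O)
    (h : f * (1 + e) ∈ Ideal.span {f ^ 2}) : f = 0 := by
  obtain ⟨g, hg⟩ := Ideal.mem_span_singleton.mp h
  have hu : IsUnit (1 + e - f * g) := by
    have := (IsLocalRing.maximalIdeal O).sub_mem ((IsLocalRing.maximalIdeal O).mul_mem_right g hf) he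
    have := IsLocalRing.isUnit_one_sub_self_of_mem_nonunits _ this
    convert! this using 1
    ring
  refine hu.mul_left_eq_zero.mp ?_
  linear_combination hg

/-- Formal smoothness lifts `ψ` from `O / f` to `O / f²`, changing the five functions by multiples
`f cᵢ`. Expanding the relation between the lifts gives `f (1 + e) ∈ (f²)`, where `e` is a
combination of the partial derivatives of `v₁ v₂ - u₁ u₂ u₃`. These all lie in the maximal ideal, so
`f = 0`. -/
lemma eq_zero_of_formallySmooth {O B : Type} [CommRing O] [IsLocalRing O] [Algebra ℂ O] [CommRing B]
    [Algebra ℂ B] [Algebra.FormallySmooth ℂ B] {f u₁ u₂ u₃ v₁ v₂ : O}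
    (hf : f = v₁ * v₂ - u₁ * u₂ * u₃) {b : Fin 5 → B}
    (hb : b 3 * b 4 = b 0 * b 1 * b 2)
    (ψ : B →ₐ[ℂ] O ⧸ Ideal.span {f})
    (hψ : ∀ i, ψ (b i) = Ideal.Quotient.mk _ (![u₁, u₂, u₃, v₁, v₂] i))
    (h₁ : v₁ ∈ IsLocalRing.maximalIdeal O) (h₂ : v₂ ∈ IsLocalRing.maximalIdeal O)
    (h₃ : u₂ * u₃ ∈ IsLocalRing.maximalIdeal O) (h₄ : u₁ * u₃ ∈ IsLocalRing.maximalIdeal O)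
    (h₅ : u₁ * u₂ ∈ IsLocalRing.maximalIdeal O) : f = 0 := by
  have hle : Ideal.span {f ^ 2} ≤ Ideal.span {f} := by
    rw [Ideal.span_singleton_le_span_singleton]
    exact dvd_pow_self f two_ne_zero
  let g : O ⧸ Ideal.span {f ^ 2} →ₐ[ℂ] O ⧸ Ideal.span {f} := Ideal.Quotient.factorₐ ℂ hle
  have hg : ∀ r, g (Ideal.Quotient.mk _ r) = Ideal.Quotient.mk _ r := fun r => rfl
  have hgs : Function.Surjective g := by
    intro r
    obtain ⟨r, rfl⟩ := Ideal.Quotient.mk_surjective r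
    exact ⟨_, hg r⟩
  have hgn : IsNilpotent (RingHom.ker (g : O ⧸ Ideal.span {f ^ 2} →+* O ⧸ Ideal.span {f})) := by
    refine ⟨2, le_bot_iff.mp ?_⟩
    rw [pow_two (RingHom.ker _), Ideal.mul_le]
    intro r hr s hs
    obtain ⟨r, rfl⟩ := Ideal.Quotient.mk_surjective r
    obtain ⟨s, rfl⟩ := Ideal.Quotient.mk_surjective s
    replace hr := Ideal.mem_span_singleton.mp (Ideal.Quotient.eq_zero_iff_mem.mp ((hg r).symm.trans hr))
    replace hs := Ideal.mem_span_singleton.mp (Ideal.Quotient.eq_zero_iff_mem.mp ((hg s).symm.trans hs))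
    rw [← map_mul]
    refine Ideal.Quotient.eq_zero_iff_mem.mpr (Ideal.mem_span_singleton.mpr ?_)
    rw [pow_two]
    exact mul_dvd_mul hr hs
  let σ := Algebra.FormallySmooth.liftOfSurjective ψ g hgs hgn
  have hσ : ∀ x, g (σ x) = ψ x := Algebra.FormallySmooth.liftOfSurjective_apply ψ g hgs hgn
  have hσ' : ∀ i, ∃ c, σ (b i) =
      Ideal.Quotient.mk (Ideal.span {f ^ 2}) (![u₁, u₂, u₃, v₁, v₂] i + f * c) := by
    intro i
    obtain ⟨r, hr⟩ := Ideal.Quotient.mk_surjective (σ (b i))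
    have := hσ (b i)
    rw [← hr, hg, hψ, Ideal.Quotient.eq, Ideal.mem_span_singleton] at this
    obtain ⟨c, hc⟩ := this
    exact ⟨c, by rw [← hr, ← hc]; congr 1; ring⟩
  choose c hc using hσ'
  have hb' := congrArg σ hb
  rw [map_mul, map_mul, map_mul, hc, hc, hc, hc, hc, ← map_mul, ← map_mul, ← map_mul,
    Ideal.Quotient.eq] at hb'
  simp at hb'
  have hm : v₁ * v₂ ∈ IsLocalRing.maximalIdeal O := Ideal.mul_mem_left _ _ h₂
  have hm' : u₁ * u₂ * u₃ ∈ IsLocalRing.maximalIdeal O := Ideal.mul_mem_right _ _ h₅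
  refine eq_zero_of_isUnit_mul_mem_span_sq
    -- The differential of `v₁ v₂ - u₁ u₂ u₃` in the direction `c`.
    (e := v₁ * c 4 + v₂ * c 3 - u₂ * u₃ * c 0 - u₁ * u₃ * c 1 - u₁ * u₂ * c 2) ?_
    (hf ▸ Ideal.sub_mem _ hm hm') ?_
  · exact Ideal.sub_mem _ (Ideal.sub_mem _ (Ideal.sub_mem _ (Ideal.add_mem _
      (Ideal.mul_mem_right _ _ h₁) (Ideal.mul_mem_right _ _ h₂)) (Ideal.mul_mem_right _ _ h₃))
      (Ideal.mul_mem_right _ _ h₄)) (Ideal.mul_mem_right _ _ h₅)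
  -- These are the terms of order at least two in the expansion; they are multiples of `f²` and are
  -- subtracted off.
  · have h2 := Ideal.mul_mem_right (c 3 * c 4 - c 0 * c 1 * u₃ - c 0 * c 2 * u₂ - c 1 * c 2 * u₁
      - f * (c 0 * c 1 * c 2)) (Ideal.span {f ^ 2}) (Ideal.mem_span_singleton_self (f ^ 2))
    convert! Ideal.sub_mem _ hb' h2 using 1
    rw [hf]
    ring

end

section

variable {C : Type} [CommRing C] [Algebra ℂ C] {u₁ u₂ u₃ v₁ v₂ : C}

lemma conePolynomial_ne_zero : conePolynomial ≠ 0 := by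
  intro h
  have := congrArg (MvPolynomial.eval ![0, 0, 0, 1, 1]) h
  simp [conePolynomial] at this

/-- Smoothness near `z` would make `F` vanish in the local ring of the ambient space at `q`. But
that local ring is flat over `ℂ[X₀, …, X₄]`, and `F` is the image of the nonzero cone polynomial. -/
lemma not_smooth_of_mem {F : C} (hF : F = v₁ * v₂ - u₁ * u₂ * u₃)
    {U : (Spec (CommRingCat.of C)).Opens} (hU : Smooth (U.ι ≫ toAffine ![u₁, u₂, u₃, v₁, v₂]))
    {V : (Spec (CommRingCat.of (C ⧸ Ideal.span {F}))).Opens}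
    (z : Spec (CommRingCat.of (C ⧸ Ideal.span {F}))) (hzV : z ∈ V) {q : Spec (CommRingCat.of C)}
    (hz : Spec.map (CommRingCat.ofHom (Ideal.Quotient.mk (Ideal.span {F}))) z = q)
    (hq : q ∈ U) (h₁ : v₁ ∈ q.asIdeal) (h₂ : v₂ ∈ q.asIdeal)
    (h : (u₂ ∈ q.asIdeal ∧ u₃ ∈ q.asIdeal) ∨ (u₁ ∈ q.asIdeal ∧ u₃ ∈ q.asIdeal) ∨
      (u₁ ∈ q.asIdeal ∧ u₂ ∈ q.asIdeal)) :
    ¬ Smooth (V.ι ≫ toC (C ⧸ Ideal.span {F})) := by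
  intro hV
  -- Shrinking to a basic open neighbourhood of `z` gives a smooth algebra `Localization.Away b`. It
  -- maps to the local ring at `q` modulo `F` because `b` does not vanish at `z`.
  obtain ⟨_, ⟨b, rfl⟩, hzb, hbV⟩ :=
    PrimeSpectrum.isTopologicalBasis_basic_opens.exists_subset_of_mem_open hzV V.2
  have hsm : Algebra.Smooth ℂ (Localization.Away b) := by
    let j := Spec.map (CommRingCat.ofHom (algebraMap (C ⧸ Ideal.span {F}) (Localization.Away b)))
    have : IsOpenImmersion j := IsOpenImmersion.of_isLocalization b
    have hj : Set.range j ⊆ Set.range V.ι := by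
      rw [Scheme.Opens.range_ι]
      refine (Eq.subset ?_).trans hbV
      exact PrimeSpectrum.localization_away_comap_range _ b
    have h1 : Smooth (IsOpenImmersion.lift V.ι j hj ≫ V.ι ≫ toC (C ⧸ Ideal.span {F})) := by
      have : IsOpenImmersion (IsOpenImmersion.lift V.ι j hj) := by
        have : IsOpenImmersion (IsOpenImmersion.lift V.ι j hj ≫ V.ι) := by
          rwa [IsOpenImmersion.lift_fac]
        exact IsOpenImmersion.of_comp _ V.ι
      infer_instance
    rw [← Category.assoc, IsOpenImmersion.lift_fac, toC, ← Spec.map_comp,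
      ← CommRingCat.ofHom_comp, ← IsScalarTower.algebraMap_eq,
      HasRingHomProperty.Spec_iff (P := @Smooth), CommRingCat.hom_ofHom,
      RingHom.smooth_algebraMap] at h1
    exact h1
  let φ := stalkHom (𝟙 (Spec (CommRingCat.of C))) q
  have hφ : ∀ r, φ r ∈ IsLocalRing.maximalIdeal _ ↔ r ∈ q.asIdeal := fun r =>
    stalkHom_mem_maximalIdeal_iff _ _
  algebraize [φ.comp (algebraMap ℂ C)]
  have hFφ : φ F = φ v₁ * φ v₂ - φ u₁ * φ u₂ * φ u₃ := by
    rw [hF, map_sub, map_mul, map_mul, map_mul]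
  let I := Ideal.span {φ F}
  let ψ₀ : C ⧸ Ideal.span {F} →+* _ ⧸ I := Ideal.quotientMap I φ (by
    rw [Ideal.span_singleton_le_iff_mem, Ideal.mem_comap]
    exact Ideal.mem_span_singleton_self _)
  have hψ₀ : ∀ r, ψ₀ (Ideal.Quotient.mk _ r) = Ideal.Quotient.mk _ (φ r) := fun r => rfl
  have hb : IsUnit (ψ₀ b) := by
    obtain ⟨b, rfl⟩ := Ideal.Quotient.mk_surjective b
    rw [hψ₀]
    refine IsUnit.map _ ?_
    by_contra hb
    subst hz
    exact hzb ((hφ b).mp hb)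
  let ψ₁ : Localization.Away b →+* _ ⧸ I := IsLocalization.Away.lift b hb
  have hψ₁ : ∀ r, ψ₁ (algebraMap (C ⧸ Ideal.span {F}) _ r) = ψ₀ r := fun r =>
    IsLocalization.Away.lift_eq b hb r
  let ψ : Localization.Away b →ₐ[ℂ] _ ⧸ I := AlgHom.mk ψ₁ fun c => by
    change ψ₁ _ = _
    rw [IsScalarTower.algebraMap_apply ℂ (C ⧸ Ideal.span {F}) (Localization.Away b), hψ₁]
    rfl
  let v : Fin 5 → Localization.Away b := fun i =>
    algebraMap (C ⧸ Ideal.span {F}) _ (Ideal.Quotient.mk _ (![u₁, u₂, u₃, v₁, v₂] i))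
  have hv : v 3 * v 4 = v 0 * v 1 * v 2 := by
    simp only [v, ← map_mul]
    refine congrArg _ ?_
    rw [Ideal.Quotient.eq]
    refine Ideal.mem_span_singleton.mpr ?_
    rw [hF]
    exact dvd_rfl
  have h0 := eq_zero_of_formallySmooth hFφ (b := v) hv ψ (fun i => by
    change ψ₁ _ = _
    rw [hψ₁, hψ₀]
    fin_cases i <;> rfl) ((hφ _).mpr h₁) ((hφ _).mpr h₂)
    (by rw [← map_mul, hφ]; rcases h with h | h | h <;> first
      | exact Ideal.mul_mem_left _ _ h.2 | exact Ideal.mul_mem_right _ _ h.2)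
    (by rw [← map_mul, hφ]; rcases h with h | h | h <;> first
      | exact Ideal.mul_mem_left _ _ h.2 | exact Ideal.mul_mem_right _ _ h.1)
    (by rw [← map_mul, hφ]; rcases h with h | h | h <;> first
      | exact Ideal.mul_mem_left _ _ h.1 | exact Ideal.mul_mem_right _ _ h.1)
  have hflat := flat_stalkHom_of_restrict (toAffine ![u₁, u₂, u₃, v₁, v₂]) U inferInstance q hq
  refine conePolynomial_ne_zero (eq_zero_of_flat hflat ?_)
  have e : stalkHom (toAffine ![u₁, u₂, u₃, v₁, v₂]) q = φ.comp (evalHom ![u₁, u₂, u₃, v₁, v₂]) := by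
    rw [← stalkHom_specMap, Category.id_comp]
    rfl
  rw [e, RingHom.comp_apply, ← h0]
  congr 1
  simp [conePolynomial, hF]

end

end

section

/-! ### Comparison of different resolutions -/

section

/-- Divisibility would descend to `a ∣ t b` with `θ t` a unit. The prime `Xᵢ` divides `a`, hence `t`
or `b`; the first contradicts `θ Xᵢ` being a nonunit, the second is excluded by evaluating `b` where
`Xᵢ = 0` and the other variables are `1`. -/
lemma not_dvd_of_flat {O : Type} [CommRing O] [IsLocalRing O] {n : ℕ}
    {θ : MvPolynomial (Fin n) ℂ →+* O} (hθ : θ.Flat) {i : Fin n}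
    (hi : θ (.X i) ∈ IsLocalRing.maximalIdeal O) {a b : MvPolynomial (Fin n) ℂ}
    (ha : MvPolynomial.X i ∣ a) (hb : MvPolynomial.eval (fun j => if j = i then 0 else 1) b ≠ 0) :
    ¬ θ a ∣ θ b := by
  intro h
  obtain ⟨t, ht, h⟩ := exists_dvd_of_flat hθ h
  obtain ⟨c, hc⟩ | ⟨c, hc⟩ := (MvPolynomial.X_prime (i := i)).dvd_or_dvd (ha.trans h)
  · rw [hc, map_mul] at ht
    exact hi (isUnit_of_mul_isUnit_left ht)
  · refine hb ?_
    rw [hc]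
    simp

variable {C : Type} [CommRing C] {u₁ u₂ u₃ v₁ v₂ : C} {X : Scheme.{0}}

/-- Two functions are comparable at a point if one divides the other in the local ring. -/
def Comparable (p : X ⟶ Spec (CommRingCat.of C)) (x : X) (a b : C) : Prop :=
  stalkHom p x a ∣ stalkHom p x b ∨ stalkHom p x b ∣ stalkHom p x a

lemma comparable_comp {Z : Scheme.{0}} (j : Z ⟶ X) [IsOpenImmersion j]
    (p : X ⟶ Spec (CommRingCat.of C)) (z : Z) {a b : C} :
    Comparable (j ≫ p) z a b ↔ Comparable p (j z) a b := by
  rw [Comparable, Comparable, stalkHom_dvd_iff, stalkHom_dvd_iff]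

/-- One of `α₋, σ₋` is `1`, so the first equation reads `v₁ = u₁ a` or `u₁ = a v₁`. -/
lemma comparable_chart (i j : Fin 2) (z : Spec (CommRingCat.of (ChartRing u₁ u₂ u₃ v₁ v₂ i j))) :
    Comparable (Spec.map (CommRingCat.ofHom (algebraMap C (ChartRing u₁ u₂ u₃ v₁ v₂ i j)))) z
      u₁ v₁ := by
  have h : stalkHom (Spec.map (CommRingCat.ofHom (algebraMap C (ChartRing u₁ u₂ u₃ v₁ v₂ i j)))) z =
      (stalkHom (𝟙 _) z).comp (algebraMap C (ChartRing u₁ u₂ u₃ v₁ v₂ i j)) := by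
    rw [← stalkHom_specMap, Category.id_comp]
  rw [Comparable, h, RingHom.comp_apply, RingHom.comp_apply]
  have h₁ := (zeroEqs_mk u₁ u₂ u₃ v₁ v₂ i j).1
  rw [sub_eq_zero] at h₁
  refine Or.imp (map_dvd _) (map_dvd _) ?_
  obtain rfl | rfl : i = 0 ∨ i = 1 := by omega
  · simp only [affineCoords_zero_zero, affineCoords_zero_one, mul_one] at h₁
    exact .inr ⟨_, h₁.trans (mul_comm _ _)⟩
  · simp only [affineCoords_one_zero, affineCoords_one_one, one_mul] at h₁
    exact .inl ⟨_, h₁.symm⟩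

lemma IsZeroScheme.comparable_left {f : X ⟶ F0 (Spec (CommRingCat.of C))}
    (hf : IsZeroScheme u₁ u₂ u₃ v₁ v₂ f) (x : X) : Comparable (f ≫ F0.toBase _) x u₁ v₁ := by
  have key : ∀ (i j : Fin 2), x ∈ Set.range (hf.chart i j) →
      Comparable (f ≫ F0.toBase _) x u₁ v₁ := by
    rintro i j ⟨z, rfl⟩
    have := hf.isOpenImmersion_chart i j
    rw [← comparable_comp, hf.chart_toBase]
    exact comparable_chart i j z
  obtain h | h | h := hf.exists_mem_range_chart x <;> exact key _ _ h

lemma IsZeroScheme.comparable_right {f : X ⟶ F0 (Spec (CommRingCat.of C))}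
    (hf : IsZeroScheme u₁ u₂ u₃ v₁ v₂ f) (x : X) : Comparable (f ≫ F0.toBase _) x u₂ v₂ := by
  rw [← IsZeroScheme.swap_toBase]
  exact hf.swap.comparable_left x

/-- The point over `q` with `a = b = 0`; it is the crossing point of the two lines in the fibre. -/
lemma exists_mem_chart₁₁ {q : Spec (CommRingCat.of C)} (h₁ : u₁ ∈ q.asIdeal) (h₂ : u₂ ∈ q.asIdeal)
    (h₃ : u₃ ∈ q.asIdeal) (h₄ : v₁ ∈ q.asIdeal) (h₅ : v₂ ∈ q.asIdeal) :
    ∃ z : Spec (CommRingCat.of (ChartRing u₁ u₂ u₃ v₁ v₂ 1 1)),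
      Spec.map (CommRingCat.ofHom (algebraMap C (ChartRing u₁ u₂ u₃ v₁ v₂ 1 1))) z = q ∧
      ∀ k, Ideal.Quotient.mk _ (MvPolynomial.X k) ∈ z.asIdeal := by
  have := q.isPrime
  have hq : ∀ r ∈ q.asIdeal, Ideal.Quotient.mk q.asIdeal r = 0 := fun r hr =>
    Ideal.Quotient.eq_zero_iff_mem.mpr hr
  have hle : chartIdeal u₁ u₂ u₃ v₁ v₂ 1 1 ≤ RingHom.ker
      (MvPolynomial.eval₂Hom (Ideal.Quotient.mk q.asIdeal) 0) := by
    rw [chartIdeal_le_ker_iff]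
    simp [ZeroEqs, hq _ h₁, hq _ h₂, hq _ h₃, hq _ h₄, hq _ h₅]
  have hl : ∀ r, Ideal.Quotient.lift _ (MvPolynomial.eval₂Hom (Ideal.Quotient.mk q.asIdeal) 0) hle
      (Ideal.Quotient.mk _ r) = MvPolynomial.eval₂Hom (Ideal.Quotient.mk q.asIdeal) 0 r := fun r =>
    Ideal.Quotient.lift_mk _ _ _
  refine ⟨kerPoint (Ideal.Quotient.lift _ _ hle), PrimeSpectrum.ext (Ideal.ext fun r => ?_),
    fun k => ?_⟩
  · refine Iff.trans (b := Ideal.Quotient.mk q.asIdeal r = 0) (Eq.congr_left ?_)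
      Ideal.Quotient.eq_zero_iff_mem
    exact (hl (MvPolynomial.C r)).trans (by simp)
  · exact (hl _).trans (by simp)

variable [Algebra ℂ C]

/-- At the point `a = b = 0` over `q` all four coordinates are nonunits, and `u₃ = ab`, `v₁ = u₁a`,
`v₂ = u₂b`. For each listed pair of monomials, each of the two contains a variable missing from the
other, so neither divides the other. -/
lemma exists_not_comparable_chart₁₁ {U : (Spec (CommRingCat.of C)).Opens}
    (hU : Smooth (U.ι ≫ toAffine ![u₁, u₂, u₃, v₁, v₂])) {q : Spec (CommRingCat.of C)} (hq : q ∈ U)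
    (h₁ : u₁ ∈ q.asIdeal) (h₂ : u₂ ∈ q.asIdeal)
    (h₃ : u₃ ∈ q.asIdeal) (h₄ : v₁ ∈ q.asIdeal) (h₅ : v₂ ∈ q.asIdeal) :
    ∃ z : Spec (CommRingCat.of (ChartRing u₁ u₂ u₃ v₁ v₂ 1 1)),
      let p := Spec.map (CommRingCat.ofHom (algebraMap C (ChartRing u₁ u₂ u₃ v₁ v₂ 1 1)))
      ¬ Comparable p z u₂ v₁ ∧ ¬ Comparable p z u₃ v₁ ∧ ¬ Comparable p z u₁ v₂ ∧
        ¬ Comparable p z u₃ v₂ := by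
  obtain ⟨z, hz, hz'⟩ := exists_mem_chart₁₁ h₁ h₂ h₃ h₄ h₅
  have H := isPullback_chart₁₁ u₁ u₂ u₃ v₁ v₂
  have hflat := flat_stalkHom_of_isPullback H hU z (by rwa [hz])
  have hm : ∀ k, stalkHom (toAffine (chartCoords₁₁ u₁ u₂ u₃ v₁ v₂)) z (.X k) ∈
      IsLocalRing.maximalIdeal _ := by
    intro k
    rw [stalkHom_toAffine_mem_iff]
    subst hz
    fin_cases k
    exacts [h₁, h₂, hz' 0, hz' 1]
  have hn : ∀ n, stalkHom (Spec.map (CommRingCat.ofHom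
      (algebraMap C (ChartRing u₁ u₂ u₃ v₁ v₂ 1 1)))) z (![u₁, u₂, u₃, v₁, v₂] n) =
      stalkHom (toAffine (chartCoords₁₁ u₁ u₂ u₃ v₁ v₂)) z (monomials₁₁ n) := by
    intro n
    have h' := stalkHom_specMap (toAffine (chartCoords₁₁ u₁ u₂ u₃ v₁ v₂)) (evalHom monomials₁₁) z
    have h'' := stalkHom_specMap (Spec.map (CommRingCat.ofHom
      (algebraMap C (ChartRing u₁ u₂ u₃ v₁ v₂ 1 1)))) (evalHom ![u₁, u₂, u₃, v₁, v₂]) z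
    have h3 := RingHom.congr_fun (h''.symm.trans
      ((congrArg (fun g => stalkHom g z) H.w.symm).trans h')) (.X n)
    simpa only [RingHom.comp_apply, evalHom_X] using h3
  have key : ∀ (n n' : Fin 5) (i i' : Fin 4), MvPolynomial.X i ∣ monomials₁₁ n →
      MvPolynomial.eval (fun j => if j = i then 0 else 1) (monomials₁₁ n') ≠ 0 →
      MvPolynomial.X i' ∣ monomials₁₁ n' →
      MvPolynomial.eval (fun j => if j = i' then 0 else 1) (monomials₁₁ n) ≠ 0 →
      ¬ Comparable (Spec.map (CommRingCat.ofHom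
        (algebraMap C (ChartRing u₁ u₂ u₃ v₁ v₂ 1 1)))) z
        (![u₁, u₂, u₃, v₁, v₂] n) (![u₁, u₂, u₃, v₁, v₂] n') := by
    intro n n' i i' h1 h2 h3 h4
    rw [Comparable, hn, hn, not_or]
    exact ⟨not_dvd_of_flat hflat (hm i) h1 h2, not_dvd_of_flat hflat (hm i') h3 h4⟩
  refine ⟨z, key 1 3 1 0 ?_ ?_ ?_ ?_, key 2 3 3 0 ?_ ?_ ?_ ?_, key 0 4 0 1 ?_ ?_ ?_ ?_,
    key 2 4 2 1 ?_ ?_ ?_ ?_⟩ <;> simp [monomials₁₁]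

lemma IsZeroScheme.exists_not_comparable {f : X ⟶ F0 (Spec (CommRingCat.of C))}
    (hf : IsZeroScheme u₁ u₂ u₃ v₁ v₂ f) {U : (Spec (CommRingCat.of C)).Opens}
    (hU : Smooth (U.ι ≫ toAffine ![u₁, u₂, u₃, v₁, v₂])) {q : Spec (CommRingCat.of C)} (hq : q ∈ U)
    (h₁ : u₁ ∈ q.asIdeal) (h₂ : u₂ ∈ q.asIdeal)
    (h₃ : u₃ ∈ q.asIdeal) (h₄ : v₁ ∈ q.asIdeal) (h₅ : v₂ ∈ q.asIdeal) :
    ∃ x, ¬ Comparable (f ≫ F0.toBase _) x u₂ v₁ ∧ ¬ Comparable (f ≫ F0.toBase _) x u₃ v₁ ∧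
      ¬ Comparable (f ≫ F0.toBase _) x u₁ v₂ ∧ ¬ Comparable (f ≫ F0.toBase _) x u₃ v₂ := by
  obtain ⟨z, hz⟩ := exists_not_comparable_chart₁₁ hU hq h₁ h₂ h₃ h₄ h₅
  have := hf.isOpenImmersion_chart 1 1
  refine ⟨hf.chart 1 1 z, ?_⟩
  rw [← comparable_comp, ← comparable_comp, ← comparable_comp, ← comparable_comp,
    hf.chart_toBase]
  exact hz

end

/-! ### The geometry over the open sets where the functions are coordinates -/

namespace Model

variable {A : Type} [CommRing A] (m : Model A) (e : Equiv.Perm (Fin 3))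

lemma fibration_eq : m.y * m.s - m.x * m.w * m.t =
    m.y * m.s - m.u (e 0) * m.u (e 1) * m.u (e 2) := by
  rw [prod_u]
variable [Algebra ℂ A] {m}

lemma smooth_toAffine_perm {U : m.patch.Opens} (hU : Smooth (U.ι ≫ m.coords)) :
    Smooth (U.ι ≫ toAffine ![m.u (e 0), m.u (e 1), m.u (e 2), m.y, m.s]) := by
  let σ : Equiv.Perm (Fin 5) := finSumFinEquiv.permCongr (Equiv.sumCongr e (Equiv.refl (Fin 2)))
  have h := smooth_toAffine_comp (v := ![m.x, m.w, m.t, m.y, m.s]) σ hU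
  convert! h using 3
  have h₁ : ∀ i : Fin 3, (![m.x, m.w, m.t, m.y, m.s] (finSumFinEquiv (m := 3) (n := 2) (Sum.inl i)))
      = m.u i := fun i => by fin_cases i <;> rfl
  have h₂ : ∀ i : Fin 2, (![m.x, m.w, m.t, m.y, m.s] (finSumFinEquiv (m := 3) (n := 2) (Sum.inr i)))
      = ![m.y, m.s] i := fun i => by fin_cases i <;> rfl
  funext k
  obtain ⟨k, rfl⟩ := (finSumFinEquiv (m := 3) (n := 2)).surjective k
  simp only [σ, Function.comp_apply, Equiv.permCongr_apply, Equiv.symm_apply_apply]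
  rcases k with k | k
  · rw [Equiv.sumCongr_apply, Sum.map_inl, h₁]
    fin_cases k <;> rfl
  · rw [Equiv.sumCongr_apply, Sum.map_inr, Equiv.refl_apply, h₂]
    fin_cases k <;> rfl

variable (m) in
lemma fibrationι_patchToC : m.fibrationι ≫ m.patchToC =
    toC (m.PatchRing ⧸ Ideal.span {m.y * m.s - m.x * m.w * m.t}) := by
  rw [fibrationι, patchToC, ← Spec.map_comp]
  rfl

variable {U : m.patch.Opens}

theorem smooth_resolution (hU : Smooth (U.ι ≫ m.coords)) :
    Smooth ((m.resolutionToPatch e ⁻¹ᵁ U).ι ≫ m.resolutionToPatch e ≫ m.patchToC) :=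
  (m.isZeroScheme_resolution e).smooth (smooth_toAffine_perm e hU)

theorem two_le_ringKrullDim_resolution (hU : Smooth (U.ι ≫ m.coords)) (p : m.resolution e) (hp : m.resolutionToPatch e p ∈ U)
    (h : m.resolutionToPatch e p ∈ m.lines) :
    2 ≤ ringKrullDim ((m.resolution e).presheaf.stalk p) := by
  obtain ⟨h₁, h₂, h₃⟩ := (m.mem_lines_iff e).mp h
  exact (m.isZeroScheme_resolution e).two_le_ringKrullDim (smooth_toAffine_perm e hU) p rfl hp
    h₁ h₂ h₃

theorem three_le_ringKrullDim_fibration (hU : Smooth (U.ι ≫ m.coords)) (q : m.fibration) (hq : m.fibrationι q ∈ U)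
    (h : m.fibrationι q ∈ m.lines) : 3 ≤ ringKrullDim (m.fibration.presheaf.stalk q) := by
  obtain ⟨i, hi⟩ := Set.mem_iUnion.mp h
  obtain ⟨h₁, h₂, h₃⟩ := m.mem_line_iff.mp hi
  -- The cone lemma allows only the first function to be nonzero, so the function along the line `i`
  -- is moved to the first place.
  let e := Equiv.swap 0 i
  have he : e 0 = i := Equiv.swap_apply_left 0 i
  have hk : ∀ k, k ≠ 0 → m.u (e k) ∈ (m.fibrationι q).asIdeal := fun k hk => by
    refine h₃ _ fun h => hk ?_
    rw [← he] at h
    exact e.injective h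
  exact three_le_ringKrullDim (m.fibration_eq e) (smooth_toAffine_perm e hU) q rfl hq h₁ h₂
    (hk 1 (by decide)) (hk 2 (by decide))

/-- Off the lines ℰ is isomorphic to an open part of a resolution, which is smooth over `U`; any
permutation would serve, and the identity is used. On the lines the lifting argument excludes
smoothness. -/
theorem smooth_fibration_iff (hU : Smooth (U.ι ≫ m.coords)) {V : m.fibration.Opens} (hV : V ≤ m.fibrationι ⁻¹ᵁ U) :
    Smooth (V.ι ≫ m.fibrationι ≫ m.patchToC) ↔ V ≤ m.offLines := by
  refine ⟨fun h z hz hl => ?_, fun h => ?_⟩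
  · obtain ⟨h₁, h₂, h₃⟩ := (m.mem_lines_iff 1).mp hl
    exact not_smooth_of_mem (m.fibration_eq 1) (smooth_toAffine_perm 1 hU) z hz rfl (hV hz) h₁ h₂ h₃
      (fibrationι_patchToC m ▸ h)
  · have := m.isIso_π_restrict 1 h
    have h1 := smooth_resolution 1 hU
    have hle : m.π 1 ⁻¹ᵁ V ≤ m.resolutionToPatch 1 ⁻¹ᵁ U := by
      rw [← π_fibrationι]
      exact fun z hz => hV hz
    have h2 : V.ι ≫ m.fibrationι ≫ m.patchToC = inv (m.π 1 ∣_ V) ≫ Scheme.homOfLE _ hle ≫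
        (m.resolutionToPatch 1 ⁻¹ᵁ U).ι ≫ m.resolutionToPatch 1 ≫ m.patchToC := by
      rw [IsIso.eq_inv_comp, ← Category.assoc, morphismRestrict_ι, Scheme.homOfLE_ι_assoc,
        Category.assoc, ← π_fibrationι, Category.assoc]
    rw [h2]
    infer_instance

/-- Comparability in local rings is preserved by isomorphisms over the patch. On the target `u (e'
0)` is comparable with `y`, and `u (e' 1)` with `s`, at every point. Over a triple point the source
has a point where only `u (e 0)` is comparable with `y` and only `u (e 1)` with `s`, so `e' = e`. -/
theorem isEmpty_iso_resolution (hU : Smooth (U.ι ≫ m.coords)) {q : m.patch} (hq : q ∈ U) (h : q ∈ m.triple)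
    {e' : Equiv.Perm (Fin 3)} (he : e' ≠ e) :
    IsEmpty (Over.mk (m.resolutionToPatch e) ≅ Over.mk (m.resolutionToPatch e')) := by
  refine ⟨fun Φ => he ?_⟩
  obtain ⟨h₁, h₂, h₃⟩ := m.mem_triple_iff.mp h
  obtain ⟨x, hx₁, hx₂, hx₃, hx₄⟩ := (m.isZeroScheme_resolution e).exists_not_comparable
    (smooth_toAffine_perm e hU) hq (h₃ _) (h₃ _) (h₃ _) h₁ h₂
  rw [resolutionι_toBase] at hx₁ hx₂ hx₃ hx₄
  have hw : Φ.hom.left ≫ m.resolutionToPatch e' = m.resolutionToPatch e := Over.w Φ.hom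
  have h4 := (m.isZeroScheme_resolution e').comparable_left (Φ.hom.left x)
  have h5 := (m.isZeroScheme_resolution e').comparable_right (Φ.hom.left x)
  have : IsIso Φ.hom.left := inferInstanceAs (IsIso ((Over.forget _).map Φ.hom))
  rw [resolutionι_toBase, ← comparable_comp, hw] at h4 h5
  have hcases : ∀ k, k = e 0 ∨ k = e 1 ∨ k = e 2 := fun k => by
    obtain ⟨k, rfl⟩ := e.surjective k
    fin_cases k <;> simp
  have he0 : e' 0 = e 0 := by
    obtain h | h | h := hcases (e' 0)
    · exact h
    · exact absurd (h ▸ h4) hx₁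
    · exact absurd (h ▸ h4) hx₂
  have he1 : e' 1 = e 1 := by
    obtain h | h | h := hcases (e' 1)
    · exact absurd (h ▸ h5) hx₃
    · exact h
    · exact absurd (h ▸ h5) hx₄
  have he2 : e' 2 = e 2 := by
    obtain h | h | h := hcases (e' 2)
    · exact absurd (e'.injective (h.trans he0.symm)) (by decide)
    · exact absurd (e'.injective (h.trans he1.symm)) (by decide)
    · exact h
  ext k
  fin_cases k
  · exact congrArg _ he0
  · exact congrArg _ he1
  · exact congrArg _ he2

end Model

end

section

/-! ### A fibrewise criterion for flatness -/

section

variable {A : Type} [CommRing A]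

lemma exists_linearMap_quotient_maximal {L : Type} [AddCommGroup L] [Module A L]
    [Module.Finite A L] [Nontrivial L] :
    ∃ (I : Ideal A) (l : L →ₗ[A] A ⧸ I), I.IsMaximal ∧ l ≠ 0 := by
  obtain ⟨K, hK, -⟩ := (eq_top_or_exists_le_coatom (⊥ : Submodule A L)).resolve_left bot_ne_top
  obtain ⟨I, hI, ⟨φ⟩⟩ := isSimpleModule_iff_quot_maximal.mp
    (isSimpleModule_iff_isCoatom.mpr hK : IsSimpleModule A (L ⧸ K))
  refine ⟨I, φ.toLinearMap ∘ₗ K.mkQ, hI, fun h => hK.1 (eq_top_iff.mpr fun x _ => ?_)⟩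
  have := LinearMap.congr_fun h x
  rw [LinearMap.comp_apply, LinearMap.zero_apply] at this
  exact (Submodule.Quotient.mk_eq_zero K).mp ((map_eq_zero_iff _ φ.injective).mp this)

/-- This passes from maximal to arbitrary ideals. If some coordinate of `n` is not in `I`, the
classes of the coordinates span a nonzero finitely generated submodule `L` of `A / I`, which has a
nonzero map `l` to some `A / J` with `J` maximal. Lifting the images under `l` of the coordinates
gives `n'` with `g n' ∈ J N` by linearity. The hypothesis for `J` then makes `l` vanish on the
generators of `L`, a contradiction. -/
lemma coord_mem_of_forall_maximal {N ι : Type} [AddCommGroup N] [Module A N]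
    (b : Module.Basis ι A N) (g : N →ₗ[A] N)
    (H : ∀ I : Ideal A, I.IsMaximal → ∀ n, (∀ j, b.repr (g n) j ∈ I) → ∀ j, b.repr n j ∈ I)
    (I : Ideal A) (n : N) (hn : ∀ j, b.repr (g n) j ∈ I) (j : ι) : b.repr n j ∈ I := by
  let L : Submodule A (A ⧸ I) :=
    Submodule.span A ((fun i => Ideal.Quotient.mk I (b.repr n i)) '' (b.repr n).support)
  have hL : ∀ i, Ideal.Quotient.mk I (b.repr n i) ∈ L := fun i => by
    by_cases hi : i ∈ (b.repr n).support
    · exact Submodule.subset_span ⟨i, hi, rfl⟩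
    · rw [Finsupp.notMem_support_iff.mp hi, map_zero]
      exact L.zero_mem
  have : Module.Finite A L :=
    Module.Finite.iff_fg.mpr (Submodule.fg_span ((b.repr n).support.finite_toSet.image _))
  by_contra hj
  have : Nontrivial L := by
    refine ⟨⟨⟨_, hL j⟩, 0, fun h => hj ?_⟩⟩
    exact Ideal.Quotient.eq_zero_iff_mem.mp (congrArg Subtype.val h)
  obtain ⟨J, l, hJ, hl⟩ := exists_linearMap_quotient_maximal (A := A) (L := L)
  choose m hm using fun i => Ideal.Quotient.mk_surjective (l ⟨_, hL i⟩)
  let n' : N := ∑ i ∈ (b.repr n).support, m i • b i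
  have hn' : ∀ i ∈ (b.repr n).support, b.repr n' i = m i := by
    intro i hi
    simp only [n', map_sum, map_smul, Module.Basis.repr_self, Finsupp.coe_finsetSum,
      Finset.sum_apply, Finsupp.smul_single, smul_eq_mul, mul_one]
    classical
    simp only [Finsupp.single_apply]
    rw [Finset.sum_ite_eq' _ i m, if_pos hi]
  have hsum : n = ∑ i ∈ (b.repr n).support, b.repr n i • b i := (b.linearCombination_repr n).symm
  have key : ∀ k, b.repr (g n') k ∈ J := by
    intro k
    rw [← Ideal.Quotient.eq_zero_iff_mem]
    have h1 : Ideal.Quotient.mk J (b.repr (g n') k) =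
        l (∑ i ∈ (b.repr n).support, b.repr (g (b i)) k • ⟨_, hL i⟩) := by
      simp only [n', map_sum, map_smul, Finsupp.coe_finsetSum, Finset.sum_apply,
        Finsupp.coe_smul, Pi.smul_apply, ← hm]
      refine Finset.sum_congr rfl fun i _ => ?_
      rw [smul_eq_mul, mul_comm, map_mul]
      rfl
    rw [h1]
    convert! l.map_zero
    refine Subtype.ext ?_
    have h2 : Ideal.Quotient.mk I (b.repr (g n) k) = 0 := Ideal.Quotient.eq_zero_iff_mem.mpr (hn k)
    rw [hsum] at h2
    rw [AddSubmonoidClass.coe_finsetSum]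
    refine Eq.trans ?_ h2
    simp only [map_sum, map_smul, Finsupp.coe_finsetSum, Finset.sum_apply, Finsupp.coe_smul,
      Pi.smul_apply]
    refine Finset.sum_congr rfl fun i _ => ?_
    rw [smul_eq_mul, mul_comm, map_mul]
    rfl
  have hl' : ∀ x (hx : x ∈ L), l ⟨x, hx⟩ = 0 := by
    intro x hx
    induction hx using Submodule.span_induction with
    | mem x hx =>
      obtain ⟨i, hi, rfl⟩ := hx
      rw [← hm, ← hn' i hi]
      exact Ideal.Quotient.eq_zero_iff_mem.mpr (H J hJ n' key i)
    | zero => exact l.map_zero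
    | add x y hx hy h₁ h₂ =>
      exact (l.map_add ⟨x, hx⟩ ⟨y, hy⟩).trans (by rw [h₁, h₂, add_zero])
    | smul a x hx h => exact (l.map_smul a ⟨x, hx⟩).trans (by rw [h, smul_zero])
  exact hl (LinearMap.ext fun x => hl' x.1 x.2)

/-- To see that `I ⊗ M → M` is injective, lift an element of the kernel to `z ∈ I ⊗ N`. Its image in
`N` is some `g n`, and `H` gives `n ∈ I N`, so `n` comes from some `z' ∈ I ⊗ N`. By flatness of `N`,
`z` is the image of `z'` under `g`, and it dies in `I ⊗ M`. -/
lemma flat_of_exact {N M : Type} [AddCommGroup N] [Module A N] [Module.Flat A N] [AddCommGroup M]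
    [Module A M] (g : N →ₗ[A] N) (q : N →ₗ[A] M) (hq : Function.Surjective q)
    (hgq : ∀ n, q n = 0 → ∃ n', g n' = n) (hqg : ∀ n, q (g n) = 0)
    (H : ∀ (I : Ideal A) n, g n ∈ I • (⊤ : Submodule A N) → n ∈ I • (⊤ : Submodule A N)) :
    Module.Flat A M := by
  rw [Module.Flat.iff_lift_lsmul_comp_subtype_injective]
  intro I hI
  have hinj := Module.Flat.iff_lift_lsmul_comp_subtype_injective.mp ‹Module.Flat A N› hI
  set σ := TensorProduct.lift (LinearMap.lsmul A N ∘ₗ Submodule.subtype I) with hσ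
  set τ := TensorProduct.lift (LinearMap.lsmul A M ∘ₗ Submodule.subtype I) with hτ
  have h₁ : ∀ z, τ (q.lTensor I z) = q (σ z) := fun z => by
    refine LinearMap.congr_fun (f := τ ∘ₗ q.lTensor I) (g := q ∘ₗ σ)
      (TensorProduct.ext' fun i n => ?_) z
    simp [hσ, hτ]
  have h₂ : ∀ z, σ (g.lTensor I z) = g (σ z) := fun z => by
    refine LinearMap.congr_fun (f := σ ∘ₗ g.lTensor I) (g := g ∘ₗ σ)
      (TensorProduct.ext' fun i n => ?_) z
    simp [hσ]
  have h₃ : ∀ z, σ z ∈ I • (⊤ : Submodule A N) := fun z => by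
    induction z with
    | zero => rw [map_zero]; exact Submodule.zero_mem _
    | tmul i n => exact Submodule.smul_mem_smul i.2 Submodule.mem_top
    | add x y hx hy => rw [map_add]; exact Submodule.add_mem _ hx hy
  have h₄ : ∀ n ∈ I • (⊤ : Submodule A N), ∃ z, σ z = n := fun n hn => by
    induction hn using Submodule.smul_induction_on' with
    | smul i hi n _ => exact ⟨TensorProduct.tmul A ⟨i, hi⟩ n, by simp [hσ]⟩
    | add x _ y _ hx hy =>
      obtain ⟨z, rfl⟩ := hx
      obtain ⟨z', rfl⟩ := hy
      exact ⟨z + z', map_add _ _ _⟩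
  rw [injective_iff_map_eq_zero]
  intro x hx
  obtain ⟨z, rfl⟩ := LinearMap.lTensor_surjective I hq x
  rw [h₁] at hx
  obtain ⟨n, hn⟩ := hgq _ hx
  obtain ⟨z', hz'⟩ := h₄ n (H I n (hn ▸ h₃ z))
  have hz : z = g.lTensor I z' := hinj (by rw [h₂, hz', hn])
  rw [hz, ← LinearMap.comp_apply, ← LinearMap.lTensor_comp,
    show q ∘ₗ g = 0 from LinearMap.ext hqg, LinearMap.lTensor_zero, LinearMap.zero_apply]

lemma coord_mem_of_mem_smul_top {N ι : Type} [AddCommGroup N] [Module A N]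
    (b : Module.Basis ι A N) {I : Ideal A} {n : N} (hn : n ∈ I • (⊤ : Submodule A N)) (j : ι) :
    b.repr n j ∈ I := by
  induction hn using Submodule.smul_induction_on' with
  | smul i hi n _ =>
    rw [map_smul]
    exact I.mul_mem_right _ hi
  | add x _ y _ hx hy =>
    rw [map_add]
    exact I.add_mem hx hy

lemma mem_smul_top_of_coord_mem {N ι : Type} [AddCommGroup N] [Module A N]
    (b : Module.Basis ι A N) {I : Ideal A} {n : N} (hn : ∀ j, b.repr n j ∈ I) :
    n ∈ I • (⊤ : Submodule A N) := by
  rw [← b.linearCombination_repr n]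
  exact Submodule.sum_mem _ fun i _ => Submodule.smul_mem_smul (hn i) Submodule.mem_top

/-- A quotient of a free algebra by one function is flat if the function is not a zero divisor on
the fibres. The latter is checked by homomorphisms to domains that detect the fibre. -/
lemma flat_quotient_span_singleton {N : Type} [CommRing N] [Algebra A N] [Module.Free A N] (f : N)
    (H : ∀ I : Ideal A, I.IsMaximal → ∃ (ι D : Type) (_ : CommRing D) (_ : IsDomain D)
      (χ : ι → N →+* D), (∀ k, ∀ a ∈ I, χ k (algebraMap A N a) = 0) ∧ (∀ k, χ k f ≠ 0) ∧
      ∀ n, (∀ k, χ k n = 0) → n ∈ I.map (algebraMap A N)) :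
    Module.Flat A (N ⧸ Ideal.span {f}) := by
  let b := Module.Free.chooseBasis A N
  have hI : ∀ (I : Ideal A) (n : N), n ∈ I • (⊤ : Submodule A N) ↔ n ∈ I.map (algebraMap A N) :=
    fun I n => by rw [Ideal.smul_top_eq_map]; rfl
  refine flat_of_exact (LinearMap.mulLeft A f) (Ideal.Quotient.mkₐ A (Ideal.span {f})).toLinearMap
    Ideal.Quotient.mk_surjective (fun n hn => ?_) (fun n => ?_) (fun I n hn => ?_)
  · obtain ⟨n', rfl⟩ := Ideal.mem_span_singleton.mp (Ideal.Quotient.eq_zero_iff_mem.mp hn)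
    exact ⟨n', rfl⟩
  · exact Ideal.Quotient.eq_zero_iff_mem.mpr
      (Ideal.mem_span_singleton.mpr (dvd_mul_right f n))
  · refine mem_smul_top_of_coord_mem b (coord_mem_of_forall_maximal b (LinearMap.mulLeft A f)
      (fun J hJ n hn => ?_) I n (coord_mem_of_mem_smul_top b hn))
    refine coord_mem_of_mem_smul_top b ((hI J n).mpr ?_)
    obtain ⟨ι, D, _, _, χ, h₁, h₂, h₃⟩ := H J hJ
    refine h₃ n fun k => ?_
    have hle : J.map (algebraMap A N) ≤ RingHom.ker (χ k) := Ideal.map_le_iff_le_comap.mpr (h₁ k)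
    have h4 : χ k (f * n) = 0 := hle ((hI J _).mp (mem_smul_top_of_coord_mem b hn))
    rw [map_mul] at h4
    exact (mul_eq_zero.mp h4).resolve_left (h₂ k)

end

end

section

/-! ### The coordinate ring of a family of hyperbolas -/

section

/-- The ring `R[a, b] / (a b - c)`. -/
abbrev HyperbolaRing (R : Type) [CommRing R] (c : R) : Type :=
  MvPolynomial (Fin 2) R ⧸
    Ideal.span {(MvPolynomial.X 0 * MvPolynomial.X 1 - MvPolynomial.C c : MvPolynomial (Fin 2) R)}

namespace HyperbolaRing

variable {R : Type} [CommRing R] {c : R}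

variable (c) in
/-- The first coordinate `a`. -/
def a : HyperbolaRing R c := Ideal.Quotient.mk _ (.X 0)

variable (c) in
/-- The second coordinate `b`. -/
def b : HyperbolaRing R c := Ideal.Quotient.mk _ (.X 1)

lemma a_mul_b : a c * b c = algebraMap R _ c := by
  rw [a, b, ← map_mul]
  exact (Ideal.Quotient.mk_eq_mk_iff_sub_mem _ _).mpr (Ideal.subset_span rfl)

lemma exists_hom {T : Type} [CommRing T] (ρ : R →+* T) {p q : T} (h : p * q = ρ c) :
    ∃ φ : HyperbolaRing R c →+* T, φ.comp (algebraMap R _) = ρ ∧ φ (a c) = p ∧ φ (b c) = q := by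
  have hle : Ideal.span {(.X 0 * .X 1 - .C c : MvPolynomial (Fin 2) R)} ≤
      RingHom.ker (MvPolynomial.eval₂Hom ρ ![p, q]) := by
    rw [Ideal.span_singleton_le_iff_mem, RingHom.mem_ker]
    simp [h]
  have hφ : ∀ r, Ideal.Quotient.lift _ _ hle (Ideal.Quotient.mk _ r) =
      MvPolynomial.eval₂Hom ρ ![p, q] r := fun r => Ideal.Quotient.lift_mk _ _ _
  refine ⟨Ideal.Quotient.lift _ _ hle, RingHom.ext fun r => ?_, ?_, ?_⟩
  · exact (hφ (.C r)).trans (by simp)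
  · exact (hφ _).trans (by simp)
  · exact (hφ _).trans (by simp)

lemma hom_ext {T : Type} [CommRing T] {φ ψ : HyperbolaRing R c →+* T}
    (h : φ.comp (algebraMap R _) = ψ.comp (algebraMap R _)) (ha : φ (a c) = ψ (a c))
    (hb : φ (b c) = ψ (b c)) : φ = ψ := by
  refine Ideal.Quotient.ringHom_ext (MvPolynomial.ringHom_ext (fun r => RingHom.congr_fun h r)
    fun k => ?_)
  fin_cases k
  exacts [ha, hb]

lemma smul_eq (r : R) (z : HyperbolaRing R c) : r • z = algebraMap R (HyperbolaRing R c) r * z :=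
  Algebra.smul_def r z

variable (c) in
/-- The monomials that form a basis. -/
def monomial (n : ℤ) : HyperbolaRing R c := a c ^ n.toNat * b c ^ (-n).toNat

lemma monomial_ofNat (k : ℕ) : monomial c k = a c ^ k := by
  simp [monomial]

lemma monomial_neg (k : ℕ) : monomial c (-k) = b c ^ k := by
  simp [monomial]

lemma monomial_mul_a (n : ℤ) : ∃ r : R, monomial c n * a c = r • monomial c (n + 1) := by
  obtain ⟨k, rfl | rfl⟩ := n.eq_nat_or_neg
  · refine ⟨1, ?_⟩
    rw [← Nat.cast_succ, monomial_ofNat, monomial_ofNat, one_smul, pow_succ]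
  · obtain _ | k := k
    · refine ⟨1, ?_⟩
      simp [monomial]
    · refine ⟨c, ?_⟩
      rw [show (-((k + 1 : ℕ) : ℤ) + 1) = -(k : ℤ) by push_cast; ring, monomial_neg, monomial_neg,
        smul_eq, ← a_mul_b]
      ring

lemma monomial_mul_b (n : ℤ) : ∃ r : R, monomial c n * b c = r • monomial c (n - 1) := by
  obtain ⟨k, rfl | rfl⟩ := n.eq_nat_or_neg
  · obtain _ | k := k
    · refine ⟨1, ?_⟩
      simp [monomial]
    · refine ⟨c, ?_⟩
      rw [show (((k + 1 : ℕ) : ℤ) - 1) = (k : ℤ) by push_cast; ring, monomial_ofNat, monomial_ofNat,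
        smul_eq, ← a_mul_b]
      ring
  · refine ⟨1, ?_⟩
    rw [show -(k : ℤ) - 1 = -((k + 1 : ℕ) : ℤ) by push_cast; ring, monomial_neg, monomial_neg,
      one_smul, pow_succ]

/-- The span contains `1` and is stable under multiplication by `a` and `b`, since each monomial is
sent to a multiple of another; the relation `ab = c` only contributes a scalar. -/
lemma span_monomial : Submodule.span R (Set.range (monomial c)) = ⊤ := by
  refine eq_top_iff.mpr fun z _ => ?_
  have hmul : ∀ t : HyperbolaRing R c, (∀ n, ∃ (r : R) (n' : ℤ), monomial c n * t =
      r • monomial c n') → ∀ z ∈ Submodule.span R (Set.range (monomial c)),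
      z * t ∈ Submodule.span R (Set.range (monomial c)) := by
    intro t ht z hz
    induction hz using Submodule.span_induction with
    | mem z hz =>
      obtain ⟨n, rfl⟩ := hz
      obtain ⟨r, n', h⟩ := ht n
      rw [h]
      exact Submodule.smul_mem _ _ (Submodule.subset_span ⟨n', rfl⟩)
    | zero => rw [zero_mul]; exact Submodule.zero_mem _
    | add x y _ _ hx hy => rw [add_mul]; exact Submodule.add_mem _ hx hy
    | smul r x _ hx => rw [smul_mul_assoc]; exact Submodule.smul_mem _ _ hx
  obtain ⟨z, rfl⟩ := Ideal.Quotient.mk_surjective z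
  induction z using MvPolynomial.induction_on with
  | C r =>
    have h : Ideal.Quotient.mk _ (.C r) = r • monomial c 0 := by
      simp only [monomial, Int.toNat_zero, neg_zero, pow_zero, mul_one, smul_eq]
      rfl
    rw [h]
    exact Submodule.smul_mem _ _ (Submodule.subset_span ⟨0, rfl⟩)
  | add p q hp hq => rw [map_add]; exact Submodule.add_mem _ (hp trivial) (hq trivial)
  | mul_X p k hp =>
    rw [map_mul]
    fin_cases k
    · exact hmul (a c) (fun n => let ⟨r, h⟩ := monomial_mul_a n; ⟨r, _, h⟩) _ (hp trivial)
    · exact hmul (b c) (fun n => let ⟨r, h⟩ := monomial_mul_b n; ⟨r, _, h⟩) _ (hp trivial)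

/-! ### The two branches of a hyperbola as homomorphisms to Laurent polynomials -/

section Laurent

variable {D : Type} [CommRing D]

lemma C_mul_T_neg_one_mul_T (d : D) : LaurentPolynomial.C d * .T (-1) * .T 1 =
    (LaurentPolynomial.C d : LaurentPolynomial D) := by
  rw [LaurentPolynomial.mul_T_assoc, neg_add_cancel, LaurentPolynomial.T_zero, mul_one]

lemma T_mul_C_mul_T_neg_one (d : D) : .T 1 * (LaurentPolynomial.C d * .T (-1)) =
    (LaurentPolynomial.C d : LaurentPolynomial D) := by
  rw [mul_comm, C_mul_T_neg_one_mul_T]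

/-- The homomorphism `(a, b) ↦ (T, c T⁻¹)`. -/
def laurentA (ρ : R →+* D) : HyperbolaRing R c →+* LaurentPolynomial D :=
  (exists_hom (LaurentPolynomial.C.comp ρ) (T_mul_C_mul_T_neg_one (ρ c))).choose

/-- The homomorphism `(a, b) ↦ (c T⁻¹, T)`. -/
def laurentB (ρ : R →+* D) : HyperbolaRing R c →+* LaurentPolynomial D :=
  (exists_hom (LaurentPolynomial.C.comp ρ) (C_mul_T_neg_one_mul_T (ρ c))).choose

variable (ρ : R →+* D)

@[simp]
lemma laurentA_algebraMap (r : R) :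
    laurentA ρ (algebraMap R (HyperbolaRing R c) r) = .C (ρ r) :=
  RingHom.congr_fun (exists_hom (LaurentPolynomial.C.comp ρ)
    (T_mul_C_mul_T_neg_one (ρ c))).choose_spec.1 r

@[simp]
lemma laurentA_a : laurentA ρ (a c) = .T 1 :=
  (exists_hom (LaurentPolynomial.C.comp ρ) (T_mul_C_mul_T_neg_one (ρ c))).choose_spec.2.1

@[simp]
lemma laurentA_b : laurentA ρ (b c) = .C (ρ c) * .T (-1) :=
  (exists_hom (LaurentPolynomial.C.comp ρ) (T_mul_C_mul_T_neg_one (ρ c))).choose_spec.2.2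

@[simp]
lemma laurentB_algebraMap (r : R) :
    laurentB ρ (algebraMap R (HyperbolaRing R c) r) = .C (ρ r) :=
  RingHom.congr_fun (exists_hom (LaurentPolynomial.C.comp ρ)
    (C_mul_T_neg_one_mul_T (ρ c))).choose_spec.1 r

@[simp]
lemma laurentB_a : laurentB ρ (a c) = .C (ρ c) * .T (-1) :=
  (exists_hom (LaurentPolynomial.C.comp ρ) (C_mul_T_neg_one_mul_T (ρ c))).choose_spec.2.1

@[simp]
lemma laurentB_b : laurentB ρ (b c) = .T 1 :=
  (exists_hom (LaurentPolynomial.C.comp ρ) (C_mul_T_neg_one_mul_T (ρ c))).choose_spec.2.2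

lemma coeff_C_mul_T (d : D) (m n : ℤ) :
    (LaurentPolynomial.C d * .T m).coeff n = if m = n then d else 0 := by
  rw [← LaurentPolynomial.single_eq_C_mul_T]
  exact Finsupp.single_apply

lemma laurentA_monomial (m : ℤ) :
    laurentA ρ (monomial c m) = .C (ρ c ^ (-m).toNat) * .T m := by
  rw [monomial, map_mul, map_pow, map_pow, laurentA_a, laurentA_b, mul_pow,
    LaurentPolynomial.T_pow, LaurentPolynomial.T_pow, ← map_pow, mul_left_comm,
    ← LaurentPolynomial.T_add]
  congr 2
  omega

lemma laurentB_monomial (m : ℤ) :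
    laurentB ρ (monomial c m) = .C (ρ c ^ m.toNat) * .T (-m) := by
  rw [monomial, map_mul, map_pow, map_pow, laurentB_a, laurentB_b, mul_pow,
    LaurentPolynomial.T_pow, LaurentPolynomial.T_pow, ← map_pow, mul_assoc,
    ← LaurentPolynomial.T_add]
  congr 2
  omega

/-- On this branch `a ^ n` goes to `T ^ n` without a factor, so coefficients with `n ≥ 0` can be
read off. Those with `n ≤ 0` are scaled by powers of `c`, possibly zero, and need the other branch.
-/
lemma coeff_laurentA (l : ℤ →₀ R) {n : ℤ} (hn : 0 ≤ n) :
    (laurentA ρ (Finsupp.linearCombination R (monomial c) l)).coeff n = ρ (l n) := by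
  induction l using Finsupp.induction_linear with
  | zero => simp
  | add f g hf hg => rw [map_add, map_add, Finsupp.add_apply, map_add, ← hf, ← hg]; rfl
  | single m r =>
    rw [Finsupp.linearCombination_single, smul_eq, map_mul, laurentA_algebraMap,
      laurentA_monomial, ← mul_assoc, ← map_mul, coeff_C_mul_T, Finsupp.single_apply]
    split_ifs with h
    · subst h
      simp [Int.toNat_of_nonpos (neg_nonpos.mpr hn)]
    · simp

lemma coeff_laurentB (l : ℤ →₀ R) {n : ℤ} (hn : n ≤ 0) :
    (laurentB ρ (Finsupp.linearCombination R (monomial c) l)).coeff (-n) = ρ (l n) := by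
  induction l using Finsupp.induction_linear with
  | zero => simp
  | add f g hf hg => rw [map_add, map_add, Finsupp.add_apply, map_add, ← hf, ← hg]; rfl
  | single m r =>
    rw [Finsupp.linearCombination_single, smul_eq, map_mul, laurentB_algebraMap,
      laurentB_monomial, ← mul_assoc, ← map_mul, coeff_C_mul_T, Finsupp.single_apply]
    by_cases h : m = n
    · subst h
      simp [Int.toNat_of_nonpos hn]
    · rw [if_neg h, if_neg (fun h' => h (neg_injective h')), map_zero]

lemma map_coeff_eq_zero {l : ℤ →₀ R}
    (h₁ : laurentA ρ (Finsupp.linearCombination R (monomial c) l) = 0)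
    (h₂ : laurentB ρ (Finsupp.linearCombination R (monomial c) l) = 0) (n : ℤ) : ρ (l n) = 0 := by
  obtain hn | hn := le_total 0 n
  · rw [← coeff_laurentA ρ l hn, h₁]
    rfl
  · rw [← coeff_laurentB ρ l hn, h₂]
    rfl

end Laurent

instance : Module.Free R (HyperbolaRing R c) := by
  -- For `ρ` the identity the two branches together recover every coefficient, so the spanning
  -- monomials are independent.
  refine Module.Free.of_basis (Module.Basis.mk (v := monomial c) ?_ span_monomial.ge)
  rw [linearIndependent_iff]
  refine fun l hl => Finsupp.ext fun n => map_coeff_eq_zero (c := c) (RingHom.id R) ?_ ?_ n <;>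
  rw [hl, map_zero]

/-- If all branches vanish on `z`, each of its coefficients is killed by all `ρ k` and hence lies in
`J`. In this way the branches detect the fibre over `J`. -/
lemma mem_map_of_laurent {J : Ideal R} {ι D : Type} [CommRing D] (ρ : ι → R →+* D)
    (h : ∀ r, (∀ k, ρ k r = 0) → r ∈ J) {z : HyperbolaRing R c}
    (hA : ∀ k, laurentA (ρ k) z = 0) (hB : ∀ k, laurentB (ρ k) z = 0) :
    z ∈ J.map (algebraMap R (HyperbolaRing R c)) := by
  obtain ⟨l, rfl⟩ := (Finsupp.mem_span_range_iff_exists_finsupp).mp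
    (span_monomial.ge (Submodule.mem_top : z ∈ ⊤))
  refine Submodule.sum_mem _ fun n _ => ?_
  change l n • monomial c n ∈ _
  rw [smul_eq]
  refine Ideal.mul_mem_right _ _ (Ideal.mem_map_of_mem _ (h _ fun k => ?_))
  exact map_coeff_eq_zero (ρ k) (hA k) (hB k) n

end HyperbolaRing

end

end

section

/-! ### Flatness -/

section

lemma ChartRing.exists_hom {C T : Type} [CommRing C] [CommRing T] {u₁ u₂ u₃ v₁ v₂ : C} {i j : Fin 2}
    (φ : C →+* T) {p q : T} (h : ZeroEqs (φ u₁) (φ u₂) (φ u₃) (φ v₁) (φ v₂) (affineCoords i p)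
      (affineCoords j q)) :
    ∃ χ : ChartRing u₁ u₂ u₃ v₁ v₂ i j →+* T, χ.comp (algebraMap C _) = φ ∧
      χ (Ideal.Quotient.mk _ (.X 0)) = p ∧ χ (Ideal.Quotient.mk _ (.X 1)) = q := by
  have hle : chartIdeal u₁ u₂ u₃ v₁ v₂ i j ≤ RingHom.ker (MvPolynomial.eval₂Hom φ ![p, q]) := by
    rw [chartIdeal_le_ker_iff]
    simpa using h
  have hχ : ∀ r, Ideal.Quotient.lift _ _ hle (Ideal.Quotient.mk _ r) =
      MvPolynomial.eval₂Hom φ ![p, q] r := fun r => Ideal.Quotient.lift_mk _ _ _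
  refine ⟨Ideal.Quotient.lift _ _ hle, RingHom.ext fun r => ?_, ?_, ?_⟩
  · exact (hχ (.C r)).trans (by simp)
  · exact (hχ _).trans (by simp)
  · exact (hχ _).trans (by simp)

lemma ChartRing.hom_ext {C T : Type} [CommRing C] [CommRing T] {u₁ u₂ u₃ v₁ v₂ : C} {i j : Fin 2}
    {φ ψ : ChartRing u₁ u₂ u₃ v₁ v₂ i j →+* T}
    (h : φ.comp (algebraMap C _) = ψ.comp (algebraMap C _))
    (h₀ : φ (Ideal.Quotient.mk _ (.X 0)) = ψ (Ideal.Quotient.mk _ (.X 0)))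
    (h₁ : φ (Ideal.Quotient.mk _ (.X 1)) = ψ (Ideal.Quotient.mk _ (.X 1))) : φ = ψ := by
  refine Ideal.Quotient.ringHom_ext (MvPolynomial.ringHom_ext (fun r => RingHom.congr_fun h r)
    fun k => ?_)
  fin_cases k
  exacts [h₀, h₁]

/-- A ring homomorphism that exhibits the target as the polynomial ring in the variable `v`. -/
structure IsPolynomialOver {R P : Type} [CommRing R] [CommRing P] (η : R →+* P) (v : P) : Prop where
  exists_hom : ∀ {T : Type} [CommRing T] (h : R →+* T) (t : T), ∃ k : P →+* T, k.comp η = h ∧ k v = t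
  hom_ext : ∀ {T : Type} [CommRing T] {k k' : P →+* T}, k.comp η = k'.comp η → k v = k' v → k = k'

variable {R P : Type} [CommRing R] [CommRing P] {η : R →+* P} {v : P}

lemma IsPolynomialOver.add (h : IsPolynomialOver η v) (d : R) : IsPolynomialOver η (v + η d) where
  exists_hom ρ t := by
    obtain ⟨k, hk, hv⟩ := h.exists_hom ρ (t - ρ d)
    refine ⟨k, hk, ?_⟩
    rw [map_add, hv, ← RingHom.comp_apply, hk, sub_add_cancel]
  hom_ext {T _ k k'} hk hv := by
    refine h.hom_ext hk ?_
    have := RingHom.congr_fun hk d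
    rw [RingHom.comp_apply, RingHom.comp_apply] at this
    rwa [map_add, map_add, this, add_right_cancel_iff] at hv

lemma flat_of_inverse {A M S : Type} [CommRing A] [CommRing M] [CommRing S] [Algebra A M]
    [Module.Flat A M] (f : M →+* S) (g : S →+* M) (h₁ : f.comp g = RingHom.id S)
    (h₂ : g.comp f = RingHom.id M) : (f.comp (algebraMap A M)).Flat :=
  (RingHom.flat_algebraMap_iff.mpr inferInstance).comp (RingHom.Flat.of_bijective
    ⟨Function.LeftInverse.injective (g := g) (RingHom.congr_fun h₂),
      Function.RightInverse.surjective (g := g) (RingHom.congr_fun h₁)⟩)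

variable {A : Type} [CommRing A] [Algebra A R]

open Polynomial in
-- Since `P` is the polynomial ring over `R` in `v`, its quotient by `F` is `R[X]` modulo `X (X + d)
-- - u`; only the flatness over `A` of the latter is needed.
lemma flat_cone (u d : R)
    (h : Module.Flat A (R[X] ⧸ Ideal.span {X * (X + C d) - C u})) {F : P}
    (hv : IsPolynomialOver η v) (hF : F = v * (v + η d) - η u) :
    ((Ideal.Quotient.mk (Ideal.span {F})).comp (η.comp (algebraMap A R))).Flat := by
  let q := Ideal.Quotient.mk (Ideal.span {X * (X + C d) - C u})
  let q' := Ideal.Quotient.mk (Ideal.span {F})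
  obtain ⟨k, hk, hkv⟩ := hv.exists_hom (q.comp C) (q X)
  have hkC : ∀ r, k (η r) = q (C r) := RingHom.congr_fun hk
  have h₁ : Ideal.span {X * (X + C d) - C u} ≤ RingHom.ker (eval₂RingHom (q'.comp η) (q' v)) := by
    rw [Ideal.span_singleton_le_iff_mem, RingHom.mem_ker]
    refine Eq.trans ?_ (Ideal.Quotient.eq_zero_iff_mem.mpr (Ideal.mem_span_singleton_self F))
    simp [hF, q']
  have h₂ : Ideal.span {F} ≤ RingHom.ker k := by
    rw [Ideal.span_singleton_le_iff_mem, RingHom.mem_ker, hF, map_sub, map_mul, map_add, hkC, hkC,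
      hkv, ← map_add, ← map_mul, ← map_sub]
    exact Ideal.Quotient.eq_zero_iff_mem.mpr (Ideal.mem_span_singleton_self _)
  let f : R[X] ⧸ Ideal.span {X * (X + C d) - C u} →+* P ⧸ Ideal.span {F} :=
    Ideal.Quotient.lift _ _ h₁
  let g : P ⧸ Ideal.span {F} →+* R[X] ⧸ Ideal.span {X * (X + C d) - C u} :=
    Ideal.Quotient.lift _ _ h₂
  have hf : ∀ r, f (q r) = eval₂RingHom (q'.comp η) (q' v) r := fun r => rfl
  have hg : ∀ r, g (q' r) = k r := fun r => rfl
  have e := flat_of_inverse (A := A) f g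
    (Ideal.Quotient.ringHom_ext (hv.hom_ext (RingHom.ext fun r => by
      change f (g (q' (η r))) = q' (η r)
      rw [hg, hkC, hf]
      simp) (by
      change f (g (q' v)) = q' v
      rw [hg, hkv, hf]
      simp)))
    (Ideal.Quotient.ringHom_ext (ringHom_ext (fun r => by
      change g (f (q (C r))) = q (C r)
      rw [hf, coe_eval₂RingHom, eval₂_C, RingHom.comp_apply, hg, hkC]) (by
      change g (f (q X)) = q X
      rw [hf, coe_eval₂RingHom, eval₂_X, hg, hkv])))
  convert! e using 1
  refine RingHom.ext fun r => ?_
  change q' (η (algebraMap A R r)) = f (q (C (algebraMap A R r)))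
  rw [hf, coe_eval₂RingHom, eval₂_C]
  rfl

open Polynomial in
-- Here `b = a u₃`, so `v' = u₂ u₃ a` and `v = u₂ u₃ a - d` are eliminated. What remains is `R[a]`
-- modulo the first equation `u₁ = a v`.
lemma flat_chart₀₁ {u₁ u₂ u₃ d : R} {v' : P} (hv : IsPolynomialOver η v) (hv' : v' = v + η d)
    (h : Module.Flat A (R[X] ⧸ Ideal.span {C u₁ - X * (C u₂ * C u₃ * X - C d)})) :
    ((algebraMap P (ChartRing (η u₁) (η u₂) (η u₃) v v' 0 1)).comp
      (η.comp (algebraMap A R))).Flat := by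
  let q := Ideal.Quotient.mk (Ideal.span {C u₁ - X * (C u₂ * C u₃ * X - C d)})
  let S := ChartRing (η u₁) (η u₂) (η u₃) v v' 0 1
  let q' := algebraMap P S
  let a : S := Ideal.Quotient.mk _ (MvPolynomial.X 0)
  let b : S := Ideal.Quotient.mk _ (MvPolynomial.X 1)
  have hq : q (C u₁) = q X * (q (C u₂) * q (C u₃) * q X - q (C d)) := by
    have h0 : q (C u₁ - X * (C u₂ * C u₃ * X - C d)) = 0 :=
      Ideal.Quotient.eq_zero_iff_mem.mpr (Ideal.mem_span_singleton_self _)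
    rwa [map_sub, map_mul, map_sub, map_mul, map_mul, sub_eq_zero] at h0
  obtain ⟨e₁, e₂, e₃⟩ := zeroEqs_mk (η u₁) (η u₂) (η u₃) v v' 0 1
  simp only [affineCoords_one_zero, affineCoords_one_one, affineCoords_zero_zero,
    affineCoords_zero_one, one_mul, mul_one] at e₁ e₂ e₃
  replace e₁ : q' (η u₁) - a * q' v = 0 := e₁
  replace e₂ : q' (η u₂) * b - q' v' = 0 := e₂
  replace e₃ : b - a * q' (η u₃) = 0 := e₃
  have ev : q' v' = q' v + q' (η d) := (congrArg q' hv').trans (map_add q' _ _)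
  obtain ⟨k, hk, hkv⟩ := hv.exists_hom (q.comp C) (q (C u₂) * q (C u₃) * q X - q (C d))
  have hkC : ∀ r, k (η r) = q (C r) := RingHom.congr_fun hk
  have h₁ : Ideal.span {C u₁ - X * (C u₂ * C u₃ * X - C d)} ≤
      RingHom.ker (eval₂RingHom (q'.comp η) a) := by
    rw [Ideal.span_singleton_le_iff_mem, RingHom.mem_ker]
    simp
    linear_combination e₁ + a * (q' (η u₂) * e₃ - e₂ - ev)
  let f : R[X] ⧸ Ideal.span {C u₁ - X * (C u₂ * C u₃ * X - C d)} →+* S :=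
    Ideal.Quotient.lift _ _ h₁
  have hf : ∀ r, f (q r) = eval₂RingHom (q'.comp η) a r := fun r => rfl
  have hfC : ∀ r, f (q (C r)) = q' (η r) := fun r => by rw [hf]; simp
  have hfX : f (q X) = a := by rw [hf]; simp
  obtain ⟨g, hg, hga, hgb⟩ := ChartRing.exists_hom (u₁ := η u₁) (u₂ := η u₂) (u₃ := η u₃) (v₁ := v)
    (v₂ := v') (i := 0) (j := 1) k (p := q X) (q := q X * q (C u₃)) (by
      rw [hv', map_add, hkv, hkC, hkC, hkC, hkC]
      simp only [ZeroEqs, affineCoords_one_zero, affineCoords_one_one, affineCoords_zero_zero,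
        affineCoords_zero_one, one_mul, mul_one]
      refine ⟨?_, ?_, ?_⟩
      · linear_combination hq
      · ring
      · ring)
  replace hga : g a = q X := hga
  have hg' : ∀ r, g (q' r) = k r := RingHom.congr_fun hg
  have e := flat_of_inverse (A := A) f g
    (ChartRing.hom_ext (hv.hom_ext (RingHom.ext fun r => by
      change f (g (q' (η r))) = q' (η r)
      rw [hg', hkC, hfC]) (by
      change f (g (q' v)) = q' v
      rw [hg', hkv, map_sub, map_mul, map_mul, hfC, hfC, hfC, hfX]
      linear_combination ev + e₂ - q' (η u₂) * e₃)) (by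
      change f (g a) = a
      rw [hga, hfX]) (by
      change f (g b) = b
      rw [hgb, map_mul, hfX, hfC]
      linear_combination -e₃))
    (Ideal.Quotient.ringHom_ext (ringHom_ext (fun r => by
      change g (f (q (C r))) = q (C r)
      rw [hfC, hg', hkC]) (by
      change g (f (q X)) = q X
      rw [hfX, hga])))
  convert! e using 1
  exact RingHom.ext fun r => (hfC _).symm

/-- Here `v = u₁ a` and `v' = u₂ b`, so `v` is eliminated and `v' - v = d` becomes the single
equation `u₂ b - u₁ a = d` on the hyperbola `ab = u₃` over `R`. -/
lemma flat_chart₁₁ {u₁ u₂ u₃ d : R} {v' : P} (hv : IsPolynomialOver η v) (hv' : v' = v + η d)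
    (h : Module.Flat A (HyperbolaRing R u₃ ⧸ Ideal.span {algebraMap R _ u₂ * HyperbolaRing.b u₃ -
      algebraMap R _ u₁ * HyperbolaRing.a u₃ - algebraMap R _ d})) :
    ((algebraMap P (ChartRing (η u₁) (η u₂) (η u₃) v v' 1 1)).comp
      (η.comp (algebraMap A R))).Flat := by
  let G := algebraMap R _ u₂ * HyperbolaRing.b u₃ -
      algebraMap R _ u₁ * HyperbolaRing.a u₃ - algebraMap R _ d
  let q := Ideal.Quotient.mk (Ideal.span {G})
  let c := algebraMap R (HyperbolaRing R u₃)
  let S := ChartRing (η u₁) (η u₂) (η u₃) v v' 1 1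
  let q' := algebraMap P S
  let a : S := Ideal.Quotient.mk _ (MvPolynomial.X 0)
  let b : S := Ideal.Quotient.mk _ (MvPolynomial.X 1)
  have hq : q (c u₂) * q (HyperbolaRing.b u₃) - q (c u₁) * q (HyperbolaRing.a u₃) - q (c d) = 0 := by
    rw [← map_mul, ← map_mul, ← map_sub, ← map_sub]
    exact Ideal.Quotient.eq_zero_iff_mem.mpr (Ideal.mem_span_singleton_self _)
  obtain ⟨e₁, e₂, e₃⟩ := zeroEqs_mk (η u₁) (η u₂) (η u₃) v v' 1 1
  simp only [affineCoords_one_zero, affineCoords_one_one, one_mul, mul_one] at e₁ e₂ e₃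
  replace e₁ : q' (η u₁) * a - q' v = 0 := e₁
  replace e₂ : q' (η u₂) * b - q' v' = 0 := e₂
  replace e₃ : a * b - q' (η u₃) = 0 := e₃
  have ev : q' v' = q' v + q' (η d) := (congrArg q' hv').trans (map_add q' _ _)
  obtain ⟨k, hk, hkv⟩ := hv.exists_hom (q.comp c) (q (c u₁) * q (HyperbolaRing.a u₃))
  have hkC : ∀ r, k (η r) = q (c r) := RingHom.congr_fun hk
  obtain ⟨f₀, hf₀, hf₀a, hf₀b⟩ := HyperbolaRing.exists_hom (c := u₃) (q'.comp η) (p := a) (q := b)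
    (sub_eq_zero.mp e₃)
  have hf₀' : ∀ r, f₀ (c r) = q' (η r) := RingHom.congr_fun hf₀
  have h₁ : Ideal.span {G} ≤ RingHom.ker f₀ := by
    rw [Ideal.span_singleton_le_iff_mem, RingHom.mem_ker, map_sub, map_sub, map_mul, map_mul,
      hf₀a, hf₀b]
    change f₀ (c u₂) * b - f₀ (c u₁) * a - f₀ (c d) = 0
    rw [hf₀', hf₀', hf₀']
    linear_combination e₂ - e₁ + ev
  let f : HyperbolaRing R u₃ ⧸ Ideal.span {G} →+* S := Ideal.Quotient.lift _ _ h₁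
  have hf : ∀ r, f (q r) = f₀ r := fun r => rfl
  have hab : q (HyperbolaRing.a u₃) * q (HyperbolaRing.b u₃) = q (c u₃) := by
    rw [← map_mul, HyperbolaRing.a_mul_b]
  obtain ⟨g, hg, hga, hgb⟩ := ChartRing.exists_hom (u₁ := η u₁) (u₂ := η u₂) (u₃ := η u₃) (v₁ := v)
    (v₂ := v') (i := 1) (j := 1) k (p := q (HyperbolaRing.a u₃)) (q := q (HyperbolaRing.b u₃)) (by
      rw [hv', map_add, hkv, hkC, hkC, hkC, hkC]
      simp only [ZeroEqs, affineCoords_one_zero, affineCoords_one_one]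
      refine ⟨?_, ?_, ?_⟩
      · ring
      · linear_combination hq
      · linear_combination hab)
  replace hga : g a = q (HyperbolaRing.a u₃) := hga
  replace hgb : g b = q (HyperbolaRing.b u₃) := hgb
  have hg' : ∀ r, g (q' r) = k r := RingHom.congr_fun hg
  have e := flat_of_inverse (A := A) f g
    (ChartRing.hom_ext (hv.hom_ext (RingHom.ext fun r => by
      change f (g (q' (η r))) = q' (η r)
      rw [hg', hkC, hf, hf₀']) (by
      change f (g (q' v)) = q' v
      rw [hg', hkv, map_mul, hf, hf, hf₀', hf₀a]
      linear_combination e₁)) (by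
      change f (g a) = a
      rw [hga, hf, hf₀a]) (by
      change f (g b) = b
      rw [hgb, hf, hf₀b]))
    (Ideal.Quotient.ringHom_ext (HyperbolaRing.hom_ext (RingHom.ext fun r => by
      change g (f (q (c r))) = q (c r)
      rw [hf, hf₀', hg', hkC]) (by
      change g (f (q (HyperbolaRing.a u₃))) = q (HyperbolaRing.a u₃)
      rw [hf, hf₀a, hga]) (by
      change g (f (q (HyperbolaRing.b u₃))) = q (HyperbolaRing.b u₃)
      rw [hf, hf₀b, hgb])))
  convert! e using 1
  exact RingHom.ext fun r => (hf₀' _).symm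

end

end

/-! ### Flatness of the fibration and of its resolutions over the base -/

section

namespace Model

variable {A : Type} [CommRing A] (m : Model A)

/-- The ring `A[x, w] / (x w - w₀)`. -/
abbrev BaseRing : Type := HyperbolaRing A m.w₀

/-- The inclusion of `A[x, w] / (x w - w₀)` in the coordinate ring of the patch. -/
def η : m.BaseRing →+* m.PatchRing :=
  (HyperbolaRing.exists_hom (algebraMap A m.PatchRing) m.x_mul_w).choose

@[simp]
lemma η_algebraMap (r : A) : m.η (algebraMap A m.BaseRing r) = algebraMap A m.PatchRing r :=
  RingHom.congr_fun
    (HyperbolaRing.exists_hom (algebraMap A m.PatchRing) m.x_mul_w).choose_spec.1 r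

@[simp]
lemma η_a : m.η (HyperbolaRing.a m.w₀) = m.x :=
  (HyperbolaRing.exists_hom (algebraMap A m.PatchRing) m.x_mul_w).choose_spec.2.1

@[simp]
lemma η_b : m.η (HyperbolaRing.b m.w₀) = m.w :=
  (HyperbolaRing.exists_hom (algebraMap A m.PatchRing) m.x_mul_w).choose_spec.2.2

/-- The difference `s - y = β₅ + w β₃`. -/
def γ : m.BaseRing := algebraMap A _ m.β₅ + HyperbolaRing.b m.w₀ * algebraMap A _ m.β₃

/-- The function `t` on the spectrum of `A[x, w] / (x w - w₀)`. -/
def baseT : m.BaseRing := HyperbolaRing.a m.w₀ + algebraMap A _ m.β₄ +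
  HyperbolaRing.b m.w₀ * algebraMap A _ m.β₂ + HyperbolaRing.b m.w₀ ^ 2 * algebraMap A _ m.β₀

/-- The functions `(x, w, t)` on the spectrum of `A[x, w] / (x w - w₀)`. -/
def baseU : Fin 3 → m.BaseRing := ![HyperbolaRing.a m.w₀, HyperbolaRing.b m.w₀, m.baseT]

lemma η_baseU (k : Fin 3) : m.η (m.baseU k) = m.u k := by
  fin_cases k <;> simp [baseU, u, baseT, t]

lemma s_eq : m.s = m.y + m.η m.γ := by
  simp [s, γ, add_assoc]

lemma isPolynomialOver_y : IsPolynomialOver m.η m.y where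
  exists_hom {T _} h c := by
    have hle : Ideal.span {(.X 0 * .X 2 - .C m.w₀ : MvPolynomial (Fin 3) A)} ≤
        RingHom.ker (MvPolynomial.eval₂Hom (h.comp (algebraMap A m.BaseRing))
          ![h (HyperbolaRing.a m.w₀), c, h (HyperbolaRing.b m.w₀)]) := by
      rw [Ideal.span_singleton_le_iff_mem, RingHom.mem_ker]
      simp [← map_mul, HyperbolaRing.a_mul_b]
    have hk : ∀ r, Ideal.Quotient.lift _ _ hle (Ideal.Quotient.mk _ r) = MvPolynomial.eval₂Hom
        (h.comp (algebraMap A m.BaseRing))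
        ![h (HyperbolaRing.a m.w₀), c, h (HyperbolaRing.b m.w₀)] r :=
      fun r => Ideal.Quotient.lift_mk _ _ _
    refine ⟨Ideal.Quotient.lift _ _ hle, HyperbolaRing.hom_ext (RingHom.ext fun r => ?_) ?_ ?_, ?_⟩
    · rw [RingHom.comp_apply, RingHom.comp_apply, η_algebraMap]
      exact (hk (.C r)).trans (by simp)
    · rw [RingHom.comp_apply, η_a]
      exact (hk _).trans (by simp)
    · rw [RingHom.comp_apply, η_b]
      exact (hk _).trans (by simp)
    · exact (hk _).trans (by simp)
  hom_ext {T _ k k'} h hy := by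
    refine Ideal.Quotient.ringHom_ext (MvPolynomial.ringHom_ext (fun r => ?_) fun n => ?_)
    · have := RingHom.congr_fun h (algebraMap A _ r)
      rw [RingHom.comp_apply, RingHom.comp_apply, η_algebraMap] at this
      exact this
    · fin_cases n
      · have := RingHom.congr_fun h (HyperbolaRing.a m.w₀)
        rw [RingHom.comp_apply, RingHom.comp_apply, η_a] at this
        exact this
      · exact hy
      · have := RingHom.congr_fun h (HyperbolaRing.b m.w₀)
        rw [RingHom.comp_apply, RingHom.comp_apply, η_b] at this
        exact this

section Fibre

variable (I : Ideal A)

/-- The two components of the fibre of the spectrum of `A[x, w] / (x w - w₀)`, up to closed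
points. -/
def fibreHom : Bool → m.BaseRing →+* LaurentPolynomial (A ⧸ I)
  | true => HyperbolaRing.laurentA (Ideal.Quotient.mk I)
  | false => HyperbolaRing.laurentB (Ideal.Quotient.mk I)

variable {I}

lemma fibreHom_algebraMap (k : Bool) (r : A) :
    m.fibreHom I k (algebraMap A _ r) = .C (Ideal.Quotient.mk I r) := by
  cases k <;> simp [fibreHom]

lemma mem_map_of_fibreHom {z : m.BaseRing} (h : ∀ k, m.fibreHom I k z = 0) :
    z ∈ I.map (algebraMap A m.BaseRing) :=
  HyperbolaRing.mem_map_of_laurent (ι := Unit) (fun _ => Ideal.Quotient.mk I)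
    (fun _ hr => Ideal.Quotient.eq_zero_iff_mem.mp (hr ())) (fun _ => h true) (fun _ => h false)

lemma ne_zero_of_coeff_ne_zero {K : Type} [CommRing K] {f : LaurentPolynomial K} (n : ℤ)
    (h : f.coeff n ≠ 0) : f ≠ 0 := by
  rintro rfl
  exact h rfl

/-- On this component `x = T` and `w = w₀ T⁻¹`, so the term `x` of `t` contributes `T` with
coefficient `1` and the other terms have exponent at most `0`. -/
lemma fibreHom_true_baseT [hI : I.IsMaximal] : m.fibreHom I true m.baseT ≠ 0 := by
  have e : m.fibreHom I true m.baseT = .C 1 * .T 1 + .C (Ideal.Quotient.mk I m.β₄) * .T 0 +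
      .C (Ideal.Quotient.mk I (m.w₀ * m.β₂)) * .T (-1) +
      .C (Ideal.Quotient.mk I (m.w₀ ^ 2 * m.β₀)) * .T (-2) := by
    have h2 : (.T (-1) ^ 2 : LaurentPolynomial (A ⧸ I)) = .T (-2) := LaurentPolynomial.T_pow _ _
    simp only [fibreHom, baseT, map_add, map_mul, map_pow, HyperbolaRing.laurentA_algebraMap,
      HyperbolaRing.laurentA_a, HyperbolaRing.laurentA_b, map_one, LaurentPolynomial.T_zero,
      ← h2]
    ring
  refine ne_zero_of_coeff_ne_zero 1 ?_
  rw [e]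
  simp only [AddMonoidAlgebra.coeff_add, Finsupp.add_apply, HyperbolaRing.coeff_C_mul_T]
  simp

/-- On this component `w = T` and `x = w₀ T⁻¹`, so `w₀, β₄, β₂, β₀` are the coefficients of four
distinct powers of `T`. -/
lemma fibreHom_false_baseT (h : m.fibreHom I false m.baseT = 0) :
    m.w₀ ∈ I ∧ m.β₄ ∈ I ∧ m.β₂ ∈ I ∧ m.β₀ ∈ I := by
  have e : m.fibreHom I false m.baseT = .C (Ideal.Quotient.mk I m.w₀) * .T (-1) +
      .C (Ideal.Quotient.mk I m.β₄) * .T 0 + .C (Ideal.Quotient.mk I m.β₂) * .T 1 +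
      .C (Ideal.Quotient.mk I m.β₀) * .T 2 := by
    have h2 : (.T 1 ^ 2 : LaurentPolynomial (A ⧸ I)) = .T 2 := LaurentPolynomial.T_pow _ _
    simp only [fibreHom, baseT, map_add, map_mul, map_pow, HyperbolaRing.laurentB_algebraMap,
      HyperbolaRing.laurentB_a, HyperbolaRing.laurentB_b, LaurentPolynomial.T_zero, ← h2]
    ring
  rw [e] at h
  have key := fun n : ℤ => congrArg (fun f : LaurentPolynomial (A ⧸ I) => f.coeff n) h
  simp only [AddMonoidAlgebra.coeff_add, Finsupp.add_apply, HyperbolaRing.coeff_C_mul_T] at key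
  simp only [← Ideal.Quotient.eq_zero_iff_mem]
  exact ⟨by simpa using key (-1), by simpa using key 0, by simpa using key 1, by simpa using key 2⟩

lemma fibreHom_false_γ (h : m.fibreHom I false m.γ = 0) : m.β₅ ∈ I ∧ m.β₃ ∈ I := by
  have e : m.fibreHom I false m.γ = .C (Ideal.Quotient.mk I m.β₅) * .T 0 +
      .C (Ideal.Quotient.mk I m.β₃) * .T 1 := by
    simp only [fibreHom, γ, map_add, map_mul, HyperbolaRing.laurentB_algebraMap,
      HyperbolaRing.laurentB_b, LaurentPolynomial.T_zero]
    ring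
  rw [e] at h
  have key := fun n : ℤ => congrArg (fun f : LaurentPolynomial (A ⧸ I) => f.coeff n) h
  simp only [AddMonoidAlgebra.coeff_add, Finsupp.add_apply, HyperbolaRing.coeff_C_mul_T] at key
  simp only [← Ideal.Quotient.eq_zero_iff_mem]
  exact ⟨by simpa using key 0, by simpa using key 1⟩

lemma T_ne_zero {K : Type} [CommRing K] [Nontrivial K] (n : ℤ) :
    (.T n : LaurentPolynomial K) ≠ 0 :=
  (LaurentPolynomial.isUnit_T n).ne_zero

end Fibre

/-- On each component of each fibre over the base, `d` does not vanish or at most one of the three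
functions vanishes. -/
def IsRegularOnFibres (d : m.BaseRing) (v : Fin 3 → m.BaseRing) : Prop :=
  ∀ I : Ideal A, I.IsMaximal → ∀ k, m.fibreHom I k d ≠ 0 ∨
    Pairwise fun i j => m.fibreHom I k (v i) ≠ 0 ∨ m.fibreHom I k (v j) ≠ 0

variable {m} in
lemma IsRegularOnFibres.false {d : m.BaseRing} {v : Fin 3 → m.BaseRing}
    (h : m.IsRegularOnFibres d v) {I : Ideal A} (hI : I.IsMaximal) (k : Bool)
    (hd : m.fibreHom I k d = 0) {i j : Fin 3} (hi : m.fibreHom I k (v i) = 0)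
    (hj : m.fibreHom I k (v j) = 0) (hij : i ≠ j) : False := by
  obtain h | h := h I hI k
  · exact h hd
  · exact (h hij).elim (fun h => h hi) fun h => h hj

variable {m} in
lemma IsRegularOnFibres.perm {d : m.BaseRing} {v : Fin 3 → m.BaseRing}
    (h : m.IsRegularOnFibres d v) (e : Equiv.Perm (Fin 3)) : m.IsRegularOnFibres d (v ∘ e) :=
  fun I hI k => (h I hI k).imp_right fun h _ _ hij => h (e.injective.ne hij)

variable {m} in
lemma IsRegularOnFibres.neg {d : m.BaseRing} {v : Fin 3 → m.BaseRing}
    (h : m.IsRegularOnFibres d v) : m.IsRegularOnFibres (-d) v :=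
  fun I hI k => (h I hI k).imp_left fun h => by rwa [map_neg, neg_ne_zero]

/-- On the component with `x = T` neither `x` nor `t` vanishes. On the one with `w = T`, `w` does
not vanish; if both `γ` and `t` did, their coefficients would put all six parameters in `I`, against
the absence of common zeros. -/
lemma isRegularOnFibres (h : Ideal.span {m.w₀, m.β₀, m.β₂, m.β₃, m.β₄, m.β₅} = ⊤) :
    m.IsRegularOnFibres m.γ m.baseU := by
  have aux : ∀ {K : Type} [CommRing K] (f : Fin 3 → K) (l : Fin 3), (∀ i, i ≠ l → f i ≠ 0) →
      Pairwise fun i j => f i ≠ 0 ∨ f j ≠ 0 := fun f l hf i j hij => by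
    by_cases hi : i = l
    · exact .inr (hf j fun hj => hij (hi.trans hj.symm))
    · exact .inl (hf i hi)
  intro I hI k
  cases k with
  | true =>
    refine .inr (aux (fun i => m.fibreHom I true (m.baseU i)) 1 fun i hi => ?_)
    fin_cases i
    · change HyperbolaRing.laurentA (Ideal.Quotient.mk I) (HyperbolaRing.a m.w₀) ≠ 0
      rw [HyperbolaRing.laurentA_a]
      exact T_ne_zero 1
    · exact absurd rfl hi
    · exact m.fibreHom_true_baseT
  | false =>
    refine or_iff_not_imp_left.mpr fun hγ =>
      (aux (fun i => m.fibreHom I false (m.baseU i)) 0 fun i hi => ?_)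
    fin_cases i
    · exact absurd rfl hi
    · change HyperbolaRing.laurentB (Ideal.Quotient.mk I) (HyperbolaRing.b m.w₀) ≠ 0
      rw [HyperbolaRing.laurentB_b]
      exact T_ne_zero 1
    · intro ht
      obtain ⟨h₅, h₃⟩ := m.fibreHom_false_γ (not_not.mp hγ)
      obtain ⟨h₀, h₄, h₂, h₁⟩ := m.fibreHom_false_baseT ht
      refine hI.ne_top (eq_top_iff.mpr ?_)
      rw [← h, Ideal.span_le]
      simp only [Set.insert_subset_iff, Set.singleton_subset_iff, SetLike.mem_coe]
      exact ⟨h₀, h₁, h₂, h₃, h₄, h₅⟩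

open Polynomial in
lemma flat_polynomial_quotient (f : m.BaseRing[X])
    (hf : ∀ I : Ideal A, I.IsMaximal → ∀ k, f.map (m.fibreHom I k) ≠ 0) :
    Module.Flat A (m.BaseRing[X] ⧸ Ideal.span {f}) := by
  have : Module.Free A m.BaseRing[X] := Module.Free.trans (S := m.BaseRing)
  refine flat_quotient_span_singleton f fun I hI => ⟨Bool, (LaurentPolynomial (A ⧸ I))[X],
    inferInstance, inferInstance, fun k => mapRingHom (m.fibreHom I k), fun k a ha => ?_,
    fun k => hf I hI k, fun n hn => ?_⟩
  · rw [IsScalarTower.algebraMap_apply A m.BaseRing, Polynomial.algebraMap_apply, Algebra.algebraMap_self,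
      RingHom.id_apply, coe_mapRingHom, map_C, fibreHom_algebraMap,
      Ideal.Quotient.eq_zero_iff_mem.mpr ha, map_zero, map_zero]
  · have h : n ∈ (I.map (algebraMap A m.BaseRing)).map C := by
      rw [Ideal.mem_map_C_iff]
      refine fun i => m.mem_map_of_fibreHom fun k => ?_
      have := congrArg (fun p => p.coeff i) (hn k)
      simpa using this
    rw [Ideal.map_map] at h
    exact h

/-- Four homomorphisms to a ring of iterated Laurent polynomials over a field detect each fibre: two
branches of the hyperbola over each of the two components of the fibre of `BaseRing`. -/
lemma flat_hyperbola_quotient (c : m.BaseRing) (f : HyperbolaRing m.BaseRing c)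
    (hA : ∀ I : Ideal A, I.IsMaximal → ∀ k, HyperbolaRing.laurentA (m.fibreHom I k) f ≠ 0)
    (hB : ∀ I : Ideal A, I.IsMaximal → ∀ k, HyperbolaRing.laurentB (m.fibreHom I k) f ≠ 0) :
    Module.Flat A (HyperbolaRing m.BaseRing c ⧸ Ideal.span {f}) := by
  have : Module.Free A (HyperbolaRing m.BaseRing c) := Module.Free.trans (S := m.BaseRing)
  have hC : ∀ a : A, algebraMap A (HyperbolaRing m.BaseRing c) a =
      algebraMap m.BaseRing _ (algebraMap A _ a) :=
    IsScalarTower.algebraMap_apply A m.BaseRing (HyperbolaRing m.BaseRing c)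
  refine flat_quotient_span_singleton f fun I hI => ⟨Bool × Bool,
    LaurentPolynomial (LaurentPolynomial (A ⧸ I)), inferInstance, inferInstance,
    fun k => bif k.1 then HyperbolaRing.laurentA (m.fibreHom I k.2) else
      HyperbolaRing.laurentB (m.fibreHom I k.2), ?_, ?_, fun n hn => ?_⟩
  · rintro ⟨k, k'⟩ a ha
    cases k <;>
    simp [hC, fibreHom_algebraMap, Ideal.Quotient.eq_zero_iff_mem.mpr ha]
  · rintro ⟨k, k'⟩
    cases k
    exacts [hB I hI k', hA I hI k']
  · have h : n ∈ (I.map (algebraMap A m.BaseRing)).map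
        (algebraMap m.BaseRing (HyperbolaRing m.BaseRing c)) :=
      HyperbolaRing.mem_map_of_laurent (m.fibreHom I) (fun r hr => m.mem_map_of_fibreHom hr)
        (fun k => hn (true, k)) (fun k => hn (false, k))
    rw [Ideal.map_map] at h
    exact h

lemma η_comp_algebraMap : m.η.comp (algebraMap A m.BaseRing) = algebraMap A m.PatchRing :=
  RingHom.ext m.η_algebraMap

lemma flat_patch_quotient :
    RingHom.Flat (S := m.FibrationRing) ((Ideal.Quotient.mk _).comp (algebraMap A m.PatchRing)) := by
  rw [← η_comp_algebraMap]
  refine flat_cone (m.baseU 0 * m.baseU 1 * m.baseU 2) m.γ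
    (m.flat_polynomial_quotient _ fun I hI k h => ?_) m.isPolynomialOver_y ?_
  -- The equation of ℰ is monic of degree two in `y`, so it stays nonzero on every fibre component
  -- without conditions on the coefficients.
  · have := congrArg (fun p => p.coeff 2) h
    simp [Polynomial.coeff_X, mul_add] at this
  · rw [← s_eq, map_mul, map_mul, η_baseU, η_baseU, η_baseU]
    rfl

variable {m} {d : m.BaseRing} {v : Fin 3 → m.BaseRing}

lemma IsRegularOnFibres.flat_chart₀₁ (h : m.IsRegularOnFibres d v) {u₁ u₂ u₃ v₁ v₂ : m.PatchRing}
    (h₁ : m.η (v 0) = u₁) (h₂ : m.η (v 1) = u₂) (h₃ : m.η (v 2) = u₃)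
    (hv : IsPolynomialOver m.η v₁) (hv' : v₂ = v₁ + m.η d) :
    ((algebraMap _ (ChartRing u₁ u₂ u₃ v₁ v₂ 0 1)).comp
      (algebraMap A m.PatchRing)).Flat := by
  subst h₁ h₂ h₃
  rw [← η_comp_algebraMap]
  refine SU5.flat_chart₀₁ hv hv' (m.flat_polynomial_quotient _ fun I hI k h0 => ?_)
  -- The coefficients of `1, X, X²` are `v 0`, `d` and `-(v 1) (v 2)`. If all vanish, then so do
  -- `d`, `v 0` and one of `v 1`, `v 2`, against regularity.
  have h1 := congrArg (fun p => p.coeff 0) h0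
  have h2 := congrArg (fun p => p.coeff 1) h0
  have h3 := congrArg (fun p => p.coeff 2) h0
  simp [Polynomial.coeff_C, Polynomial.coeff_X, mul_sub] at h1 h2 h3
  obtain h3 | h3 := h3
  exacts [h.false hI k h2 h1 h3 (by decide), h.false hI k h2 h1 h3 (by decide)]

lemma IsRegularOnFibres.flat_chart₁₁ (h : m.IsRegularOnFibres d v) {u₁ u₂ u₃ v₁ v₂ : m.PatchRing}
    (h₁ : m.η (v 0) = u₁) (h₂ : m.η (v 1) = u₂) (h₃ : m.η (v 2) = u₃)
    (hv : IsPolynomialOver m.η v₁) (hv' : v₂ = v₁ + m.η d) :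
    ((algebraMap _ (ChartRing u₁ u₂ u₃ v₁ v₂ 1 1)).comp
      (algebraMap A m.PatchRing)).Flat := by
  subst h₁ h₂ h₃
  rw [← η_comp_algebraMap]
  refine SU5.flat_chart₁₁ hv hv' (m.flat_hyperbola_quotient _ _ (fun I hI k h0 => ?_)
    fun I hI k h0 => ?_)
  -- The three terms have different exponents `-1, 1, 0`, so vanishing forces `d = 0`, `v 0 = 0` and
  -- `(v 1) (v 2) = 0`. The other branch is symmetric, with `v 0` and `v 1` exchanged.
  · have e : HyperbolaRing.laurentA (m.fibreHom I k) (algebraMap _ _ (v 1) * HyperbolaRing.b (v 2) -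
        algebraMap _ _ (v 0) * HyperbolaRing.a (v 2) - algebraMap _ _ d) =
        .C (m.fibreHom I k (v 1 * v 2)) * .T (-1) + .C (- m.fibreHom I k (v 0)) * .T 1 +
          .C (- m.fibreHom I k d) * .T 0 := by
      simp only [map_sub, map_mul, map_neg, HyperbolaRing.laurentA_algebraMap,
        HyperbolaRing.laurentA_a, HyperbolaRing.laurentA_b, LaurentPolynomial.T_zero]
      ring
    rw [e] at h0
    have key := fun n : ℤ => congrArg (fun f : LaurentPolynomial _ => f.coeff n) h0
    simp only [AddMonoidAlgebra.coeff_add, Finsupp.add_apply, HyperbolaRing.coeff_C_mul_T] at key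
    have h1 : m.fibreHom I k (v 0) = 0 := by simpa using key 1
    have h2 : m.fibreHom I k d = 0 := by simpa using key 0
    have h3 : m.fibreHom I k (v 1) = 0 ∨ m.fibreHom I k (v 2) = 0 := by simpa using key (-1)
    obtain h3 | h3 := h3
    exacts [h.false hI k h2 h1 h3 (by decide), h.false hI k h2 h1 h3 (by decide)]
  · have e : HyperbolaRing.laurentB (m.fibreHom I k) (algebraMap _ _ (v 1) * HyperbolaRing.b (v 2) -
        algebraMap _ _ (v 0) * HyperbolaRing.a (v 2) - algebraMap _ _ d) =
        .C (m.fibreHom I k (v 1)) * .T 1 + .C (- m.fibreHom I k (v 0 * v 2)) * .T (-1) +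
          .C (- m.fibreHom I k d) * .T 0 := by
      simp only [map_sub, map_mul, map_neg, HyperbolaRing.laurentB_algebraMap,
        HyperbolaRing.laurentB_a, HyperbolaRing.laurentB_b, LaurentPolynomial.T_zero]
      ring
    rw [e] at h0
    have key := fun n : ℤ => congrArg (fun f : LaurentPolynomial _ => f.coeff n) h0
    simp only [AddMonoidAlgebra.coeff_add, Finsupp.add_apply, HyperbolaRing.coeff_C_mul_T] at key
    have h1 : m.fibreHom I k (v 1) = 0 := by simpa using key 1
    have h2 : m.fibreHom I k d = 0 := by simpa using key 0
    have h3 : m.fibreHom I k (v 0) = 0 ∨ m.fibreHom I k (v 2) = 0 := by simpa using key (-1)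
    obtain h3 | h3 := h3
    exacts [h.false hI k h2 h1 h3 (by decide), h.false hI k h2 h1 h3 (by decide)]

variable (m)

theorem flat_fibration : Flat (m.fibrationι ≫ m.patchToBase) := by
  rw [fibrationι, patchToBase, ← Spec.map_comp, HasRingHomProperty.Spec_iff (P := @Flat)]
  exact m.flat_patch_quotient

lemma flat_specMap_patchToBase {S : Type} [CommRing S] (f : m.PatchRing →+* S)
    (hf : (f.comp (algebraMap A m.PatchRing)).Flat) :
    Flat (Spec.map (CommRingCat.ofHom f) ≫ m.patchToBase) := by
  rw [patchToBase, ← Spec.map_comp, HasRingHomProperty.Spec_iff (P := @Flat)]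
  exact hf

theorem flat_resolution (e : Equiv.Perm (Fin 3))
    (h : Ideal.span {m.w₀, m.β₀, m.β₂, m.β₃, m.β₄, m.β₅} = ⊤) :
    Flat (m.resolutionToPatch e ≫ m.patchToBase) := by
  have hr := m.isRegularOnFibres h
  have hf := m.isZeroScheme_resolution e
  -- The chart `(1, 0)` is the chart `(0, 1)` of the swapped equations, where `s` is the free
  -- variable and `y = s - γ`; hence the sign of `γ` and the transposition below.
  have hs : IsPolynomialOver m.η m.s := m.s_eq ▸ m.isPolynomialOver_y.add m.γ
  have hy : m.y = m.s + m.η (-m.γ) := by rw [s_eq, map_neg, add_neg_cancel_right]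
  refine of_forall_exists_isOpenImmersion @Flat _ fun z => ?_
  obtain hz | hz | hz := hf.exists_mem_range_chart z
  · refine ⟨_, hf.chart 1 1, hf.isOpenImmersion_chart 1 1, hz, ?_⟩
    rw [← resolutionι_toBase, ← Category.assoc, hf.chart_toBase]
    exact m.flat_specMap_patchToBase _ ((hr.perm e).flat_chart₁₁
      (m.η_baseU _) (m.η_baseU _) (m.η_baseU _) m.isPolynomialOver_y m.s_eq)
  · refine ⟨_, hf.chart 0 1, hf.isOpenImmersion_chart 0 1, hz, ?_⟩
    rw [← resolutionι_toBase, ← Category.assoc, hf.chart_toBase]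
    exact m.flat_specMap_patchToBase _ ((hr.perm e).flat_chart₀₁
      (m.η_baseU _) (m.η_baseU _) (m.η_baseU _) m.isPolynomialOver_y m.s_eq)
  · rw [← hf.range_swap_chart] at hz
    have hb := hf.swap.chart_toBase 0 1
    rw [IsZeroScheme.swap_toBase, resolutionι_toBase] at hb
    refine ⟨_, hf.swap.chart 0 1, hf.swap.isOpenImmersion_chart 0 1, hz, ?_⟩
    rw [← Category.assoc, hb]
    exact m.flat_specMap_patchToBase _ ((hr.neg.perm ((Equiv.swap 0 1).trans e)).flat_chart₀₁
      (m.η_baseU _) (m.η_baseU _) (m.η_baseU _) hs hy)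

end Model

end

end

end SU5

/-! ### The properties of the six small resolutions assembled -/

theorem mainTheorem3 {A : Type} [CommRing A] [Algebra ℂ A] (m : SU5.Model A)
    (e : Equiv.Perm (Fin 3)) :
    ∃ π : m.resolution e ⟶ m.fibration,
      π ≫ m.fibrationι = m.resolutionToPatch e ∧
      -- a proper modification which is an isomorphism off the three lines
      IsProper π ∧
      IsIso (π ∣_ m.offLines) ∧
      -- the fibre over a point of exactly one line is a projective line
      (∀ q : m.fibration, m.fibrationι q ∈ m.lines → m.fibrationι q ∉ m.triple →
        ∃ φ : π.fiber q ≅ SU5.P1 (Spec (m.fibration.residueField q)),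
          φ.hom ≫ SU5.P1.toBase _ = π.fiberToSpecResidueField q) ∧
      -- the fibre over a triple point is two projective lines meeting at a point
      (∀ q : m.fibration, m.fibrationι q ∈ m.triple →
        SU5.IsTwoLinesMeetingAtPoint (π.fiberToSpecResidueField q)) ∧
      -- the fibres over the divisor `w₀ = 0` of the base are cut out by `w x = 0`
      (∀ p : m.resolution e,
        (m.resolutionToPatch e ≫ m.patchToBase) p ∈ PrimeSpectrum.zeroLocus {m.w₀} ↔
          m.resolutionToPatch e p ∈ PrimeSpectrum.zeroLocus {m.w * m.x}) ∧
      -- flatness, before and after the resolution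
      Flat (m.fibrationι ≫ m.patchToBase) ∧
      (Ideal.span {m.w₀, m.β₀, m.β₂, m.β₃, m.β₄, m.β₅} = ⊤ →
        Flat (m.resolutionToPatch e ≫ m.patchToBase)) ∧
      -- where `x, w, t, y, s` are part of a local coordinate system of the ambient space
      (∀ U : m.patch.Opens, Smooth (U.ι ≫ m.coords) →
        -- the lines are the singular locus of the fibration
        (∀ V : m.fibration.Opens, V ≤ m.fibrationι ⁻¹ᵁ U →
          (Smooth (V.ι ≫ m.fibrationι ≫ m.patchToC) ↔ V ≤ m.offLines)) ∧
        -- smoothness of the resolution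
        Smooth ((m.resolutionToPatch e ⁻¹ᵁ U).ι ≫ m.resolutionToPatch e ≫ m.patchToC) ∧
        -- smallness: the lines have codimension at least three, the exceptional locus at least two
        (∀ q : m.fibration, m.fibrationι q ∈ U → m.fibrationι q ∈ m.lines →
          3 ≤ ringKrullDim (m.fibration.presheaf.stalk q)) ∧
        (∀ p : m.resolution e, m.resolutionToPatch e p ∈ U → m.resolutionToPatch e p ∈ m.lines →
          2 ≤ ringKrullDim ((m.resolution e).presheaf.stalk p)) ∧
        -- different permutations give different resolutions near a triple point
        ((∃ q : m.patch, q ∈ U ∧ q ∈ m.triple) →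
          ∀ e' : Equiv.Perm (Fin 3), e' ≠ e →
            IsEmpty (Over.mk (m.resolutionToPatch e) ≅ Over.mk (m.resolutionToPatch e')))) := by
  refine ⟨m.π e, m.π_fibrationι e, inferInstance, m.isIso_π_restrict e le_rfl,
    fun q h h' => m.exists_iso_fiber e q h h', fun q h => m.isTwoLinesMeetingAtPoint_fiber e q h,
    m.resolution_mem_divisor_iff e, m.flat_fibration, m.flat_resolution e, fun U hU =>
    ⟨fun V hV => SU5.Model.smooth_fibration_iff hU hV, SU5.Model.smooth_resolution e hU,
      SU5.Model.three_le_ringKrullDim_fibration hU,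
      SU5.Model.two_le_ringKrullDim_resolution e hU, ?_⟩⟩
  rintro ⟨q, hq, hq'⟩ e' he
  exact SU5.Model.isEmpty_iso_resolution e hU hq hq' he
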